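/- **Conventions.** All groups are countable and discrete, $R$ is a commutative ring with unit and $W$ an $R$-module. A map $\varphi:G\to H$ is a *coarse map* if all preimages $\varphi^{-1}(\{y\})$ are finite and, for every $S\subseteq G\times G$ with $\{st^{-1}:(s,t)\in S\}$ finite, $\{\varphi(s)\varphi(t)^{-1}:(s,t)\in S\}$ is finite; it is a *coarse embedding* if, for every $S\subseteq G\times G$, the first set is finite if and only if the second is (coarse embeddings are coarse maps). Maps $\varphi,\phi$ are *close*, $\varphi\sim\phi$, if $\{\varphi(x)\phi(x)^{-1}:x\in G\}$ is finite. $C(G,W)$ is the module of all functions $G\to W$ with $(g.f)(x)=f(g^{-1}x)$. An $RG$-submodule $L\subseteq C(G,W)$ is *res-invariant* if $1_A\cdot f\in L$ for all $f\in L$, $A\subseteq G$. Put $\varphi_*(f)(y)=\sum_{\varphi(x)=y}f(x)$ and $\varphi^*(f)=f\circ\varphi$. Let $\varphi_*L\subseteq C(H,W)$ be the smallest res-invariant $RH$-submodule containing all $\varphi_*(f)$, $f\in L$; for a res-invariant $RH$-submodule $M\subseteq C(H,W)$ let $\varphi^*M\subseteq C(G,W)$ be the smallest res-invariant $RG$-submodule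 containing all $\varphi^*(f)$, $f\in M$; and let $\varphi^{*-1}L=\{f\in C(H,W):\varphi^*(h.f)\in L\text{ for all }h\in H\}$. *(Co)homology.* $H_n(G,L)$ and $H^n(G,L)$ are computed by the (inhomogeneous) bar complexes, whose $n$-chains are the finitely supported functions $c:G^n\to L$ and whose $n$-cochains are all functions $c:G^n\to L$. View $c$ as the function $(x,\vec g)\mapsto c(\vec g)(x)$ on $G\times G^n$. A map $\varphi:G\to H$ gives $\varphi^n:G\times G^n\to H\times H^n$, $(x,g_1,\dots,g_n)\mapsto(\varphi(x_1),h_1,\dots,h_n)$ with $x_1=x$, $x_{i+1}=g_i^{-1}x_i$, $h_i=\varphi(x_i)\varphi(x_{i+1})^{-1}$. Let $D_n(\varphi)$ be the map on chains $c\mapsto(\varphi^n)_*c$, $(\varphi^n)_*c(\eta)=\sum_{\varphi^n(\gamma)=\eta}c(\gamma)$, and $D^n(\varphi)$ the map on cochains $c\mapsto c\circ\varphi^n$. *The map $\omega$.* For a coarse embedding $\varphi$, put $Y=\varphi(G)$, choose $X\subseteq G$ that $\varphi$ maps bijectively onto $Y$ and an enumeration $h_1=e,h_2,\dots$ of $H$,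 and let $\omega(y)\in X$ be the point with $\varphi(\omega(y))=h_j^{-1}y$, where $j$ is minimal with $h_j^{-1}y\in Y$. *Topological case.* $R$ is a topological field (the statement is made for any commutative topological ring). A topological res-invariant module is a res-invariant $L$ with a topology making it a topological $R$-module such that all maps $f\mapsto1_A\cdot f$ and $f\mapsto g.f$ are continuous. For such modules $L$ over $G$ and $M$ over $H$, $\varphi_*L$ (resp. $\varphi^*M$) carries the finest topology making it a topological res-invariant module and $f\mapsto\varphi_*(f)$, $L\to\varphi_*L$ (resp. $f\mapsto\varphi^*(f)$, $M\to\varphi^*M$) continuous, and $\varphi^{*-1}L$ the coarsest topology making it a topological res-invariant module and $\varphi^*:\varphi^{*-1}L\to L$ continuous. Chains and cochains carry the topology of pointwise convergence on $G^n$. Reduced (co)homology $\bar H_n$, $\bar H^n$ is the kernel of the differential modulo the closure (in that kernel) of the image, with the quotient topology. **Theorem.** Let $\varphi:G\to H$ be a coarse map, $L\subseteq C(G,W)$ a res-invariant $RG$-submodule and $M\subseteq C(H,W)$ a res-invariant $RH$-submodule. (i) The maps $D_n(\varphi)$ are well defined, form a chain map and induce homomorphisms $H_n(\varphi):H_n(G,L)\to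 H_n(H,\varphi_*L)$ for all $n\ge0$. If $\varphi$ is a coarse embedding, then $D_*(\omega)$ is a well-defined chain map as well, and $H_n(\varphi)$ is an isomorphism with inverse $H_n(\omega)$. If in addition $L$ is a topological res-invariant module, $D_*(\varphi)$ also induces topological isomorphisms $\bar H_n(\varphi):\bar H_n(G,L)\cong\bar H_n(H,\varphi_*L)$. If $\phi:G\to H$ is a coarse map with $\varphi\sim\phi$, then $\varphi_*L=\phi_*L$ and $H_n(\varphi)=H_n(\phi)$; in the topological case with $\varphi$ a coarse embedding, $\varphi_*L=\phi_*L$ also topologically, and $\bar H_n(\varphi)=\bar H_n(\phi)$. If $\psi:H\to K$ is another coarse map, then $\psi_*\varphi_*L=(\psi\circ\varphi)_*L$ and $H_n(\psi\circ\varphi)=H_n(\psi)\circ H_n(\varphi)$; in the topological case with $\varphi,\psi$ coarse embeddings, the equality of modules is topological, and $\bar H_n(\psi\circ\varphi)=\bar H_n(\psi)\circ\bar H_n(\varphi)$. (ii) The maps $D^n(\varphi)$ are well defined, form a cochain map and induce homomorphisms $H^n(\varphi):H^n(H,M)\to H^n(G,\varphi^*M)$ for all $n\ge0$. If $\varphi$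 is a coarse embedding, then $\varphi^*\varphi^{*-1}L=L$, $D^*(\omega)$ is a well-defined cochain map, and $H^n(\varphi):H^n(H,\varphi^{*-1}L)\to H^n(G,L)$ is an isomorphism with inverse $H^n(\omega)$. If in addition $L$ and $M$ are topological res-invariant modules, then $\varphi^*\varphi^{*-1}L=L$ also topologically, and $D^*(\varphi)$ induces continuous homomorphisms $\bar H^n(\varphi):\bar H^n(H,M)\to\bar H^n(G,\varphi^*M)$ and topological isomorphisms $\bar H^n(\varphi):\bar H^n(H,\varphi^{*-1}L)\cong\bar H^n(G,L)$. If $\phi:G\to H$ is a coarse map with $\varphi\sim\phi$, then $\varphi^*M=\phi^*M$ and $H^n(\varphi)=H^n(\phi)$; in the topological case with $\varphi$ a coarse embedding, $\varphi^*M=\phi^*M$ also topologically, and $\bar H^n(\varphi)=\bar H^n(\phi)$. If $\psi:H\to K$ is another coarse map and $N\subseteq C(K,W)$ a res-invariant $RK$-submodule, then $\varphi^*\psi^*N=(\psi\circ\varphi)^*N$ and $H^n(\psi\circ\varphi)=H^n(\varphi)\circ H^n(\psi)$; in the topological case with $\varphi,\psi$ coarse embeddings, the equality of modules is topological, and $\bar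 H^n(\psi\circ\varphi)=\bar H^n(\varphi)\circ\bar H^n(\psi)$. -/

import Mathlib

open CategoryTheory

universe u

/-! ### Coarse maps -/

section Coarse

variable {G H : Type*} [Group G] [Group H]

/-- `φ` is a coarse map: point preimages are finite, and `{φ s (φ t)⁻¹ | (s, t) ∈ S}` is finite
whenever `{s t⁻¹ | (s, t) ∈ S}` is finite. -/
structure IsCoarseMap (φ : G → H) : Prop where
  finite_preimage : ∀ y : H, (φ ⁻¹' {y}).Finite
  finite_image : ∀ S : Set (G × G), ((fun p : G × G => p.1 * p.2⁻¹) '' S).Finite →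
    ((fun p : G × G => φ p.1 * (φ p.2)⁻¹) '' S).Finite

/-- `φ` is a coarse embedding. -/
def IsCoarseEmbedding (φ : G → H) : Prop :=
  ∀ S : Set (G × G), ((fun p : G × G => p.1 * p.2⁻¹) '' S).Finite ↔
    ((fun p : G × G => φ p.1 * (φ p.2)⁻¹) '' S).Finite

/-- Two maps are close if `{φ x (ϕ x)⁻¹ | x ∈ G}` is finite. -/
def IsClose (φ ϕ : G → H) : Prop :=
  (Set.range fun x => φ x * (ϕ x)⁻¹).Finite

/-- `ω : H → G` is a map obtained from `φ : G → H` by the following construction. Put `Y = φ(G)`,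
choose `X ⊆ G` such that `φ` restricts to a bijection `X → Y`, and an enumeration
`e 0 = 1, e 1, e 2, …` of `H` (repetitions allowed, so that `H` may be finite). Every `y : H` lies
in exactly one of the disjoint sets `e j • Y_j = e j • Y \ ⋃ i < j, e i • Y`, and `ω y` is then the
point of `X` that `φ` maps to `(e j)⁻¹ * y`. -/
def IsCoarseInverse (φ : G → H) (ω : H → G) : Prop :=
  ∃ (X : Set G) (e : ℕ → H), Set.BijOn φ X (Set.range φ) ∧ Function.Surjective e ∧ e 0 = 1 ∧
    ∀ y : H, ∃ j : ℕ, (∀ i < j, (e i)⁻¹ * y ∉ Set.range φ) ∧ ω y ∈ X ∧ φ (ω y) = (e j)⁻¹ * y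

theorem exists_isCoarseInverse [Countable H] (φ : G → H) : ∃ ω : H → G, IsCoarseInverse φ ω := by
  classical
  obtain ⟨e', he'⟩ := exists_surjective_nat H
  let e : ℕ → H := fun n => Nat.casesOn n 1 e'
  have he : Function.Surjective e := fun y => by
    obtain ⟨n, hn⟩ := he' y
    exact ⟨n + 1, hn⟩
  have hs : ∀ y : Set.range φ, ∃ x, φ x = y := fun y => y.2
  choose s hs using hs
  have hex : ∀ y : H, ∃ j, (e j)⁻¹ * y ∈ Set.range φ := fun y => by
    obtain ⟨j, hj⟩ := he (y * (φ 1)⁻¹)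
    exact ⟨j, 1, by rw [hj]; group⟩
  refine ⟨fun y => s ⟨_, Nat.find_spec (hex y)⟩, Set.range s, e, ⟨?_, ?_, ?_⟩, he, rfl, ?_⟩
  · rintro _ ⟨a, rfl⟩
    exact ⟨s a, rfl⟩
  · rintro _ ⟨a, rfl⟩ _ ⟨b, rfl⟩ h
    rw [hs, hs] at h
    rw [Subtype.ext h]
  · intro y hy
    exact ⟨s ⟨y, hy⟩, ⟨_, rfl⟩, hs _⟩
  · intro y
    exact ⟨Nat.find (hex y), fun i hi => Nat.find_min (hex y) hi, ⟨_, rfl⟩, hs _⟩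

/-- The pushforward `u_* f (y) = ∑_{u x = y} f x`. -/
noncomputable def fiberSum {X Y W : Type*} [AddCommMonoid W] (u : X → Y) (f : X → W) : Y → W :=
  fun y => ∑ᶠ x ∈ u ⁻¹' {y}, f x

/-- Left translation `(g.f)(x) = f (g⁻¹ x)`. -/
def leftTranslate {W : Type*} (g : G) (f : G → W) : G → W := fun x => f (g⁻¹ * x)

/-- The map `φⁿ : 𝒢⁽ⁿ⁾ → ℋ⁽ⁿ⁾` induced by `φ : G → H` on composable `n`-tuples of the
transformation groupoids of `G` acting on `G` and of `H` acting on `H` by left multiplication.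
The tuple `((x₁, g₁), …, (xₙ, gₙ))`, with `xᵢ₊₁ = gᵢ⁻¹ xᵢ`, is written `(x₁, (g₁, …, gₙ))`, so that
`xᵢ = (g₁ ⋯ gᵢ₋₁)⁻¹ x₁`; it is sent to the tuple of the `(φ xᵢ, φ xᵢ (φ (gᵢ⁻¹ xᵢ))⁻¹)`. -/
def tupleMap (φ : G → H) (n : ℕ) (p : G × (Fin n → G)) : H × (Fin n → H) :=
  (φ p.1, fun i =>
    φ ((Fin.partialProd p.2 i.castSucc)⁻¹ * p.1) *
      (φ ((p.2 i)⁻¹ * ((Fin.partialProd p.2 i.castSucc)⁻¹ * p.1)))⁻¹)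

end Coarse

/-! ### res-invariant modules -/

/-- A res-invariant `RG`-submodule of the module `C(G, W)` of all functions `G → W`. -/
structure ResSubmodule (R G W : Type*) [CommRing R] [Group G] [AddCommGroup W] [Module R W]
    extends Submodule R (G → W) where
  translate_mem' : ∀ (g : G) (f : G → W), f ∈ carrier → leftTranslate g f ∈ carrier
  res_mem' : ∀ (A : Set G) (f : G → W), f ∈ carrier → A.indicator f ∈ carrier

section ResSubmodule

variable {R G H W : Type*} [CommRing R] [Group G] [Group H] [AddCommGroup W] [Module R W]

namespace ResSubmodule

/-- Translation by `g` on `L`. -/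
def translateMap (L : ResSubmodule R G W) (g : G) : L.toSubmodule →ₗ[R] L.toSubmodule where
  toFun f := ⟨leftTranslate g f.1, L.translate_mem' g f.1 f.2⟩
  map_add' _ _ := rfl
  map_smul' _ _ := rfl

theorem translateMap_apply (L : ResSubmodule R G W) (g : G) (f : L.toSubmodule) (x : G) :
    (L.translateMap g f).1 x = f.1 (g⁻¹ * x) := rfl

/-- Restriction to `A` on `L`. -/
noncomputable def resMap (L : ResSubmodule R G W) (A : Set G) (f : L.toSubmodule) :
    L.toSubmodule :=
  ⟨A.indicator f.1, L.res_mem' A f.1 f.2⟩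

/-- The representation of `G` on `L`, `(g.f)(x) = f (g⁻¹ x)`. -/
def rho (L : ResSubmodule R G W) : Representation R G L.toSubmodule where
  toFun g := L.translateMap g
  map_one' := by
    ext f x
    rw [translateMap_apply]
    simp
  map_mul' g h := by
    ext f x
    rw [Module.End.mul_apply, translateMap_apply, translateMap_apply, translateMap_apply]
    simp [mul_assoc]

/-- The smallest res-invariant submodule containing a set of functions. -/
def resSpan (S : Set (G → W)) : ResSubmodule R G W where
  carrier := {f | ∀ P : ResSubmodule R G W, S ⊆ P.toSubmodule → f ∈ P.toSubmodule}
  add_mem' ha hb P hP := P.add_mem (ha P hP) (hb P hP)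
  zero_mem' P _ := P.zero_mem
  smul_mem' r _ ha P hP := P.smul_mem r (ha P hP)
  translate_mem' g f hf P hP := P.translate_mem' g f (hf P hP)
  res_mem' A f hf P hP := P.res_mem' A f (hf P hP)

/-- `φ_* L`, the smallest res-invariant submodule containing all `φ_* f`, `f ∈ L`. -/
noncomputable def push (φ : G → H) (L : ResSubmodule R G W) : ResSubmodule R H W :=
  resSpan (fiberSum φ '' L.toSubmodule)

/-- `φ^* M`, the smallest res-invariant submodule containing all `f ∘ φ`, `f ∈ M`. -/
def pull (φ : G → H) (M : ResSubmodule R H W) : ResSubmodule R G W :=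
  resSpan ((fun f => f ∘ φ) '' M.toSubmodule)

/-- `φ^{*-1} L = {f | φ^*(h.f) ∈ L for all h ∈ H}`. -/
def invPull (φ : G → H) (L : ResSubmodule R G W) : ResSubmodule R H W where
  carrier := {f | ∀ h : H, leftTranslate h f ∘ φ ∈ L.toSubmodule}
  add_mem' ha hb h := L.add_mem (ha h) (hb h)
  zero_mem' _ := L.zero_mem
  smul_mem' r _ ha h := L.smul_mem r (ha h)
  translate_mem' g f hf h := by
    have : leftTranslate h (leftTranslate g f) = leftTranslate (h * g) f := by
      ext x
      simp [leftTranslate, mul_assoc]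
    rw [this]
    exact hf (h * g)
  res_mem' B f hf h := by
    classical
    have : leftTranslate h (B.indicator f) ∘ φ =
        {x | h⁻¹ * φ x ∈ B}.indicator (leftTranslate h f ∘ φ) := by
      ext x
      simp [leftTranslate, Set.indicator_apply]
    rw [this]
    exact L.res_mem' _ _ (hf h)

/-- `f ↦ φ_* f` as a map `L → φ_* L`. -/
noncomputable def pushMap (φ : G → H) (L : ResSubmodule R G W) (f : L.toSubmodule) :
    (push φ L).toSubmodule :=
  ⟨fiberSum φ f.1, fun _ hP => hP ⟨f.1, f.2, rfl⟩⟩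

/-- `f ↦ φ^* f` as a map `M → φ^* M`. -/
def pullMap (φ : G → H) (M : ResSubmodule R H W) (f : M.toSubmodule) : (pull φ M).toSubmodule :=
  ⟨f.1 ∘ φ, fun _ hP => hP ⟨f.1, f.2, rfl⟩⟩

/-- `f ↦ φ^*(h.f)` as a map `φ^{*-1} L → L`. -/
def invPullMap (φ : G → H) (L : ResSubmodule R G W) (h : H) :
    (invPull φ L).toSubmodule →ₗ[R] L.toSubmodule where
  toFun f := ⟨leftTranslate h f.1 ∘ φ, f.2 h⟩
  map_add' _ _ := rfl
  map_smul' _ _ := rfl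

theorem invPullMap_apply (φ : G → H) (L : ResSubmodule R G W) (h : H)
    (f : (invPull φ L).toSubmodule) (x : G) :
    (L.invPullMap φ h f).1 x = f.1 (h⁻¹ * φ x) := rfl

end ResSubmodule

/-! ### Topological res-invariant modules -/

variable [TopologicalSpace R]

/-- The topology on `L` makes `L` a topological `R`-module on which all restrictions to subsets and
all translations are continuous. -/
structure IsTopRes (L : ResSubmodule R G W) [TopologicalSpace L.toSubmodule] : Prop where
  topologicalAddGroup : IsTopologicalAddGroup L.toSubmodule
  continuousSMul : ContinuousSMul R L.toSubmodule
  continuous_res : ∀ A : Set G, Continuous (L.resMap A)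
  continuous_translate : ∀ g : G, Continuous (L.translateMap g)

variable (R G W) in
/-- A topological res-invariant `RG`-submodule of `C(G, W)`. -/
structure TopResSubmodule where
  toRes : ResSubmodule R G W
  top : TopologicalSpace toRes.toSubmodule
  isTopRes : IsTopRes toRes

theorem isTopRes_sInf (L : ResSubmodule R G W) (s : Set (TopologicalSpace L.toSubmodule))
    (hs : ∀ t ∈ s, @IsTopRes R G W _ _ _ _ _ L t) :
    @IsTopRes R G W _ _ _ _ _ L (sInf s) :=
  letI := sInf s
  { topologicalAddGroup := topologicalAddGroup_sInf fun t ht => (hs t ht).topologicalAddGroup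
    continuousSMul := continuousSMul_sInf fun t ht => (hs t ht).continuousSMul
    continuous_res := fun A => continuous_sInf_rng.2 fun t ht =>
      continuous_sInf_dom ht ((hs t ht).continuous_res A)
    continuous_translate := fun g => continuous_sInf_rng.2 fun t ht =>
      continuous_sInf_dom ht ((hs t ht).continuous_translate g) }

namespace TopResSubmodule

instance (L : TopResSubmodule R G W) : TopologicalSpace L.toRes.toSubmodule := L.top

instance (L : TopResSubmodule R G W) : IsTopologicalAddGroup L.toRes.toSubmodule :=
  L.isTopRes.topologicalAddGroup

instance (L : TopResSubmodule R G W) : ContinuousSMul R L.toRes.toSubmodule :=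
  L.isTopRes.continuousSMul

/-- `φ_* L` with the finest topology (in Mathlib's order on topologies, the infimum) that makes it
a topological res-invariant module and `L → φ_* L`, `f ↦ φ_* f`, continuous. -/
noncomputable def push (φ : G → H) (L : TopResSubmodule R G W) : TopResSubmodule R H W where
  toRes := L.toRes.push φ
  top := sInf {t | @IsTopRes R H W _ _ _ _ _ (L.toRes.push φ) t ∧
    @Continuous _ _ L.top t (L.toRes.pushMap φ)}
  isTopRes := isTopRes_sInf _ _ fun _ ht => ht.1

/-- `φ^* M` with the finest topology (in Mathlib's order on topologies, the infimum) that makes it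
a topological res-invariant module and `M → φ^* M`, `f ↦ φ^* f`, continuous. -/
noncomputable def pull (φ : G → H) (M : TopResSubmodule R H W) : TopResSubmodule R G W where
  toRes := M.toRes.pull φ
  top := sInf {t | @IsTopRes R G W _ _ _ _ _ (M.toRes.pull φ) t ∧
    @Continuous _ _ M.top t (M.toRes.pullMap φ)}
  isTopRes := isTopRes_sInf _ _ fun _ ht => ht.1

/-- `φ^{*-1} L` with the initial topology for the maps `φ^{*-1} L → L`, `f ↦ φ^*(h.f)`, `h ∈ H`. -/
noncomputable def invPull (φ : G → H) (L : TopResSubmodule R G W) : TopResSubmodule R H W where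
  toRes := L.toRes.invPull φ
  top := ⨅ h : H, TopologicalSpace.induced (L.toRes.invPullMap φ h) L.top
  isTopRes :=
    letI := ⨅ h : H, TopologicalSpace.induced (L.toRes.invPullMap φ h) L.top
    { topologicalAddGroup := topologicalAddGroup_iInf fun h =>
        topologicalAddGroup_induced (L.toRes.invPullMap φ h)
      continuousSMul := continuousSMul_iInf fun h => continuousSMul_induced (L.toRes.invPullMap φ h)
      continuous_res := fun B => by
        classical
        refine continuous_iInf_rng.2 fun h => continuous_induced_rng.2 ?_
        have : L.toRes.invPullMap φ h ∘ (L.toRes.invPull φ).resMap B =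
            L.toRes.resMap {x | h⁻¹ * φ x ∈ B} ∘ L.toRes.invPullMap φ h := by
          ext f x
          rw [Function.comp_apply, ResSubmodule.invPullMap_apply]
          simp [ResSubmodule.resMap, ResSubmodule.invPullMap_apply, Set.indicator_apply]
        rw [this]
        exact (L.isTopRes.continuous_res _).comp (continuous_iInf_dom continuous_induced_dom)
      continuous_translate := fun g => by
        refine continuous_iInf_rng.2 fun h => continuous_induced_rng.2 ?_
        have : L.toRes.invPullMap φ h ∘ (L.toRes.invPull φ).translateMap g =
            L.toRes.invPullMap φ (h * g) := by
          ext f x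
          rw [Function.comp_apply, ResSubmodule.invPullMap_apply,
            ResSubmodule.translateMap_apply, ResSubmodule.invPullMap_apply]
          simp [mul_assoc]
        rw [this]
        exact continuous_iInf_dom continuous_induced_dom }

/-- The topology of `φ^{*-1} L` is the coarsest one that makes it a topological res-invariant module
and `f ↦ φ^* f` continuous. -/
theorem invPull_top_coarsest (φ : G → H) (L : TopResSubmodule R G W)
    (t : TopologicalSpace (L.toRes.invPull φ).toSubmodule)
    (ht : @IsTopRes R H W _ _ _ _ _ (L.toRes.invPull φ) t)
    (hc : @Continuous _ _ t L.top (L.toRes.invPullMap φ 1)) : t ≤ (L.invPull φ).top := by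
  refine le_iInf fun h => continuous_iff_le_induced.1 ?_
  have : (L.toRes.invPullMap φ h : (L.toRes.invPull φ).toSubmodule → L.toRes.toSubmodule) =
      L.toRes.invPullMap φ 1 ∘ (L.toRes.invPull φ).translateMap h := by
    ext f x
    rw [Function.comp_apply, ResSubmodule.invPullMap_apply, ResSubmodule.invPullMap_apply,
      ResSubmodule.translateMap_apply]
    simp
  rw [this]
  exact @Continuous.comp _ _ _ t t L.top _ _ hc (ht.continuous_translate h)

end TopResSubmodule

end ResSubmodule

/-! ### Reduced homology of a complex of topological modules -/

section Reduced

variable {R ι : Type*} [CommRing R] {c : ComplexShape ι}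

/-- The kernel of the outgoing differential. -/
noncomputable def cycleSubmodule (C : HomologicalComplex (ModuleCat R) c) (i : ι) :
    Submodule R (C.X i) :=
  LinearMap.ker (C.d i (c.next i)).hom

/-- The image of the incoming differential. -/
noncomputable def boundarySubmodule (C : HomologicalComplex (ModuleCat R) c) (i : ι) :
    Submodule R (C.X i) :=
  LinearMap.range (C.d (c.prev i) i).hom

/-- The reduced (co)homology, kernel modulo the closure of the image (taken inside the kernel), with
the quotient topology of the subspace topology of the kernel. -/
noncomputable abbrev ReducedHomology (C : HomologicalComplex (ModuleCat R) c) (i : ι)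
    [TopologicalSpace (C.X i)] [IsTopologicalAddGroup (C.X i)] [ContinuousConstSMul R (C.X i)] :
    Type _ :=
  cycleSubmodule C i ⧸ (boundarySubmodule C i).topologicalClosure.submoduleOf (cycleSubmodule C i)

/-- `T` is the map on reduced (co)homology in degree `i` induced by the map of complexes `D`,
`T [z] = [D z]`. -/
def IsReducedMap {C C' : HomologicalComplex (ModuleCat R) c} (D : C ⟶ C') (i : ι)
    [TopologicalSpace (C.X i)] [IsTopologicalAddGroup (C.X i)] [ContinuousConstSMul R (C.X i)]
    [TopologicalSpace (C'.X i)] [IsTopologicalAddGroup (C'.X i)] [ContinuousConstSMul R (C'.X i)]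
    (T : ReducedHomology C i →L[R] ReducedHomology C' i) : Prop :=
  ∀ z : cycleSubmodule C i, ∃ h : (D.f i).hom z.1 ∈ cycleSubmodule C' i,
    T (Submodule.Quotient.mk z) = Submodule.Quotient.mk ⟨(D.f i).hom z.1, h⟩

end Reduced

/-! ### Group (co)homology with coefficients in res-invariant modules, and the induced maps -/

section GroupHomology

variable {R G H W : Type u} [CommRing R] [Group G] [Group H] [AddCommGroup W] [Module R W]

namespace ResSubmodule

/-- `L` as a representation of `G`. -/
abbrev rep (L : ResSubmodule R G W) : Rep.{u} R G := Rep.of L.rho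

/-- The bar complex of `L`: in degree `n`, finitely supported functions `Gⁿ → L`. -/
noncomputable abbrev chains (L : ResSubmodule R G W) : ChainComplex (ModuleCat.{u} R) ℕ :=
  groupHomology.inhomogeneousChains L.rep

/-- The cobar complex of `L`: in degree `n`, all functions `Gⁿ → L`. -/
noncomputable abbrev cochains (L : ResSubmodule R G W) : CochainComplex (ModuleCat.{u} R) ℕ :=
  groupCohomology.inhomogeneousCochains L.rep

/-- A chain as a function on composable `n`-tuples of the transformation groupoid,
`(x, g) ↦ c(g)(x)`. -/
noncomputable def chainFun (L : ResSubmodule R G W) {n : ℕ} (c : (Fin n → G) →₀ L.toSubmodule) :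
    G × (Fin n → G) → W :=
  fun p => (c p.2).1 p.1

/-- A cochain as a function on composable `n`-tuples of the transformation groupoid,
`(x, g) ↦ c(g)(x)`. -/
def cochainFun (L : ResSubmodule R G W) {n : ℕ} (c : (Fin n → G) → L.toSubmodule) :
    G × (Fin n → G) → W :=
  fun p => (c p.2).1 p.1

end ResSubmodule

/-- The chain map `D` is `D_*(φ)`: under the identification of chains with functions on composable
tuples, it is the pushforward `(φⁿ)_*` in degree `n`, all sums in it being finite. -/
def IsChainPush (φ : G → H) {L : ResSubmodule R G W} {N : ResSubmodule R H W}
    (D : L.chains ⟶ N.chains) : Prop :=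
  ∀ (n : ℕ) (c : (Fin n → G) →₀ L.toSubmodule),
    (∀ q, (tupleMap φ n ⁻¹' {q} ∩ Function.support (L.chainFun c)).Finite) ∧
      N.chainFun ((D.f n).hom c) = fiberSum (tupleMap φ n) (L.chainFun c)

/-- The cochain map `D` is `D^*(φ)`: under the identification of cochains with functions on
composable tuples, it is composition with `φⁿ` in degree `n`. -/
def IsCochainPull (φ : G → H) {M : ResSubmodule R H W} {N : ResSubmodule R G W}
    (D : M.cochains ⟶ N.cochains) : Prop :=
  ∀ (n : ℕ) (c : (Fin n → H) → M.toSubmodule),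
    N.cochainFun ((D.f n).hom c) = M.cochainFun c ∘ tupleMap φ n

/-- `T` is `Hₙ(φ) : Hₙ(G, L) → Hₙ(H, N)`, the map induced by `D_*(φ)`. -/
def IsHomologyMap (φ : G → H) (L : ResSubmodule R G W) (N : ResSubmodule R H W) (n : ℕ)
    (T : groupHomology L.rep n ⟶ groupHomology N.rep n) : Prop :=
  ∃ D : L.chains ⟶ N.chains, IsChainPush φ D ∧ T = HomologicalComplex.homologyMap D n

/-- `T` is `Hⁿ(φ) : Hⁿ(H, M) → Hⁿ(G, N)`, the map induced by `D^*(φ)`. -/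
def IsCohomologyMap (φ : G → H) (M : ResSubmodule R H W) (N : ResSubmodule R G W) (n : ℕ)
    (T : groupCohomology M.rep n ⟶ groupCohomology N.rep n) : Prop :=
  ∃ D : M.cochains ⟶ N.cochains, IsCochainPull φ D ∧ T = HomologicalComplex.homologyMap D n

namespace TopResSubmodule

variable [TopologicalSpace R]

/-- Chains carry the topology of pointwise convergence on `Gⁿ`. -/
noncomputable instance (L : TopResSubmodule R G W) (n : ℕ) : TopologicalSpace (L.toRes.chains.X n) :=
  TopologicalSpace.induced
    (Finsupp.lcoeFun : ((Fin n → G) →₀ L.toRes.toSubmodule) →ₗ[R] (Fin n → G) → L.toRes.toSubmodule)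
    inferInstance

instance (L : TopResSubmodule R G W) (n : ℕ) : IsTopologicalAddGroup (L.toRes.chains.X n) :=
  topologicalAddGroup_induced
    (Finsupp.lcoeFun : ((Fin n → G) →₀ L.toRes.toSubmodule) →ₗ[R] (Fin n → G) → L.toRes.toSubmodule)

instance (L : TopResSubmodule R G W) (n : ℕ) : ContinuousSMul R (L.toRes.chains.X n) :=
  continuousSMul_induced
    (Finsupp.lcoeFun : ((Fin n → G) →₀ L.toRes.toSubmodule) →ₗ[R] (Fin n → G) → L.toRes.toSubmodule)

/-- Cochains carry the topology of pointwise convergence on `Gⁿ`. -/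
instance (L : TopResSubmodule R G W) (n : ℕ) : TopologicalSpace (L.toRes.cochains.X n) :=
  inferInstanceAs (TopologicalSpace ((Fin n → G) → L.toRes.toSubmodule))

instance (L : TopResSubmodule R G W) (n : ℕ) : IsTopologicalAddGroup (L.toRes.cochains.X n) :=
  inferInstanceAs (IsTopologicalAddGroup ((Fin n → G) → L.toRes.toSubmodule))

instance (L : TopResSubmodule R G W) (n : ℕ) : ContinuousSMul R (L.toRes.cochains.X n) :=
  inferInstanceAs (ContinuousSMul R ((Fin n → G) → L.toRes.toSubmodule))

/-- Reduced group homology of `G` with coefficients in `L`. -/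
noncomputable abbrev RedHomology (L : TopResSubmodule R G W) (n : ℕ) : Type u :=
  ReducedHomology L.toRes.chains n

/-- Reduced group cohomology of `G` with coefficients in `L`. -/
noncomputable abbrev RedCohomology (L : TopResSubmodule R G W) (n : ℕ) : Type u :=
  ReducedHomology L.toRes.cochains n

end TopResSubmodule

variable [TopologicalSpace R]

/-- `T` is the map on reduced homology induced by `D_*(φ)`. -/
def IsRedHomologyMap (φ : G → H) (L : TopResSubmodule R G W) (N : TopResSubmodule R H W) (n : ℕ)
    (T : L.RedHomology n →L[R] N.RedHomology n) : Prop :=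
  ∃ D : L.toRes.chains ⟶ N.toRes.chains, IsChainPush φ D ∧ IsReducedMap D n T

/-- `T` is the map on reduced cohomology induced by `D^*(φ)`. -/
def IsRedCohomologyMap (φ : G → H) (M : TopResSubmodule R H W) (N : TopResSubmodule R G W) (n : ℕ)
    (T : M.RedCohomology n →L[R] N.RedCohomology n) : Prop :=
  ∃ D : M.toRes.cochains ⟶ N.toRes.cochains, IsCochainPull φ D ∧ IsReducedMap D n T

end GroupHomology

/-!
In the homogeneous coordinates `(x₁, …, xₙ₊₁)` with `xᵢ₊₁ = gᵢ⁻¹ xᵢ` on composable tuples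
(`homog`), the map `φⁿ` applies `φ` to every entry (`homog_tupleMap`), and the differentials of
the bar and cobar complexes are the alternating sums over the maps that omit one entry
(`ResSubmodule.chains_d`, `ResSubmodule.cochainLin_d`). Hence `D_*(φ)` and `D^*(φ)` commute with
the differentials, and the prisms `(α x₀, …, α xⱼ, β xⱼ, …, β xₙ)` give homotopies between the
maps induced by `α` and `β` (`faceSum_prismSum`, `IsChainPush.nonempty_homotopy`,
`IsCochainPull.nonempty_homotopy`).

All these maps preserve coefficients for one reason. If `u x (v x)⁻¹` takes finitely many values,
then `u_* f` and `f ∘ u` are finite sums of restrictions and translates of `v_*` and `v^*`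
(`fiberSum_eq_sum_leftTranslate`, `comp_eq_sum_leftTranslate`), so they stay in res-invariant
modules, and they depend continuously on `f` if `v_* f` and `f ∘ v` do. A map of tuples whose
entries are pairwise close takes, for fixed group components of the argument, finitely many values
in its own group components, so it is handled by the same decomposition.

For a coarse embedding `φ`, the map `ω` need not be a coarse map. It is controlled on the
translates of `φ(G)`, and `φ ∘ ω` is close to the identity there, because the index `j` in its
construction is bounded on each translate (`IsCoarseInverse.exists_finset`); moreover `ω ∘ φ` is
close to the identity. This suffices: functions in `φ_* L` are supported near `φ(G)`
(`ResSubmodule.closeOn_supports_push`), and membership in `φ^{*-1} L` is a condition on translates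
of `φ(G)` (`ResSubmodule.detectedOn_invPull`). For this reason closeness is used relative to a
family of subsets (`CloseOn`).

The topologies of `φ_* L` and `φ^* M` are infima, so a map out of one of these modules is shown to
be continuous by exhibiting the initial topology for its composites with restrictions and
translations as a competitor (`TopResSubmodule.continuous_pushes_push`,
`TopResSubmodule.continuous_pulls_pull`). On cochains, `D^*(φ)` and `D^*(ω)` are continuous. On
chains, `D_n(φ)` is continuous for a coarse embedding `φ`, but `D_n(ω)` need not be for `n ≥ 1`,
since infinitely many coordinates of a chain may contribute to one coordinate of its image. The
topological isomorphism on reduced homology is therefore obtained from `D_0(ω)` in degree `0`,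
while in positive degrees both sides vanish (`TopResSubmodule.subsingleton_redHomology_succ`): if
`G` is infinite, then cones with a far away apex show that boundaries are dense, and if `G` is
finite, then `G` is coarsely equivalent to the trivial group.
-/

/-! ### Homogeneous coordinates and the prism identity -/

section Tuples

variable {G H : Type*} [Group G] [Group H]

/-- Homogeneous coordinates on composable `n`-tuples of the transformation groupoid: the tuple
`(x₁, (g₁, …, gₙ))` corresponds to `(x₁, …, xₙ₊₁)` with `xᵢ₊₁ = gᵢ⁻¹ xᵢ`. -/
def homog (n : ℕ) : G × (Fin n → G) ≃ (Fin (n + 1) → G) where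
  toFun p i := (Fin.partialProd p.2 i)⁻¹ * p.1
  invFun x := (x 0, fun i => x i.castSucc * (x i.succ)⁻¹)
  left_inv p := by
    refine Prod.ext (by simp) (funext fun i => ?_)
    simp [Fin.partialProd_succ, mul_assoc]
  right_inv x := by
    funext i
    induction i using Fin.induction with
    | zero => simp
    | succ i ih =>
      simp only [Fin.partialProd_succ, mul_inv_rev, mul_assoc] at ih ⊢
      rw [ih]
      simp

theorem homog_apply (n : ℕ) (p : G × (Fin n → G)) (i : Fin (n + 1)) :
    homog n p i = (Fin.partialProd p.2 i)⁻¹ * p.1 := rfl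

theorem homog_symm_apply (n : ℕ) (x : Fin (n + 1) → G) :
    (homog n).symm x = (x 0, fun i => x i.castSucc * (x i.succ)⁻¹) := rfl

/-- In homogeneous coordinates, `φⁿ` is `φ` applied to every entry. -/
theorem homog_tupleMap (φ : G → H) (n : ℕ) (p : G × (Fin n → G)) :
    homog n (tupleMap φ n p) = φ ∘ homog n p := by
  rw [← Equiv.eq_symm_apply, homog_symm_apply]
  refine Prod.ext (by simp [tupleMap, homog_apply]) (funext fun i => ?_)
  simp [tupleMap, homog_apply, Fin.partialProd_succ, mul_assoc]

/-- In homogeneous coordinates, the terms of the differential of the bar complex omit one entry;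
here the first one. -/
theorem homog_tail (n : ℕ) (x : G) (g : Fin (n + 1) → G) :
    homog n ((g 0)⁻¹ * x, fun i => g i.succ) = homog (n + 1) (x, g) ∘ Fin.succAbove 0 := by
  funext i
  have := Fin.partialProd_succ' g i
  simp only [homog_apply, Function.comp_apply, Fin.zero_succAbove, this, mul_inv_rev, mul_assoc]
  rfl

theorem homog_contractNth (n : ℕ) (x : G) (g : Fin (n + 1) → G) (j : Fin (n + 1)) :
    homog n (x, Fin.contractNth j (· * ·) g) =
      homog (n + 1) (x, g) ∘ Fin.succAbove j.succ := by
  funext i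
  simp only [homog_apply, Function.comp_apply, Fin.partialProd_contractNth]

/-- The `j`-th prism `(α x₀, …, α xⱼ, β xⱼ, …, β xₙ)` over the tuple `(x₀, …, xₙ)`. -/
def prism {X Y : Type*} (α β : X → Y) {n : ℕ} (j : Fin n) (x : Fin n → X) : Fin (n + 1) → Y :=
  fun i => (if i ≤ j.castSucc then α else β) (x (j.predAbove i))

theorem prism_apply {X Y : Type*} (α β : X → Y) {n : ℕ} (j : Fin n) (i : Fin (n + 1))
    (x : Fin n → X) : ∃ s, prism α β j x i = α (x s) ∨ prism α β j x i = β (x s) := by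
  refine ⟨j.predAbove i, ?_⟩
  unfold prism
  split_ifs
  exacts [Or.inl rfl, Or.inr rfl]

theorem prism_zero_cons {X Y : Type*} (α β : X → Y) {n : ℕ} (a : X) (x : Fin n → X) :
    prism α β 0 (Fin.cons a x : Fin (n + 1) → X) =
      (Fin.cons (α a) (Fin.cons (β a) (β ∘ x) : Fin (n + 1) → Y) : Fin (n + 2) → Y) := by
  funext i
  refine Fin.cases ?_ (fun i => ?_) i
  · simp [prism]
  · refine Fin.cases ?_ (fun i => ?_) i <;> simp [prism]

theorem prism_succ_cons {X Y : Type*} (α β : X → Y) {n : ℕ} (j : Fin n) (a : X) (x : Fin n → X) :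
    prism α β j.succ (Fin.cons a x : Fin (n + 1) → X) =
      (Fin.cons (α a) (prism α β j x) : Fin (n + 2) → Y) := by
  funext i
  refine Fin.cases ?_ (fun i => ?_) i
  · simp [prism]
  · simp [prism, Fin.le_def, Fin.succ_predAbove_succ]

section Prism

variable (R : Type*) [CommRing R] {A X Y : Type*} [AddCommGroup A] [Module R A]

/-- The simplicial coboundary of a function on `n`-tuples. -/
def faceSum {n : ℕ} (F : (Fin n → X) → A) (x : Fin (n + 1) → X) : A :=
  ∑ i : Fin (n + 1), (-1 : R) ^ (i : ℕ) • F (x ∘ i.succAbove)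

/-- The prism operator on functions on tuples. -/
def prismSum (α β : X → Y) {n : ℕ} (F : (Fin (n + 1) → Y) → A) (x : Fin n → X) : A :=
  ∑ j : Fin n, (-1 : R) ^ (j : ℕ) • F (prism α β j x)

theorem cons_comp_succAbove_zero {n : ℕ} (a : X) (x : Fin n → X) :
    (Fin.cons a x : Fin (n + 1) → X) ∘ Fin.succAbove 0 = x := by
  funext i
  simp

theorem cons_comp_succAbove_succ {n : ℕ} (a : X) (x : Fin (n + 1) → X) (i : Fin (n + 1)) :
    (Fin.cons a x : Fin (n + 2) → X) ∘ i.succ.succAbove = Fin.cons a (x ∘ i.succAbove) := by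
  funext k
  refine Fin.cases ?_ (fun k => ?_) k <;> simp

theorem faceSum_cons {n : ℕ} (F : (Fin (n + 1) → X) → A) (a : X) (x : Fin (n + 1) → X) :
    faceSum R F (Fin.cons a x : Fin (n + 2) → X) =
      F x - faceSum R (fun y : Fin n → X => F (Fin.cons a y)) x := by
  simp only [faceSum]
  rw [Fin.sum_univ_succ, cons_comp_succAbove_zero, sub_eq_add_neg, ← Finset.sum_neg_distrib]
  refine congrArg₂ (· + ·) (by simp) (Finset.sum_congr rfl fun i _ => ?_)
  rw [cons_comp_succAbove_succ]
  simp [pow_succ]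

theorem prismSum_cons (α β : X → Y) {n : ℕ} (F : (Fin (n + 2) → Y) → A) (a : X)
    (x : Fin n → X) :
    prismSum R α β F (Fin.cons a x : Fin (n + 1) → X) =
      F (Fin.cons (α a) (Fin.cons (β a) (β ∘ x) : Fin (n + 1) → Y)) -
        prismSum R α β (fun y : Fin (n + 1) → Y => F (Fin.cons (α a) y)) x := by
  simp only [prismSum]
  rw [Fin.sum_univ_succ, prism_zero_cons, sub_eq_add_neg, ← Finset.sum_neg_distrib]
  simp [prism_succ_cons, pow_succ]

theorem faceSum_sub {n : ℕ} (F F' : (Fin n → X) → A) (x : Fin (n + 1) → X) :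
    faceSum R (fun y => F y - F' y) x = faceSum R F x - faceSum R F' x := by
  simp [faceSum, smul_sub]

theorem prismSum_sub (α β : X → Y) {n : ℕ} (F F' : (Fin (n + 1) → Y) → A) (x : Fin n → X) :
    prismSum R α β (fun y => F y - F' y) x = prismSum R α β F x - prismSum R α β F' x := by
  simp [prismSum, smul_sub]

theorem faceSum_comp (β : X → Y) {n : ℕ} (F : (Fin n → Y) → A) (x : Fin (n + 1) → X) :
    faceSum R (fun y => F (β ∘ y)) x = faceSum R F (β ∘ x) := rfl

/-- The prism operator is a homotopy between composition with `β` and composition with `α`. The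
proof splits off the first entry of the tuple. -/
theorem faceSum_prismSum (α β : X → Y) {n : ℕ} (F : (Fin (n + 1) → Y) → A)
    (x : Fin (n + 1) → X) :
    faceSum R (prismSum R α β F) x + prismSum R α β (faceSum R F) x =
      F (β ∘ x) - F (α ∘ x) := by
  induction n with
  | zero =>
    have h1 : prism α β 0 x ∘ Fin.succ = β ∘ x := by
      funext i
      fin_cases i
      simp [prism]
    have h2 : prism α β 0 x ∘ Fin.succAbove 1 = α ∘ x := by
      funext i
      fin_cases i
      simp [prism]
    simp [faceSum, prismSum, h1, h2, sub_eq_add_neg]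
  | succ n ih =>
    refine Fin.consCases (fun a x => ?_) x
    have ih' := ih (fun y => F (Fin.cons (α a) y)) x
    rw [faceSum_cons, prismSum_cons]
    simp only [prismSum_cons, faceSum_cons, faceSum_sub, prismSum_sub]
    have e := faceSum_comp R β
      (fun y : Fin n → Y => F (Fin.cons (α a) (Fin.cons (β a) y : Fin (n + 1) → Y))) x
    have hβ : β ∘ (Fin.cons a x : Fin (n + 2) → X) = Fin.cons (β a) (β ∘ x) := Fin.comp_cons ..
    have hα : α ∘ (Fin.cons a x : Fin (n + 2) → X) = Fin.cons (α a) (α ∘ x) := Fin.comp_cons ..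
    rw [e, hα, hβ]
    rw [← sub_eq_zero] at ih' ⊢
    rw [← ih']
    abel

end Prism
end Tuples

/-! ### Sums over fibres -/

section FiberSum

variable {R X Y Z W : Type*} [CommRing R] [AddCommGroup W] [Module R W]

/-- The map `u` has finite fibres on the set `A`. -/
def FiniteFibers (u : X → Y) (A : Set X) : Prop := ∀ y, (u ⁻¹' {y} ∩ A).Finite

theorem FiniteFibers.mono {u : X → Y} {A B : Set X} (h : FiniteFibers u B) (hAB : A ⊆ B) :
    FiniteFibers u A := fun y => (h y).subset (Set.inter_subset_inter_right _ hAB)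

theorem FiniteFibers.union {u : X → Y} {A B : Set X} (hA : FiniteFibers u A)
    (hB : FiniteFibers u B) : FiniteFibers u (A ∪ B) := fun y => by
  rw [Set.inter_union_distrib_left]
  exact (hA y).union (hB y)

theorem FiniteFibers.of_comp {u : X → Y} {v : Y → Z} {A : Set X}
    (h : FiniteFibers (v ∘ u) A) : FiniteFibers u A := fun y =>
  (h (v y)).subset fun _ hx => ⟨congrArg v hx.1, hx.2⟩

theorem FiniteFibers.image {u : X → Y} {v : Y → Z} {A : Set X}
    (h : FiniteFibers (v ∘ u) A) : FiniteFibers v (u '' A) := fun z =>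
  ((h z).image u).subset (by rintro _ ⟨hz, x, hx, rfl⟩; exact ⟨x, ⟨hz, hx⟩, rfl⟩)

theorem FiniteFibers.congr {u v : X → Y} {A : Set X} (h : FiniteFibers u A)
    (huv : ∀ x ∈ A, u x = v x) : FiniteFibers v A := fun y =>
  (h y).subset fun x hx => ⟨(huv x hx.2).trans hx.1, hx.2⟩

theorem fiberSum_eq_sum [DecidableEq Y] {u : X → Y} {f : X → W} {y : Y} (T : Finset X)
    (hT : ∀ x, u x = y → f x ≠ 0 → x ∈ T) :
    fiberSum u f y = ∑ x ∈ T, if u x = y then f x else 0 := by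
  classical
  rw [fiberSum, finsum_mem_def, finsum_eq_sum_of_support_subset (s := T)]
  · exact Finset.sum_congr rfl fun x _ => by simp [Set.indicator_apply]
  · intro x hx
    rw [Function.mem_support, Set.indicator_apply_ne_zero] at hx
    exact hT x hx.1 hx.2

theorem fiberSum_zero (u : X → Y) : fiberSum u (0 : X → W) = 0 := by
  funext y
  simp [fiberSum]

theorem fiberSum_add {u : X → Y} {f f' : X → W} (hf : FiniteFibers u f.support)
    (hf' : FiniteFibers u f'.support) : fiberSum u (f + f') = fiberSum u f + fiberSum u f' := by
  funext y
  exact finsum_mem_add_distrib' (hf y) (hf' y)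

theorem fiberSum_smul {u : X → Y} (r : R) {f : X → W} (hf : FiniteFibers u f.support) :
    fiberSum u (r • f) = r • fiberSum u f := by
  classical
  funext y
  rw [Pi.smul_apply, fiberSum_eq_sum (f := f) (hf y).toFinset (fun x hx h => by simp [hx, h]),
    fiberSum_eq_sum (hf y).toFinset, Finset.smul_sum]
  · exact Finset.sum_congr rfl fun x _ => by split_ifs <;> simp
  · intro x hx h
    rw [Set.Finite.mem_toFinset]
    exact ⟨hx, fun h0 => h (by simp [h0])⟩

theorem fiberSum_sum {ι : Type*} {u : X → Y} (s : Finset ι) (f : ι → X → W) {A : Set X}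
    (hA : FiniteFibers u A) (hf : ∀ i ∈ s, (f i).support ⊆ A) :
    fiberSum u (∑ i ∈ s, f i) = ∑ i ∈ s, fiberSum u (f i) := by
  classical
  induction s using Finset.induction_on with
  | empty => simp [fiberSum_zero]
  | insert i s hi ih =>
    rw [Finset.sum_insert hi, Finset.sum_insert hi, fiberSum_add
      (hA.mono (hf i (Finset.mem_insert_self i s))),
      ih fun j hj => hf j (Finset.mem_insert_of_mem hj)]
    refine hA.mono fun x hx => ?_
    rw [Function.mem_support, Finset.sum_apply] at hx
    obtain ⟨j, hj, hx⟩ := Finset.exists_ne_zero_of_sum_ne_zero hx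
    exact hf j (Finset.mem_insert_of_mem hj) hx

theorem fiberSum_congr {u v : X → Y} {f : X → W} (h : ∀ x, f x ≠ 0 → u x = v x) :
    fiberSum u f = fiberSum v f := by
  classical
  funext y
  simp only [fiberSum, finsum_mem_def]
  refine finsum_congr fun x => ?_
  by_cases hx : f x = 0
  · simp [Set.indicator_apply, hx]
  · simp [Set.indicator_apply, h x hx]

theorem support_fiberSum_subset (u : X → Y) (f : X → W) :
    (fiberSum u f).support ⊆ u '' f.support := by
  intro y hy
  rw [Function.mem_support, fiberSum] at hy
  obtain ⟨x, hx, h⟩ := exists_ne_zero_of_finsum_mem_ne_zero hy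
  exact ⟨x, h, hx⟩

theorem fiberSum_comp {u : X → Y} {v : Y → Z} {f : X → W}
    (h : FiniteFibers (v ∘ u) f.support) :
    fiberSum v (fiberSum u f) = fiberSum (v ∘ u) f := by
  classical
  funext z
  have hT : ∀ x, (v ∘ u) x = z → f x ≠ 0 → x ∈ (h z).toFinset := fun x hx hf => by
    rw [Set.Finite.mem_toFinset]
    exact ⟨hx, hf⟩
  rw [fiberSum_eq_sum ((h z).toFinset.image u), fiberSum_eq_sum _ hT]
  · have : ∀ y ∈ (h z).toFinset.image u, (if v y = z then fiberSum u f y else 0) =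
        ∑ x ∈ (h z).toFinset, if u x = y then f x else 0 := by
      intro y hy
      obtain ⟨x, hx, rfl⟩ := Finset.mem_image.1 hy
      have hvx : v (u x) = z := ((h z).mem_toFinset.1 hx).1
      rw [if_pos hvx, fiberSum_eq_sum]
      intro x' hx' hf
      exact hT x' (by simp [hx', hvx]) hf
    rw [Finset.sum_congr rfl this, Finset.sum_comm]
    refine Finset.sum_congr rfl fun x hx => ?_
    have hvx : v (u x) = z := ((h z).mem_toFinset.1 hx).1
    rw [Finset.sum_ite_eq, if_pos (Finset.mem_image_of_mem u hx), Function.comp_apply,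
      if_pos hvx]
  · intro y hy hf
    obtain ⟨x, hx, rfl⟩ := support_fiberSum_subset u f hf
    exact Finset.mem_image_of_mem u (hT x hy hx)

theorem fiberSum_comp_equiv (u : Y → Z) (e : X ≃ Y) (f : X → W) :
    fiberSum (u ∘ e) f = fiberSum u (f ∘ e.symm) := by
  classical
  funext z
  simp only [fiberSum, finsum_mem_def]
  rw [← finsum_comp_equiv e]
  refine finsum_congr fun x => ?_
  simp [Set.indicator_apply]

theorem fiberSum_equiv_comp (u : X → Y) (e : Y ≃ Z) (f : X → W) :
    fiberSum (e ∘ u) f = fiberSum u f ∘ e.symm := by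
  classical
  funext z
  simp only [fiberSum, finsum_mem_def, Function.comp_apply]
  refine finsum_congr fun x => ?_
  simp [Set.indicator_apply, Equiv.eq_symm_apply]

theorem fiberSum_of_injective {u : X → Y} (hu : Function.Injective u) (f : X → W) (x : X) :
    fiberSum u f (u x) = f x := by
  have : u ⁻¹' {u x} = {x} := by
    ext x'
    simp [hu.eq_iff]
  rw [fiberSum, this, finsum_mem_singleton]

theorem fiberSum_id (f : X → W) : fiberSum id f = f :=
  funext fun x => fiberSum_of_injective Function.injective_id f x

theorem indicator_fiberSum (u : X → Y) (f : X → W) (B : Set Y) :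
    B.indicator (fiberSum u f) = fiberSum u ((u ⁻¹' B).indicator f) := by
  classical
  funext y
  simp only [fiberSum, finsum_mem_def, Set.indicator_apply]
  by_cases hy : y ∈ B
  · rw [if_pos hy]
    refine finsum_congr fun x => ?_
    by_cases hx : u x = y <;> simp [hx, hy]
  · rw [if_neg hy]
    symm
    refine finsum_eq_zero_of_forall_eq_zero fun x => ?_
    by_cases hx : u x = y <;> simp [hx, hy]

theorem support_indicator_subset_support (A : Set X) (f : X → W) :
    (A.indicator f).support ⊆ f.support := by
  rw [Set.support_indicator]
  exact Set.inter_subset_right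

/-- A function is the finite sum of its restrictions to the fibres of a map that takes finitely
many values on its support. -/
theorem eq_sum_indicator (κ : X → Y) (S : Finset Y) (f : X → W) (h : ∀ x, f x ≠ 0 → κ x ∈ S) :
    f = ∑ k ∈ S, (κ ⁻¹' {k}).indicator f := by
  classical
  funext x
  rw [Finset.sum_apply]
  simp only [Set.indicator_apply, Set.mem_preimage, Set.mem_singleton_iff, Finset.sum_ite_eq]
  split_ifs with hx
  · rfl
  · by_contra h0
    exact hx (h x h0)

section Translate

variable {G H : Type*} [Group G] [Group H]

theorem leftTranslate_fiberSum (g : H) (u : X → H) (f : X → W) :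
    leftTranslate g (fiberSum u f) = fiberSum (fun x => g * u x) f :=
  (fiberSum_equiv_comp u (Equiv.mulLeft g) f).symm

theorem fiberSum_leftTranslate (g : G) (u : G → Y) (f : G → W) :
    fiberSum u (leftTranslate g f) = fiberSum (fun x => u (g * x)) f :=
  (fiberSum_comp_equiv u (Equiv.mulLeft g) f).symm

theorem mem_support_leftTranslate {g x : G} {f : G → W} :
    x ∈ (leftTranslate g f).support ↔ g⁻¹ * x ∈ f.support := Iff.rfl

/-- If `u` and `v` differ by finitely many left translations on the support of `f`, then `u_* f` is
the finite sum of the translates `k.v_*(1_A f)`, with `A` the set where `u = k v`. -/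
theorem fiberSum_eq_sum_leftTranslate {u v : X → H} {f : X → W} (S : Finset H)
    (hS : ∀ x, f x ≠ 0 → u x * (v x)⁻¹ ∈ S) (hu : FiniteFibers u f.support) :
    fiberSum u f = ∑ k ∈ S, leftTranslate k
      (fiberSum v (((fun x => u x * (v x)⁻¹) ⁻¹' {k}).indicator f)) := by
  conv_lhs => rw [eq_sum_indicator (fun x => u x * (v x)⁻¹) S f hS]
  rw [fiberSum_sum S _ hu fun k _ => support_indicator_subset_support _ _]
  refine Finset.sum_congr rfl fun k _ => ?_
  rw [leftTranslate_fiberSum]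
  refine fiberSum_congr fun x hx => ?_
  have : u x * (v x)⁻¹ = k := by
    by_contra h
    exact hx (Set.indicator_of_notMem (s := (fun x => u x * (v x)⁻¹) ⁻¹' {k}) h _)
  rw [← this, inv_mul_cancel_right]

/-- If `u` and `v` differ by finitely many left translations, then `f ∘ u` is the finite sum of the
functions `1_A · ((k⁻¹.f) ∘ v)`, with `A` the set where `u = k v`. -/
theorem comp_eq_sum_leftTranslate {u v : X → H} (f : H → W) (S : Finset H)
    (hS : ∀ x, u x * (v x)⁻¹ ∈ S) :
    f ∘ u = ∑ k ∈ S, ((fun x => u x * (v x)⁻¹) ⁻¹' {k}).indicator (leftTranslate k⁻¹ f ∘ v) := by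
  rw [eq_sum_indicator (fun x => u x * (v x)⁻¹) S (f ∘ u) fun x _ => hS x]
  refine Finset.sum_congr rfl fun k _ => Set.indicator_congr fun x hx => ?_
  have : u x * (v x)⁻¹ = k := hx
  simp [leftTranslate, ← this]

end Translate
end FiberSum

/-! ### Closeness along a family of subsets -/

section CloseOn

variable {G H K : Type*} [Group G] [Group H] [Group K]

/-- `α` and `β` are close on every set of the family `𝒯`, also after left translations of the
variable. `CloseOn 𝒯 α α` says that `α` is controlled on the sets of `𝒯`. -/
def CloseOn (𝒯 : Set (Set G)) (α β : G → H) : Prop :=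
  ∀ A ∈ 𝒯, ∀ g k : G, ((fun x => α (g * x) * (β (k * x))⁻¹) '' A).Finite

/-- The translates of the image of `φ`. -/
def imageTranslates {X : Type*} (φ : X → H) : Set (Set H) :=
  {A | ∃ h : H, A = Set.range fun x => h * φ x}

theorem CloseOn.symm {𝒯 : Set (Set G)} {α β : G → H} (h : CloseOn 𝒯 α β) : CloseOn 𝒯 β α :=
  fun A hA g k => by
    refine ((h A hA k g).image (·⁻¹)).subset ?_
    rintro _ ⟨x, hx, rfl⟩
    exact ⟨_, ⟨x, hx, rfl⟩, by simp⟩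

theorem CloseOn.trans {𝒯 : Set (Set G)} {α β γ : G → H} (h : CloseOn 𝒯 α β)
    (h' : CloseOn 𝒯 β γ) : CloseOn 𝒯 α γ := fun A hA g k => by
  refine ((h A hA g 1).mul (h' A hA 1 k)).subset ?_
  rintro _ ⟨x, hx, rfl⟩
  exact ⟨_, ⟨x, hx, rfl⟩, _, ⟨x, hx, rfl⟩, by simp [mul_assoc]⟩

theorem CloseOn.of_univ {α β : G → H} (h : CloseOn {Set.univ} α β) (𝒯 : Set (Set G)) :
    CloseOn 𝒯 α β := fun A _ g k =>
  (h Set.univ rfl g k).subset (Set.image_mono (Set.subset_univ A))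

theorem closeOn_univ_iff {α β : G → H} :
    CloseOn {Set.univ} α β ↔ ∀ g k, (Set.range fun x => α (g * x) * (β (k * x))⁻¹).Finite := by
  simp [CloseOn]

theorem closeOn_id (𝒯 : Set (Set G)) : CloseOn 𝒯 (id : G → G) id := fun A _ g k =>
  (Set.finite_singleton (g * k⁻¹)).subset (by rintro _ ⟨x, -, rfl⟩; simp)

theorem closeOn_imageTranslates_iff {X : Type*} {φ : X → H} {α β : H → K} :
    CloseOn (imageTranslates φ) α β ↔
      ∀ g k, (Set.range fun x => α (g * φ x) * (β (k * φ x))⁻¹).Finite := by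
  refine ⟨fun h g k => (h _ ⟨1, rfl⟩ g k).subset ?_, fun h A hA g k => ?_⟩
  · rintro _ ⟨x, rfl⟩
    exact ⟨_, ⟨x, rfl⟩, by simp⟩
  · obtain ⟨a, rfl⟩ := hA
    refine (h (g * a) (k * a)).subset ?_
    rintro _ ⟨_, ⟨x, rfl⟩, rfl⟩
    exact ⟨x, by simp [mul_assoc]⟩

/-- The two points `g x` and `k x` differ by the constant `g k⁻¹`, so a coarse map is controlled. -/
theorem IsCoarseMap.closeOn {φ : G → H} (hφ : IsCoarseMap φ) (𝒯 : Set (Set G)) :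
    CloseOn 𝒯 φ φ := by
  refine CloseOn.of_univ (closeOn_univ_iff.2 fun g k => ?_) 𝒯
  refine (hφ.finite_image (Set.range fun x => (g * x, k * x)) ?_).subset ?_
  · refine (Set.finite_singleton (g * k⁻¹)).subset ?_
    rintro _ ⟨_, ⟨x, rfl⟩, rfl⟩
    simp
  · rintro _ ⟨x, rfl⟩
    exact ⟨_, ⟨x, rfl⟩, rfl⟩

theorem IsClose.closeOn {φ ϕ : G → H} (h : IsClose φ ϕ) (hφ : IsCoarseMap φ)
    (𝒯 : Set (Set G)) : CloseOn 𝒯 φ ϕ := by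
  refine CloseOn.of_univ (closeOn_univ_iff.2 fun g k => ?_) 𝒯
  refine ((closeOn_univ_iff.1 (hφ.closeOn _) g k).mul h).subset ?_
  rintro _ ⟨x, rfl⟩
  exact ⟨_, ⟨x, rfl⟩, _, ⟨k * x, rfl⟩, by simp⟩

theorem IsCoarseEmbedding.isCoarseMap {φ : G → H} (hφ : IsCoarseEmbedding φ) :
    IsCoarseMap φ := by
  refine ⟨fun y => ?_, fun S hS => (hφ S).1 hS⟩
  have h : ((fun p : G × G => p.1 * p.2⁻¹) '' ((φ ⁻¹' {y}) ×ˢ (φ ⁻¹' {y}))).Finite := by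
    refine (hφ _).2 ((Set.finite_singleton 1).subset ?_)
    rintro _ ⟨⟨a, b⟩, ⟨ha, hb⟩, rfl⟩
    have ha : φ a = y := ha
    have hb : φ b = y := hb
    simp [ha, hb]
  rcases (φ ⁻¹' {y}).eq_empty_or_nonempty with h0 | ⟨t, ht⟩
  · simp [h0]
  · refine (h.image (· * t)).subset fun x hx => ?_
    exact ⟨_, ⟨(x, t), ⟨hx, ht⟩, rfl⟩, by simp⟩

theorem IsCoarseMap.comp {φ : G → H} {ψ : H → K} (hψ : IsCoarseMap ψ) (hφ : IsCoarseMap φ) :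
    IsCoarseMap (ψ ∘ φ) := by
  refine ⟨fun y => ?_, fun S hS => ?_⟩
  · rw [Set.preimage_comp]
    exact (hψ.finite_preimage y).preimage' fun b _ => hφ.finite_preimage b
  · have := hψ.finite_image (Prod.map φ φ '' S) (by
      rw [Set.image_image]
      exact hφ.finite_image S hS)
    rw [Set.image_image] at this
    exact this

theorem IsCoarseMap.finiteFibers {φ : G → H} (hφ : IsCoarseMap φ) (A : Set G) :
    FiniteFibers φ A := fun y => (hφ.finite_preimage y).inter_of_left A

section Inverse

/-- Near `φ(G)` the index `j` in the construction of `ω` is bounded: if `y = g φ(x)` then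
`φ (ω y)` is `k⁻¹ y` with `k` in a finite set that depends on `g` only. -/
theorem IsCoarseInverse.exists_finset {X : Type*} {φ : X → H} {ω : H → X}
    (hω : IsCoarseInverse φ ω) (g : H) :
    ∃ F : Finset H, ∀ x, ∃ k ∈ F, φ (ω (g * φ x)) = k⁻¹ * (g * φ x) := by
  classical
  obtain ⟨X, e, -, he, -, h⟩ := hω
  obtain ⟨i, rfl⟩ := he g
  refine ⟨(Finset.range (i + 1)).image e, fun x => ?_⟩
  obtain ⟨j, hj, -, hj'⟩ := h (e i * φ x)
  refine ⟨e j, Finset.mem_image_of_mem e (Finset.mem_range.2 ?_), hj'⟩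
  by_contra hij
  exact hj i (by omega) ⟨x, by simp⟩

theorem IsCoarseInverse.apply_apply {X : Type*} {φ : X → H} {ω : H → X}
    (hω : IsCoarseInverse φ ω) (x : X) :
    φ (ω (φ x)) = φ x := by
  obtain ⟨X, e, -, -, he, h⟩ := hω
  obtain ⟨j, hj, -, hj'⟩ := h (φ x)
  have : j = 0 := by
    by_contra h0
    exact hj 0 (Nat.pos_of_ne_zero h0) ⟨x, by simp [he]⟩
  rw [hj', this, he, inv_one, one_mul]

variable {φ : G → H} {ω : H → G}

/-- `φ ∘ ω` is close to the identity near `φ(G)`, but in general not on all of `H`. -/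
theorem IsCoarseInverse.closeOn_comp_id {X : Type*} {φ : X → H} {ω : H → X}
    (hω : IsCoarseInverse φ ω) :
    CloseOn (imageTranslates φ) (φ ∘ ω) id := by
  refine closeOn_imageTranslates_iff.2 fun g k => ?_
  obtain ⟨F, hF⟩ := hω.exists_finset g
  refine (F.finite_toSet.image fun a => a⁻¹ * g * k⁻¹).subset ?_
  rintro _ ⟨x, rfl⟩
  obtain ⟨a, ha, h⟩ := hF x
  refine ⟨a, ha, ?_⟩
  simp only [Function.comp_apply, h, id]
  group

/-- `ω` is controlled near `φ(G)`: `φ ∘ ω` is, and a coarse embedding reflects finiteness. In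
general `ω` is not a coarse map. -/
theorem IsCoarseInverse.closeOn (hω : IsCoarseInverse φ ω) (hφ : IsCoarseEmbedding φ) :
    CloseOn (imageTranslates φ) ω ω := by
  have h := hω.closeOn_comp_id.trans hω.closeOn_comp_id.symm
  refine closeOn_imageTranslates_iff.2 fun g k => ?_
  have h1 := closeOn_imageTranslates_iff.1 h g k
  have h2 := (hφ (Set.range fun x => (ω (g * φ x), ω (k * φ x)))).2 (h1.subset (by
    rintro _ ⟨_, ⟨x, rfl⟩, rfl⟩
    exact ⟨x, rfl⟩))
  refine h2.subset ?_
  rintro _ ⟨x, rfl⟩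
  exact ⟨_, ⟨x, rfl⟩, rfl⟩

theorem IsCoarseInverse.closeOn_comp_id_right (hω : IsCoarseInverse φ ω) (hφ : IsCoarseEmbedding φ)
    (𝒯 : Set (Set G)) : CloseOn 𝒯 (ω ∘ φ) id := by
  refine CloseOn.of_univ (closeOn_univ_iff.2 fun g k => ?_) 𝒯
  have h := (hφ (Set.range fun x => (ω (φ (g * x)), g * x))).2
    ((Set.finite_singleton 1).subset (by
      rintro _ ⟨_, ⟨x, rfl⟩, rfl⟩
      simp [hω.apply_apply]))
  refine (h.image (· * (g * k⁻¹))).subset ?_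
  rintro _ ⟨x, rfl⟩
  exact ⟨_, ⟨_, ⟨x, rfl⟩, rfl⟩, by simp [mul_assoc]⟩

end Inverse
end CloseOn

/-! ### Res-invariant submodules under push-forward and pull-back -/

namespace ResSubmodule

variable {R G H K W : Type*} [CommRing R] [Group G] [Group H] [Group K] [AddCommGroup W]
  [Module R W]

theorem ext_mem {L L' : ResSubmodule R G W}
    (h : ∀ f, f ∈ L.toSubmodule ↔ f ∈ L'.toSubmodule) : L = L' := by
  have : L.toSubmodule = L'.toSubmodule := Submodule.ext h
  cases L
  cases L'
  simp only at this
  subst this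
  rfl

theorem resSpan_le {S : Set (G → W)} {P : ResSubmodule R G W} (h : S ⊆ P.toSubmodule)
    {f : G → W} (hf : f ∈ (resSpan (R := R) S).toSubmodule) : f ∈ P.toSubmodule := hf P h

theorem subset_resSpan (S : Set (G → W)) : S ⊆ (resSpan (R := R) S).toSubmodule :=
  fun _ hf _ hP => hP hf

theorem leftTranslate_one {W : Type*} (f : G → W) : leftTranslate 1 f = f := by
  funext x
  simp [leftTranslate]

/-- The supports of the functions in `L`. -/
def supports (L : ResSubmodule R G W) : Set (Set G) :=
  Function.support '' (L.toSubmodule : Set (G → W))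

/-- `α_* f` is defined and lies in `N` for every `f ∈ L`. -/
structure Pushes (L : ResSubmodule R G W) (N : ResSubmodule R H W) (α : G → H) : Prop where
  finiteFibers : ∀ f ∈ L.toSubmodule, FiniteFibers α f.support
  mem : ∀ f ∈ L.toSubmodule, fiberSum α f ∈ N.toSubmodule

/-- `f ∘ α` lies in `L` for every `f ∈ M`. -/
def Pulls (M : ResSubmodule R H W) (L : ResSubmodule R G W) (α : G → H) : Prop :=
  ∀ f ∈ M.toSubmodule, f ∘ α ∈ L.toSubmodule

theorem finiteFibers_of_finite_image {X : Type*} {u v : X → H} {A : Set X}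
    (h : ((fun x => u x * (v x)⁻¹) '' A).Finite) (hv : FiniteFibers v A) : FiniteFibers u A := by
  intro z
  refine (h.biUnion fun k _ => hv (k⁻¹ * z)).subset fun x hx => ?_
  refine Set.mem_biUnion (Set.mem_image_of_mem _ hx.2) ⟨?_, hx.2⟩
  have : u x = z := hx.1
  simp [← this]

theorem fiberSum_mem_of_finite_image {L : ResSubmodule R G W} {N : ResSubmodule R H W}
    {u v : G → H} {f : G → W} (hv : Pushes L N v) (hf : f ∈ L.toSubmodule)
    (h : ((fun x => u x * (v x)⁻¹) '' f.support).Finite) : fiberSum u f ∈ N.toSubmodule := by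
  rw [fiberSum_eq_sum_leftTranslate h.toFinset
    (fun x hx => h.mem_toFinset.2 ⟨x, hx, rfl⟩)
    (finiteFibers_of_finite_image h (hv.finiteFibers f hf))]
  exact N.sum_mem fun k _ => N.translate_mem' _ _ (hv.mem _ (L.res_mem' _ _ hf))

theorem Pushes.of_finite_range {L : ResSubmodule R G W} {N : ResSubmodule R H W} {u v : G → H}
    (hv : Pushes L N v) (h : (Set.range fun x => u x * (v x)⁻¹).Finite) : Pushes L N u :=
  have h' := fun A => h.subset (Set.image_subset_range (fun x => u x * (v x)⁻¹) A)
  ⟨fun f hf => finiteFibers_of_finite_image (h' _) (hv.finiteFibers f hf),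
    fun _ hf => fiberSum_mem_of_finite_image hv hf (h' _)⟩

theorem Pushes.of_close {L : ResSubmodule R G W} {N : ResSubmodule R H W} {u v : G → H}
    (hv : Pushes L N v) (h : CloseOn L.supports u v) : Pushes L N u := by
  have h' : ∀ f ∈ L.toSubmodule, ((fun x => u x * (v x)⁻¹) '' f.support).Finite :=
    fun f hf => by simpa using h _ ⟨f, hf, rfl⟩ 1 1
  exact ⟨fun f hf => finiteFibers_of_finite_image (h' f hf) (hv.finiteFibers f hf),
    fun f hf => fiberSum_mem_of_finite_image hv hf (h' f hf)⟩

theorem pushes_id (L : ResSubmodule R G W) : Pushes L L id :=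
  ⟨fun _ _ y => (Set.finite_singleton y).subset fun _ hx => hx.1,
    fun f hf => by rwa [fiberSum_id]⟩

theorem pushes_push (L : ResSubmodule R G W) {φ : G → H} (hφ : IsCoarseMap φ) :
    Pushes L (L.push φ) φ :=
  ⟨fun _ _ => hφ.finiteFibers _, fun f hf => subset_resSpan _ ⟨f, hf, rfl⟩⟩

theorem Pushes.comp {L : ResSubmodule R G W} {N : ResSubmodule R H W} {P : ResSubmodule R K W}
    {φ : G → H} {ψ : H → K} (hψ : Pushes N P ψ) (hφ : Pushes L N φ)
    (h : ∀ f ∈ L.toSubmodule, FiniteFibers (ψ ∘ φ) f.support) : Pushes L P (ψ ∘ φ) :=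
  ⟨h, fun f hf => by
    rw [← fiberSum_comp (h f hf)]
    exact hψ.mem _ (hφ.mem f hf)⟩

/-- Functions in `φ_* L` are supported near `φ(G)`, so maps that are close near `φ(G)` are close on
their supports. -/
theorem closeOn_supports_push (L : ResSubmodule R G W) {φ : G → H} {α β : H → K}
    (h : CloseOn (imageTranslates φ) α β) : CloseOn (L.push φ).supports α β := by
  rintro _ ⟨f, hf, rfl⟩
  -- the functions on whose supports `α` and `β` are close form a res-invariant submodule
  let P : ResSubmodule R H W :=
    { carrier := {f | ∀ g k, ((fun x => α (g * x) * (β (k * x))⁻¹) '' f.support).Finite}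
      add_mem' := fun {a b} ha hb g k => ((ha g k).union (hb g k)).subset (by
        rw [← Set.image_union]
        exact Set.image_mono (Function.support_add a b))
      zero_mem' := fun g k => by simp
      smul_mem' := fun r a ha g k =>
        (ha g k).subset (Set.image_mono (Function.support_const_smul_subset r a))
      translate_mem' := fun a f hf g k => by
        refine (hf (g * a) (k * a)).subset ?_
        rintro _ ⟨x, hx, rfl⟩
        exact ⟨a⁻¹ * x, hx, by simp [mul_assoc]⟩
      res_mem' := fun A f hf g k =>
        (hf g k).subset (Set.image_mono (support_indicator_subset_support A f)) }
  refine resSpan_le (P := P) ?_ hf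
  rintro _ ⟨f, -, rfl⟩ g k
  refine (closeOn_imageTranslates_iff.1 h g k).subset ?_
  rintro _ ⟨y, hy, rfl⟩
  obtain ⟨x, -, rfl⟩ := support_fiberSum_subset φ f hy
  exact ⟨x, rfl⟩

/-- Push-forward along `ψ` is defined on `φ_* L` as soon as push-forward along `ψ ∘ φ` is defined
on `L`, provided `ψ` is controlled near the image of `φ`. -/
theorem pushes_of_comp {L : ResSubmodule R G W} {N : ResSubmodule R K W} {φ : G → H} {ψ : H → K}
    (hψ : CloseOn (imageTranslates φ) ψ ψ) (h : Pushes L N (ψ ∘ φ)) :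
    Pushes (L.push φ) N ψ := by
  -- quantifying over translations and restrictions makes the condition res-invariant
  let P : ResSubmodule R H W :=
    { carrier := {f | ∀ (h : H) (B : Set H), FiniteFibers ψ (leftTranslate h f).support ∧
        fiberSum ψ (B.indicator (leftTranslate h f)) ∈ N.toSubmodule}
      add_mem' := fun {a b} ha hb h B => by
        refine ⟨((ha h B).1.union (hb h B).1).mono (Function.support_add _ _), ?_⟩
        have : B.indicator (leftTranslate h (a + b)) =
            B.indicator (leftTranslate h a) + B.indicator (leftTranslate h b) :=
          Set.indicator_add' B _ _
        rw [this, fiberSum_add ((ha h B).1.mono (support_indicator_subset_support _ _))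
          ((hb h B).1.mono (support_indicator_subset_support _ _))]
        exact N.add_mem (ha h B).2 (hb h B).2
      zero_mem' := fun h B => by
        have h0 : leftTranslate h (0 : H → W) = 0 := rfl
        rw [h0, Set.indicator_zero', fiberSum_zero]
        exact ⟨fun y => by simp, N.zero_mem⟩
      smul_mem' := fun r a ha h B => by
        refine ⟨(ha h B).1.mono (Function.support_const_smul_subset r _), ?_⟩
        have : B.indicator (leftTranslate h (r • a)) = r • B.indicator (leftTranslate h a) :=
          Set.indicator_const_smul B r _
        rw [this, fiberSum_smul r ((ha h B).1.mono (support_indicator_subset_support _ _))]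
        exact N.smul_mem r (ha h B).2
      translate_mem' := fun g f hf h B => by
        have : leftTranslate h (leftTranslate g f) = leftTranslate (h * g) f := by
          funext x
          simp [leftTranslate, mul_assoc]
        rw [this]
        exact hf (h * g) B
      res_mem' := fun A f hf h B => by
        classical
        have : leftTranslate h (A.indicator f) =
            {x | h⁻¹ * x ∈ A}.indicator (leftTranslate h f) := by
          funext x
          simp [leftTranslate, Set.indicator_apply]
        rw [this, Set.indicator_indicator]
        exact ⟨(hf h B).1.mono (support_indicator_subset_support _ _), (hf h _).2⟩ }
  have hP : ∀ f ∈ (L.push φ).toSubmodule, f ∈ P.toSubmodule := by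
    refine fun f hf => resSpan_le (P := P) ?_ hf
    rintro _ ⟨f, hf, rfl⟩ a B
    have hf : f ∈ L.toSubmodule := hf
    have hcl : ∀ A : Set G,
        ((fun x => (ψ ∘ fun x => a * φ x) x * ((ψ ∘ φ) x)⁻¹) '' A).Finite := fun A => by
      refine (closeOn_imageTranslates_iff.1 hψ a 1).subset ?_
      rintro _ ⟨x, -, rfl⟩
      exact ⟨x, by simp⟩
    have hfib := finiteFibers_of_finite_image (hcl f.support) (h.finiteFibers f hf)
    rw [leftTranslate_fiberSum]
    refine ⟨hfib.image.mono (support_fiberSum_subset _ _), ?_⟩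
    rw [indicator_fiberSum, fiberSum_comp
      (hfib.mono (support_indicator_subset_support _ _))]
    exact fiberSum_mem_of_finite_image h (L.res_mem' _ _ hf) (hcl _)
  refine ⟨fun f hf => ?_, fun f hf => ?_⟩
  · simpa [leftTranslate_one] using (hP f hf 1 Set.univ).1
  · simpa [leftTranslate_one] using (hP f hf 1 Set.univ).2

theorem push_eq_of_close (L : ResSubmodule R G W) {φ ϕ : G → H} (hφ : IsCoarseMap φ)
    (hϕ : IsCoarseMap ϕ) (h : IsClose φ ϕ) : L.push φ = L.push ϕ := by
  have hc := h.closeOn hφ L.supports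
  refine ext_mem fun f => ⟨fun hf => resSpan_le ?_ hf, fun hf => resSpan_le ?_ hf⟩
  · rintro _ ⟨f, hf, rfl⟩
    exact ((L.pushes_push hϕ).of_close hc).mem f hf
  · rintro _ ⟨f, hf, rfl⟩
    exact ((L.pushes_push hφ).of_close hc.symm).mem f hf

theorem push_push (L : ResSubmodule R G W) {φ : G → H} {ψ : H → K} (hφ : IsCoarseMap φ)
    (hψ : IsCoarseMap ψ) : (L.push φ).push ψ = L.push (ψ ∘ φ) := by
  have hψφ := hψ.comp hφ
  refine ext_mem fun f => ⟨fun hf => resSpan_le ?_ hf, fun hf => resSpan_le ?_ hf⟩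
  · rintro _ ⟨f, hf, rfl⟩
    exact (pushes_of_comp (hψ.closeOn _) (L.pushes_push hψφ)).mem f hf
  · rintro _ ⟨f, hf, rfl⟩
    exact (((L.push φ).pushes_push hψ).comp (L.pushes_push hφ)
      fun f _ => hψφ.finiteFibers _).mem f hf

theorem pulls_pull (M : ResSubmodule R H W) (φ : G → H) : Pulls M (M.pull φ) φ :=
  fun f hf => subset_resSpan _ ⟨f, hf, rfl⟩

theorem pulls_invPull (L : ResSubmodule R G W) (φ : G → H) : Pulls (L.invPull φ) L φ :=
  fun f hf => by simpa [leftTranslate_one] using hf 1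

theorem Pulls.of_finite_range {M : ResSubmodule R H W} {L : ResSubmodule R G W} {u v : G → H}
    (hv : Pulls M L v) (h : (Set.range fun x => u x * (v x)⁻¹).Finite) : Pulls M L u :=
  fun f hf => by
    rw [comp_eq_sum_leftTranslate f h.toFinset fun x => h.mem_toFinset.2 ⟨x, rfl⟩]
    exact L.sum_mem fun k _ => L.res_mem' _ _ (hv _ (M.translate_mem' _ _ hf))

theorem Pulls.of_close {M : ResSubmodule R H W} {L : ResSubmodule R G W} {u v : G → H}
    (hv : Pulls M L v) (h : CloseOn {Set.univ} u v) : Pulls M L u :=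
  hv.of_finite_range (by simpa using closeOn_univ_iff.1 h 1 1)

theorem Pulls.pull_le {M : ResSubmodule R H W} {L : ResSubmodule R G W} {φ : G → H}
    (h : Pulls M L φ) {f : G → W} (hf : f ∈ (M.pull φ).toSubmodule) : f ∈ L.toSubmodule :=
  resSpan_le (by rintro _ ⟨f, hf, rfl⟩; exact h f hf) hf

theorem pulls_id (L : ResSubmodule R G W) : Pulls L L id := fun _ hf => hf

theorem Pulls.comp {N : ResSubmodule R K W} {M : ResSubmodule R H W} {L : ResSubmodule R G W}
    {φ : G → H} {ψ : H → K} (hψ : Pulls N M ψ) (hφ : Pulls M L φ) : Pulls N L (ψ ∘ φ) :=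
  fun f hf => hφ _ (hψ f hf)

/-- If `f ∘ ψ ∘ φ ∈ L` for all `f ∈ N` and `ψ` is controlled near the image of `φ`, then `ψ`
pulls `N` back into `φ^{*-1} L`. -/
theorem Pulls.invPull_of_comp {N : ResSubmodule R K W} {L : ResSubmodule R G W} {φ : G → H}
    {ψ : H → K} (hψ : CloseOn (imageTranslates φ) ψ ψ) (h : Pulls N L (ψ ∘ φ)) :
    Pulls N (L.invPull φ) ψ := by
  intro f hf a
  refine h.of_finite_range (u := fun x => ψ (a⁻¹ * φ x)) ?_ f hf
  simpa using closeOn_imageTranslates_iff.1 hψ a⁻¹ 1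

theorem pull_eq_of_close (M : ResSubmodule R H W) {φ ϕ : G → H} (hφ : IsCoarseMap φ)
    (h : IsClose φ ϕ) : M.pull φ = M.pull ϕ := by
  have hc := h.closeOn hφ {Set.univ}
  exact ext_mem fun f => ⟨((M.pulls_pull ϕ).of_close hc).pull_le,
    ((M.pulls_pull φ).of_close hc.symm).pull_le⟩

/-- Pull-back along `φ` maps `ψ^* N` to `L` as soon as pull-back along `ψ ∘ φ` maps `N` to `L`,
provided `ψ` is controlled near the image of `φ`. -/
theorem Pulls.pull_of_comp {N : ResSubmodule R K W} {L : ResSubmodule R G W} {φ : G → H}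
    {ψ : H → K} (hψ : CloseOn (imageTranslates φ) ψ ψ) (h : Pulls N L (ψ ∘ φ)) :
    Pulls (N.pull ψ) L φ := fun _ hf =>
  L.pulls_invPull φ _ ((h.invPull_of_comp hψ).pull_le hf)

theorem pull_pull (N : ResSubmodule R K W) {φ : G → H} {ψ : H → K} (hψ : IsCoarseMap ψ) :
    (N.pull ψ).pull φ = N.pull (ψ ∘ φ) :=
  ext_mem fun _ => ⟨((N.pulls_pull _).pull_of_comp (hψ.closeOn _)).pull_le,
    ((N.pulls_pull ψ).comp ((N.pull ψ).pulls_pull φ)).pull_le⟩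

theorem pulls_coarseInverse (L : ResSubmodule R G W) {φ : G → H} {ω : H → G}
    (hφ : IsCoarseEmbedding φ) (hω : IsCoarseInverse φ ω) : Pulls L (L.invPull φ) ω :=
  (L.pulls_id.of_close (hω.closeOn_comp_id_right hφ _)).invPull_of_comp (hω.closeOn hφ)

theorem pull_invPull (L : ResSubmodule R G W) {φ : G → H} {ω : H → G}
    (hφ : IsCoarseEmbedding φ) (hω : IsCoarseInverse φ ω) : (L.invPull φ).pull φ = L := by
  refine ext_mem fun f => ⟨(L.pulls_invPull φ).pull_le, fun hf => ?_⟩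
  exact
    ((L.pulls_coarseInverse hφ hω).comp ((L.invPull φ).pulls_pull φ)).of_close
      (hω.closeOn_comp_id_right hφ _).symm f hf

theorem pushes_coarseInverse (L : ResSubmodule R G W) {φ : G → H} {ω : H → G}
    (hφ : IsCoarseEmbedding φ) (hω : IsCoarseInverse φ ω) : Pushes (L.push φ) L ω :=
  pushes_of_comp (hω.closeOn hφ) (L.pushes_id.of_close (hω.closeOn_comp_id_right hφ _))

/-- Membership in `L` can be tested after restriction to the sets of the family `𝒯`. -/
def DetectedOn (L : ResSubmodule R G W) (𝒯 : Set (Set G)) : Prop :=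
  ∀ f : G → W, (∀ A ∈ 𝒯, A.indicator f ∈ L.toSubmodule) → f ∈ L.toSubmodule

theorem detectedOn_univ (L : ResSubmodule R G W) : L.DetectedOn {Set.univ} :=
  fun f h => by simpa using h Set.univ rfl

/-- Membership of `f` in `φ^{*-1} L` only involves the values of `f` on translates of `φ(G)`. -/
theorem detectedOn_invPull (L : ResSubmodule R G W) (φ : G → H) :
    (L.invPull φ).DetectedOn (imageTranslates φ) := fun f h a => by
  have := h (Set.range fun x => a⁻¹ * φ x) ⟨a⁻¹, rfl⟩ a
  refine (congrArg (· ∈ L.toSubmodule) (funext fun x => ?_)).mp this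
  exact Set.indicator_of_mem (s := Set.range fun x => a⁻¹ * φ x) ⟨x, rfl⟩ f

end ResSubmodule

/-! ### Chains as functions on tuples -/

namespace ResSubmodule

section Chains

variable {R G H K W : Type*} [CommRing R] [Group G] [Group H] [Group K] [AddCommGroup W]
  [Module R W] (L : ResSubmodule R G W) {N : ResSubmodule R H W} {P : ResSubmodule R K W}

/-- A chain as a function on homogeneous tuples. -/
noncomputable def chainLin (n : ℕ) :
    ((Fin n → G) →₀ L.toSubmodule) →ₗ[R] (Fin (n + 1) → G) → W where
  toFun c x := (c ((homog n).symm x).2).1 ((homog n).symm x).1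
  map_add' _ _ := rfl
  map_smul' _ _ := rfl

theorem chainLin_homog {n : ℕ} (c : (Fin n → G) →₀ L.toSubmodule) (x : G) (g : Fin n → G) :
    L.chainLin n c (homog n (x, g)) = (c g).1 x := by
  change (c ((homog n).symm (homog n (x, g))).2).1 ((homog n).symm (homog n (x, g))).1 = _
  rw [Equiv.symm_apply_apply]

theorem chainLin_injective (n : ℕ) : Function.Injective (L.chainLin n) := by
  intro c c' h
  ext g x
  rw [← chainLin_homog, h, chainLin_homog]

theorem chainLin_single {n : ℕ} (g : Fin n → G) (f : L.toSubmodule) :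
    L.chainLin n (Finsupp.single g f) = fiberSum (fun x => homog n (x, g)) f.1 := by
  classical
  funext y
  obtain ⟨⟨x, g'⟩, rfl⟩ := (homog n).surjective y
  rw [chainLin_homog, Finsupp.single_apply]
  split_ifs with h
  · subst h
    exact (fiberSum_of_injective (u := fun x => homog n (x, g))
      (fun a b hab => (Prod.ext_iff.1 ((homog n).injective hab)).1) f.1 x).symm
  · symm
    by_contra h0
    obtain ⟨x', -, hx'⟩ := support_fiberSum_subset _ _ (Function.mem_support.2 h0)
    exact h (Prod.ext_iff.1 ((homog n).injective hx')).2

variable {L}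

/-- The map `θ` on tuples has finite fibres on the support of every chain. -/
def ChainFinite (L : ResSubmodule R G W) {n : ℕ} {Y : Type*} (θ : (Fin (n + 1) → G) → Y) : Prop :=
  ∀ (g : Fin n → G), ∀ f ∈ L.toSubmodule, FiniteFibers (fun x => θ (homog n (x, g))) f.support

theorem ChainFinite.finiteFibers {n : ℕ} {Y : Type*} {θ : (Fin (n + 1) → G) → Y}
    (h : ChainFinite L θ) (c : (Fin n → G) →₀ L.toSubmodule) :
    FiniteFibers θ (L.chainLin n c).support := by
  intro y
  refine (c.support.finite_toSet.biUnion fun g _ =>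
    ((h g _ (c g).2) y).image fun x => homog n (x, g)).subset ?_
  rintro t ⟨ht, hc⟩
  obtain ⟨⟨x, g⟩, rfl⟩ := (homog n).surjective t
  rw [Function.mem_support, chainLin_homog] at hc
  refine Set.mem_biUnion (x := g) ?_ ⟨x, ⟨ht, hc⟩, rfl⟩
  rw [Finset.mem_coe, Finsupp.mem_support_iff]
  exact fun h0 => hc (by rw [h0]; rfl)

theorem finiteFibers_mulLeft {Z : Type*} {α : G → Z}
    (hα : ∀ f ∈ L.toSubmodule, FiniteFibers α f.support) (g : G) {f : G → W}
    (hf : f ∈ L.toSubmodule) : FiniteFibers (fun x => α (g * x)) f.support := by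
  intro z
  refine ((hα _ (L.translate_mem' g f hf) z).preimage
    (mul_right_injective g).injOn).subset fun x hx => ⟨hx.1, ?_⟩
  rw [mem_support_leftTranslate, inv_mul_cancel_left]
  exact hx.2

/-- A map on tuples has finite fibres on the support of chains if one of its entries, as a
function of one of the variables, has finite fibres on the supports of the functions in `L`. -/
theorem ChainFinite.of_apply {n : ℕ} {Y : Type*} {θ : (Fin (n + 1) → G) → Y} {Z : Type*}
    {α : G → Z} (π : Y → Z) (s : Fin (n + 1)) (h : ∀ x, π (θ x) = α (x s))
    (hα : ∀ f ∈ L.toSubmodule, FiniteFibers α f.support) : ChainFinite L θ := fun g _ hf =>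
  FiniteFibers.of_comp (v := π) ((finiteFibers_mulLeft hα (Fin.partialProd g s)⁻¹ hf).congr
    fun x _ => (h (homog n (x, g))).symm)

/-- Push-forward along `θ` maps chains with coefficients in `L` to chains with coefficients
in `N`. -/
structure ChainPushes (L : ResSubmodule R G W) (N : ResSubmodule R H W) {n m : ℕ}
    (θ : (Fin (n + 1) → G) → (Fin (m + 1) → H)) : Prop where
  finite : ChainFinite L θ
  mem : ∀ (g : Fin n → G), ∀ f ∈ L.toSubmodule,
    fiberSum (fun x => θ (homog n (x, g))) f ∈ LinearMap.range (N.chainLin m)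

theorem ChainPushes.fiberSum_mem {n m : ℕ} {θ : (Fin (n + 1) → G) → (Fin (m + 1) → H)}
    (h : ChainPushes L N θ) (c : (Fin n → G) →₀ L.toSubmodule) :
    fiberSum θ (L.chainLin n c) ∈ LinearMap.range (N.chainLin m) := by
  induction c using Finsupp.induction_linear with
  | zero =>
    rw [map_zero, fiberSum_zero]
    exact Submodule.zero_mem _
  | add c c' hc hc' =>
    rw [map_add, fiberSum_add (h.finite.finiteFibers c) (h.finite.finiteFibers c')]
    exact Submodule.add_mem _ hc hc'
  | single g f =>
    rw [chainLin_single, fiberSum_comp (h.finite g f.1 f.2)]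
    exact h.mem g f.1 f.2

/-- The push-forward of a chain along a map of tuples. -/
noncomputable def ChainPushes.mapFun {n m : ℕ} {θ : (Fin (n + 1) → G) → (Fin (m + 1) → H)}
    (h : ChainPushes L N θ) (c : (Fin n → G) →₀ L.toSubmodule) : (Fin m → H) →₀ N.toSubmodule :=
  (h.fiberSum_mem c).choose

theorem ChainPushes.chainLin_mapFun {n m : ℕ} {θ : (Fin (n + 1) → G) → (Fin (m + 1) → H)}
    (h : ChainPushes L N θ) (c : (Fin n → G) →₀ L.toSubmodule) :
    N.chainLin m (h.mapFun c) = fiberSum θ (L.chainLin n c) :=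
  (h.fiberSum_mem c).choose_spec

/-- The push-forward of chains along a map of tuples, as a linear map. -/
noncomputable def ChainPushes.map {n m : ℕ} {θ : (Fin (n + 1) → G) → (Fin (m + 1) → H)}
    (h : ChainPushes L N θ) :
    ((Fin n → G) →₀ L.toSubmodule) →ₗ[R] ((Fin m → H) →₀ N.toSubmodule) where
  toFun := h.mapFun
  map_add' c c' := N.chainLin_injective m (by
    rw [map_add, h.chainLin_mapFun, h.chainLin_mapFun, h.chainLin_mapFun, map_add,
      fiberSum_add (h.finite.finiteFibers c) (h.finite.finiteFibers c')])
  map_smul' r c := N.chainLin_injective m (by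
    rw [map_smul, h.chainLin_mapFun, h.chainLin_mapFun, map_smul,
      fiberSum_smul r (h.finite.finiteFibers c), RingHom.id_apply])

theorem ChainPushes.chainLin_map {n m : ℕ} {θ : (Fin (n + 1) → G) → (Fin (m + 1) → H)}
    (h : ChainPushes L N θ) (c : (Fin n → G) →₀ L.toSubmodule) :
    N.chainLin m (h.map c) = fiberSum θ (L.chainLin n c) := h.chainLin_mapFun c

theorem ChainPushes.chainLin_map_map {n m l : ℕ} {θ : (Fin (n + 1) → G) → (Fin (m + 1) → H)}
    {θ' : (Fin (m + 1) → H) → (Fin (l + 1) → K)} (h : ChainPushes L N θ)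
    (h' : ChainPushes N P θ') (hc : ChainFinite L (θ' ∘ θ)) (c : (Fin n → G) →₀ L.toSubmodule) :
    P.chainLin l (h'.map (h.map c)) = fiberSum (θ' ∘ θ) (L.chainLin n c) := by
  rw [h'.chainLin_map, h.chainLin_map, fiberSum_comp (hc.finiteFibers c)]

/-- Maps that are given in each entry by a function of one of the variables, with these functions
pairwise close on the supports of the functions in `L`, push chains forward to chains. -/
theorem ChainPushes.of_closeOn {n m : ℕ} (α : Fin (m + 1) → G → H)
    (s : Fin (m + 1) → Fin (n + 1)) (hα : ∀ i j, CloseOn L.supports (α i) (α j))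
    (h0 : Pushes L N (α 0)) :
    ChainPushes L N (fun x : Fin (n + 1) → G => fun i => α i (x (s i))) := by
  have hfin : ChainFinite L (fun x : Fin (n + 1) → G => fun i => α i (x (s i))) :=
    ChainFinite.of_apply (fun y => y 0) (s 0) (fun _ => rfl) h0.finiteFibers
  refine ⟨hfin, fun g f hf => ?_⟩
  set β : G → Fin (m + 1) → H := fun x i => α i (homog n (x, g) (s i)) with hβ
  -- the group components of `β x` take finitely many values on the support of `f`
  have hd : (Set.image (fun x => ((homog m).symm (β x)).2) f.support).Finite := by
    refine (Set.Finite.pi' fun i : Fin m => hα i.castSucc i.succ _ ⟨f, hf, rfl⟩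
      (Fin.partialProd g (s i.castSucc))⁻¹ (Fin.partialProd g (s i.succ))⁻¹).subset ?_
    rintro _ ⟨x, hx, rfl⟩ i
    exact ⟨x, hx, rfl⟩
  rw [eq_sum_indicator (fun x => ((homog m).symm (β x)).2) hd.toFinset f
    fun x hx => hd.mem_toFinset.2 ⟨x, hx, rfl⟩,
    fiberSum_sum _ _ (hfin g f hf) fun _ _ => support_indicator_subset_support _ _]
  refine Submodule.sum_mem _ fun h _ => ?_
  have hmem : fiberSum (fun x => β x 0)
      (((fun x => ((homog m).symm (β x)).2) ⁻¹' {h}).indicator f) ∈ N.toSubmodule := by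
    have := h0.mem _ (L.translate_mem' (Fin.partialProd g (s 0))⁻¹ _ (L.res_mem'
      ((fun x => ((homog m).symm (β x)).2) ⁻¹' {h}) f hf))
    rwa [fiberSum_leftTranslate] at this
  refine ⟨Finsupp.single h ⟨_, hmem⟩, ?_⟩
  have hfib : FiniteFibers ((fun y => homog m (y, h)) ∘ fun x => β x 0)
      (((fun x => ((homog m).symm (β x)).2) ⁻¹' {h}).indicator f).support := fun y =>
    ((finiteFibers_mulLeft h0.finiteFibers (Fin.partialProd g (s 0))⁻¹ hf) (y 0)).subset
      fun x hx => by
        refine ⟨?_, support_indicator_subset_support _ _ hx.2⟩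
        have hy : homog m (β x 0, h) = y := hx.1
        simp [← hy, homog_apply, hβ]
  rw [chainLin_single, fiberSum_comp hfib]
  refine fiberSum_congr fun x hx => ?_
  have hxh : ((homog m).symm (β x)).2 = h := by
    by_contra h'
    exact hx (Set.indicator_of_notMem
      (s := (fun x => ((homog m).symm (β x)).2) ⁻¹' {h}) h' _)
  rw [Function.comp_apply, ← Equiv.eq_symm_apply]
  exact Prod.ext rfl hxh.symm

theorem ChainPushes.comp_left {φ : G → H} (n : ℕ) (hc : CloseOn L.supports φ φ)
    (h : Pushes L N φ) : ChainPushes L N (fun x : Fin (n + 1) → G => φ ∘ x) :=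
  ChainPushes.of_closeOn (fun _ => φ) id (fun _ _ => hc) h

theorem ChainPushes.face (L : ResSubmodule R G W) {n : ℕ} (i : Fin (n + 2)) :
    ChainPushes L L (fun x : Fin (n + 2) → G => x ∘ i.succAbove) :=
  ChainPushes.of_closeOn (fun _ => id) i.succAbove (fun _ _ => closeOn_id _) L.pushes_id

theorem ChainPushes.prism {α β : G → H} {n : ℕ} (hα : CloseOn L.supports α α)
    (hβ : CloseOn L.supports β β) (hαβ : CloseOn L.supports α β) (h : Pushes L N α)
    (j : Fin (n + 1)) : ChainPushes L N (_root_.prism α β j) := by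
  refine ChainPushes.of_closeOn (fun i => if i ≤ j.castSucc then α else β) j.predAbove
    (fun i k => ?_) ?_
  · split_ifs
    exacts [hα, hαβ, hαβ.symm, hβ]
  · simpa using h

end Chains

section ChainComplex

variable {R G H K W : Type u} [CommRing R] [Group G] [Group H] [Group K] [AddCommGroup W]
  [Module R W] {L : ResSubmodule R G W} {N : ResSubmodule R H W} {P : ResSubmodule R K W}

theorem chainFun_eq (L : ResSubmodule R G W) {n : ℕ} (c : (Fin n → G) →₀ L.toSubmodule) :
    L.chainFun c = L.chainLin n c ∘ homog n := by
  funext p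
  exact (L.chainLin_homog c p.1 p.2).symm

/-- The differential of the bar complex is the alternating sum of the push-forwards along the
face maps. -/
theorem chains_d (L : ResSubmodule R G W) (n : ℕ) :
    (groupHomology.inhomogeneousChains.d L.rep n).hom =
      ∑ i : Fin (n + 2), (-1 : R) ^ (i : ℕ) • (ChainPushes.face L i).map := by
  refine Finsupp.lhom_ext fun g f => L.chainLin_injective n ?_
  have hface : ∀ i, L.chainLin n ((ChainPushes.face L i).map (Finsupp.single g f)) =
      fiberSum (fun x => homog (n + 1) (x, g) ∘ i.succAbove) f.1 := fun i => by
    rw [ChainPushes.chainLin_map, chainLin_single,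
      fiberSum_comp ((ChainPushes.face L i).finite g f.1 f.2)]
    rfl
  have h0 : L.chainLin n (Finsupp.single (fun i => g i.succ) (L.rho (g 0)⁻¹ f)) =
      L.chainLin n ((ChainPushes.face L 0).map (Finsupp.single g f)) := by
    rw [hface, chainLin_single]
    refine (fiberSum_leftTranslate (g 0)⁻¹ _ f.1).trans ?_
    exact congrArg (fun u => fiberSum u f.1) (funext fun x => homog_tail n x g)
  have h1 : ∀ j : Fin (n + 1), L.chainLin n (Finsupp.single (Fin.contractNth j (· * ·) g) f) =
      L.chainLin n ((ChainPushes.face L j.succ).map (Finsupp.single g f)) := fun j => by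
    rw [hface, chainLin_single]
    exact congrArg (fun u => fiberSum u f.1) (funext fun x => homog_contractNth n x g j)
  have hd := groupHomology.inhomogeneousChains.d_single (A := L.rep) n g f
  rw [LinearMap.sum_apply, Fin.sum_univ_succ]
  refine (congrArg (L.chainLin n) hd).trans ?_
  refine (map_add (L.chainLin n) _ _).trans ?_
  rw [map_add, map_sum, map_sum]
  refine congrArg₂ (· + ·) (h0.trans (by simp)) ?_
  refine Finset.sum_congr rfl fun j _ => ?_
  refine (map_smul (L.chainLin n) _ _).trans ?_
  rw [h1 j, LinearMap.smul_apply, map_smul]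
  rfl

end ChainComplex
end ResSubmodule

/-! ### Homotopies indexed by natural numbers -/

section NatHomotopy

variable {V : Type*} [Category V] [Preadditive V]

/-- A homotopy between maps of chain complexes indexed by `ℕ`, from its components. -/
noncomputable def Homotopy.ofNatChain {C D : ChainComplex V ℕ} {f g : C ⟶ D}
    (s : ∀ n, C.X n ⟶ D.X (n + 1)) (h0 : f.f 0 = s 0 ≫ D.d 1 0 + g.f 0)
    (hs : ∀ n, f.f (n + 1) =
      C.d (n + 1) n ≫ s n + s (n + 1) ≫ D.d (n + 2) (n + 1) + g.f (n + 1)) :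
    Homotopy f g where
  hom i j := if h : i + 1 = j then s i ≫ (D.XIsoOfEq h).hom else 0
  zero i j hij := dif_neg hij
  comm n := by
    cases n with
    | zero =>
      rw [Homotopy.dNext_zero_chainComplex, Homotopy.prevD_chainComplex]
      simp [h0]
    | succ n =>
      rw [Homotopy.dNext_succ_chainComplex, Homotopy.prevD_chainComplex]
      simp [hs]

/-- A homotopy between maps of cochain complexes indexed by `ℕ`, from its components. -/
noncomputable def Homotopy.ofNatCochain {C D : CochainComplex V ℕ} {f g : C ⟶ D}
    (s : ∀ n, C.X (n + 1) ⟶ D.X n) (h0 : f.f 0 = C.d 0 1 ≫ s 0 + g.f 0)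
    (hs : ∀ n, f.f (n + 1) =
      C.d (n + 1) (n + 2) ≫ s (n + 1) + s n ≫ D.d n (n + 1) + g.f (n + 1)) :
    Homotopy f g where
  hom i j := if h : j + 1 = i then (C.XIsoOfEq h.symm).hom ≫ s j else 0
  zero i j hij := dif_neg hij
  comm n := by
    cases n with
    | zero =>
      rw [Homotopy.dNext_cochainComplex, Homotopy.prevD_zero_cochainComplex]
      simp [h0]
    | succ n =>
      rw [Homotopy.dNext_cochainComplex, Homotopy.prevD_succ_cochainComplex]
      simp [hs]

end NatHomotopy

/-! ### The chain maps `D_*(φ)` -/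

namespace ResSubmodule

section ChainMap

variable {R G H K W : Type u} [CommRing R] [Group G] [Group H] [Group K] [AddCommGroup W]
  [Module R W] {L : ResSubmodule R G W} {N : ResSubmodule R H W} {P : ResSubmodule R K W}

theorem chains_d_apply (L : ResSubmodule R G W) (n : ℕ)
    (c : (Fin (n + 1) → G) →₀ L.toSubmodule) :
    (L.chains.d (n + 1) n).hom c =
      ∑ i : Fin (n + 2), (-1 : R) ^ (i : ℕ) • (ChainPushes.face L i).map c := by
  have := congrArg (fun u => u c) (chains_d L n)
  rw [LinearMap.sum_apply] at this
  rw [groupHomology.inhomogeneousChains.d_def]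
  exact this

theorem Pushes.chainFinite_apply {φ : G → H} (h : Pushes L N φ) {n m : ℕ}
    {θ : (Fin (n + 1) → G) → (Fin (m + 1) → H)} (s : Fin (n + 1)) (hθ : ∀ x, θ x 0 = φ (x s)) :
    ChainFinite L θ :=
  ChainFinite.of_apply (fun y => y 0) s hθ h.finiteFibers

/-- The chain map `D_*(φ)`. -/
noncomputable def pushChain {φ : G → H} (hc : CloseOn L.supports φ φ) (h : Pushes L N φ) :
    L.chains ⟶ N.chains where
  f n := ModuleCat.ofHom (ChainPushes.comp_left n hc h).map
  comm' i j hij := by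
    obtain rfl : j + 1 = i := hij
    refine ModuleCat.hom_ext (LinearMap.ext fun c => ?_)
    have hL := chains_d_apply L j c
    have hN := chains_d_apply N j ((ChainPushes.comp_left (j + 1) hc h).map c)
    refine hN.trans (Eq.trans ?_ (congrArg (ChainPushes.comp_left j hc h).map hL).symm)
    rw [map_sum]
    refine Finset.sum_congr rfl fun i _ => ?_
    rw [map_smul]
    refine congrArg _ (N.chainLin_injective j ?_)
    rw [ChainPushes.chainLin_map_map _ _, ChainPushes.chainLin_map_map _ _]
    · rfl
    · exact h.chainFinite_apply (i.succAbove 0) fun _ => rfl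
    · exact h.chainFinite_apply (i.succAbove 0) fun _ => rfl

theorem isChainPush_iff {φ : G → H} (h : Pushes L N φ) (D : L.chains ⟶ N.chains) :
    IsChainPush φ D ↔ ∀ (n : ℕ) (c : (Fin n → G) →₀ L.toSubmodule),
      N.chainLin n ((D.f n).hom c) = fiberSum (φ ∘ ·) (L.chainLin n c) := by
  have key : ∀ (n : ℕ) (c : (Fin n → G) →₀ L.toSubmodule),
      FiniteFibers (fun x : Fin (n + 1) → G => φ ∘ x) (L.chainLin n c).support := fun n c =>
    (h.chainFinite_apply 0 fun _ => rfl).finiteFibers c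
  have htuple : ∀ n, tupleMap φ n = (homog n).symm ∘ (fun x => φ ∘ x) ∘ homog n := fun n => by
    funext p
    rw [Function.comp_apply, Equiv.eq_symm_apply]
    exact homog_tupleMap φ n p
  have heq : ∀ (n : ℕ) (c : (Fin n → G) →₀ L.toSubmodule),
      fiberSum (tupleMap φ n) (L.chainFun c) =
        fiberSum (fun x => φ ∘ x) (L.chainLin n c) ∘ homog n := fun n c => by
    rw [htuple, fiberSum_equiv_comp, fiberSum_comp_equiv, chainFun_eq]
    congr 2
    funext x
    simp
  refine forall_congr' fun n => forall_congr' fun c => ?_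
  rw [heq, chainFun_eq L, chainFun_eq N, (homog n).surjective.right_cancellable]
  refine and_iff_right fun q => ?_
  refine ((key n c (homog n q)).preimage (homog n).injective.injOn).subset ?_
  rintro p ⟨hp, hc⟩
  refine ⟨?_, ?_⟩
  · have hp : tupleMap φ n p = q := hp
    exact (homog_tupleMap φ n p).symm.trans (congrArg (homog n) hp)
  · exact hc

theorem isChainPush_pushChain {φ : G → H} (hc : CloseOn L.supports φ φ) (h : Pushes L N φ) :
    IsChainPush φ (pushChain hc h) :=
  (isChainPush_iff h _).2 fun n c => (ChainPushes.comp_left n hc h).chainLin_map c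

theorem _root_.IsChainPush.unique {φ : G → H} {D D' : L.chains ⟶ N.chains} (hD : IsChainPush φ D)
    (hD' : IsChainPush φ D') : D = D' := by
  ext n : 1
  refine ModuleCat.hom_ext (LinearMap.ext fun c => N.chainLin_injective n ?_)
  have := (hD n c).2.trans (hD' n c).2.symm
  rw [chainFun_eq, chainFun_eq] at this
  exact (homog n).surjective.injective_comp_right this

theorem _root_.IsChainPush.comp {φ : G → H} {ψ : H → K} {D : L.chains ⟶ N.chains}
    {D' : N.chains ⟶ P.chains} (hφ : Pushes L N φ) (hψ : Pushes N P ψ)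
    (hψφ : Pushes L P (ψ ∘ φ)) (hD : IsChainPush φ D) (hD' : IsChainPush ψ D') :
    IsChainPush (ψ ∘ φ) (D ≫ D') := by
  rw [isChainPush_iff hφ] at hD
  rw [isChainPush_iff hψ] at hD'
  refine (isChainPush_iff hψφ _).2 fun n c => (hD' n _).trans ?_
  refine (congrArg _ (hD n c)).trans (fiberSum_comp ?_)
  exact (hψφ.chainFinite_apply 0 fun _ => rfl).finiteFibers c

theorem isChainPush_id (L : ResSubmodule R G W) : IsChainPush id (𝟙 L.chains) :=
  (isChainPush_iff L.pushes_id _).2 fun n c => (fiberSum_id (L.chainLin n c)).symm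

section Prism

variable {α β : G → H} (hα : CloseOn L.supports α α) (hβ : CloseOn L.supports β β)
  (hαβ : CloseOn L.supports α β) (h : Pushes L N α)

/-- The prism operator on chains. -/
noncomputable def prismChain (n : ℕ) :
    ((Fin n → G) →₀ L.toSubmodule) →ₗ[R] ((Fin (n + 1) → H) →₀ N.toSubmodule) :=
  ∑ j : Fin (n + 1), (-1 : R) ^ (j : ℕ) • (ChainPushes.prism hα hβ hαβ h j).map

/-- Alternating sums of push-forwards of a chain can be computed pointwise: at a fixed tuple `y`,
the push-forward along `θ` is `∑ₓ F x (θ x)` with `F x t` equal to `c x` if `t = y` and to `0`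
otherwise, and the sum is over one finite set for all maps `θ` that occur. -/
theorem exists_finset_fiberSum (h : Pushes L N α) (h' : Pushes L N β) {n m : ℕ}
    (c : (Fin n → G) →₀ L.toSubmodule) (y : Fin (m + 1) → H) :
    ∃ (T : Finset (Fin (n + 1) → G)) (F : (Fin (n + 1) → G) → (Fin (m + 1) → H) → W),
      ∀ θ : (Fin (n + 1) → G) → (Fin (m + 1) → H),
        (∀ x, ∃ i, θ x 0 = α (x i) ∨ θ x 0 = β (x i)) →
          fiberSum θ (L.chainLin n c) y = ∑ x ∈ T, F x (θ x) := by
  classical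
  have hfin : (⋃ i : Fin (n + 1), ((fun x => α (x i)) ⁻¹' {y 0} ∩ (L.chainLin n c).support) ∪
      ((fun x => β (x i)) ⁻¹' {y 0} ∩ (L.chainLin n c).support)).Finite := by
    refine Set.finite_iUnion fun i => Set.Finite.union ?_ ?_
    · exact (ChainFinite.of_apply (L := L) (θ := fun x => α (x i)) id i (fun _ => rfl)
        h.finiteFibers).finiteFibers c (y 0)
    · exact (ChainFinite.of_apply (L := L) (θ := fun x => β (x i)) id i (fun _ => rfl)
        h'.finiteFibers).finiteFibers c (y 0)
  refine ⟨hfin.toFinset, fun x t => if t = y then L.chainLin n c x else 0, fun θ hθ =>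
    fiberSum_eq_sum _ fun x hx hc => ?_⟩
  rw [Set.Finite.mem_toFinset, Set.mem_iUnion]
  obtain ⟨i, hi⟩ := hθ x
  rw [hx] at hi
  exact ⟨i, hi.imp (fun hi => ⟨hi.symm, hc⟩) fun hi => ⟨hi.symm, hc⟩⟩

theorem chainLin_d_prismChain (n : ℕ) (c : (Fin n → G) →₀ L.toSubmodule) :
    N.chainLin n ((N.chains.d (n + 1) n).hom (prismChain hα hβ hαβ h n c)) =
      ∑ j : Fin (n + 1), (-1 : R) ^ (j : ℕ) • ∑ i : Fin (n + 2), (-1 : R) ^ (i : ℕ) •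
        fiberSum (fun x => prism α β j x ∘ i.succAbove) (L.chainLin n c) := by
  rw [prismChain, LinearMap.sum_apply]
  refine (congrArg (N.chainLin n) (map_sum (N.chains.d (n + 1) n).hom _ _)).trans ?_
  rw [map_sum]
  refine Finset.sum_congr rfl fun j _ => ?_
  refine (congrArg (N.chainLin n) (map_smul (N.chains.d (n + 1) n).hom _ _)).trans ?_
  refine (map_smul (N.chainLin n) _ _).trans (congrArg _ ?_)
  refine (congrArg (N.chainLin n) (chains_d_apply N n _)).trans ?_
  rw [map_sum]
  refine Finset.sum_congr rfl fun i _ => ?_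
  rw [map_smul, ChainPushes.chainLin_map_map]
  · rfl
  · have h' := h.of_close hαβ.symm
    by_cases hi : i.succAbove 0 ≤ j.castSucc
    · exact h.chainFinite_apply (j.predAbove (i.succAbove 0)) fun x => by simp [prism, hi]
    · exact h'.chainFinite_apply (j.predAbove (i.succAbove 0)) fun x => by simp [prism, hi]

theorem chainLin_prismChain_d (n : ℕ) (c : (Fin (n + 1) → G) →₀ L.toSubmodule) :
    N.chainLin (n + 1) (prismChain hα hβ hαβ h n ((L.chains.d (n + 1) n).hom c)) =
      ∑ i : Fin (n + 2), (-1 : R) ^ (i : ℕ) • ∑ j : Fin (n + 1), (-1 : R) ^ (j : ℕ) •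
        fiberSum (fun x => prism α β j (x ∘ i.succAbove)) (L.chainLin (n + 1) c) := by
  rw [chains_d_apply, map_sum, map_sum]
  refine Finset.sum_congr rfl fun i _ => ?_
  rw [map_smul, map_smul, prismChain, LinearMap.sum_apply, map_sum]
  refine congrArg _ (Finset.sum_congr rfl fun j _ => ?_)
  rw [LinearMap.smul_apply, map_smul, ChainPushes.chainLin_map_map]
  · rfl
  · exact h.chainFinite_apply (i.succAbove 0) fun x => by simp [prism]

theorem sum_smul_sum_smul_comm {ι κ X A : Type*} [Fintype ι] [Fintype κ] [AddCommGroup A]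
    [Module R A] (T : Finset X) (a : ι → R) (b : κ → R) (F : ι → κ → X → A) :
    ∑ i, a i • ∑ j, b j • ∑ x ∈ T, F i j x = ∑ x ∈ T, ∑ i, a i • ∑ j, b j • F i j x := by
  rw [Finset.sum_comm]
  refine Finset.sum_congr rfl fun i _ => ?_
  rw [← Finset.smul_sum, Finset.sum_comm]
  refine congrArg _ (Finset.sum_congr rfl fun j _ => ?_)
  rw [← Finset.smul_sum]

/-- The prism operators form a chain homotopy from `D_*(α)` to `D_*(β)`. -/
theorem _root_.IsChainPush.nonempty_homotopy (hα : CloseOn L.supports α α)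
    (hβ : CloseOn L.supports β β) (hαβ : CloseOn L.supports α β) (h : Pushes L N α)
    {D D' : L.chains ⟶ N.chains} (hD : IsChainPush α D) (hD' : IsChainPush β D') :
    Nonempty (Homotopy D' D) := by
  have h' := h.of_close hαβ.symm
  rw [isChainPush_iff h] at hD
  rw [isChainPush_iff h'] at hD'
  have key : ∀ (n : ℕ) (c : (Fin n → G) →₀ L.toSubmodule),
      fiberSum (fun x : Fin (n + 1) → G => β ∘ x) (L.chainLin n c) =
        (∑ i : Fin (n + 1), (-1 : R) ^ (i : ℕ) • ∑ j : Fin n, (-1 : R) ^ (j : ℕ) •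
          fiberSum (fun x => prism α β j (x ∘ i.succAbove)) (L.chainLin n c)) +
        (∑ j : Fin (n + 1), (-1 : R) ^ (j : ℕ) • ∑ i : Fin (n + 2), (-1 : R) ^ (i : ℕ) •
          fiberSum (fun x => prism α β j x ∘ i.succAbove) (L.chainLin n c)) +
        fiberSum (fun x : Fin (n + 1) → G => α ∘ x) (L.chainLin n c) := fun n c => by
    funext y
    obtain ⟨T, F, hF⟩ := exists_finset_fiberSum h h' c y
    simp only [Pi.add_apply, Finset.sum_apply, Pi.smul_apply]
    rw [hF (fun x => β ∘ x) fun x => ⟨0, Or.inr rfl⟩,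
      hF (fun x => α ∘ x) fun x => ⟨0, Or.inl rfl⟩]
    have h1 : ∀ (i : Fin (n + 1)) (j : Fin n),
        fiberSum (fun x => prism α β j (x ∘ i.succAbove)) (L.chainLin n c) y =
          ∑ x ∈ T, F x (prism α β j (x ∘ i.succAbove)) := fun i j => hF _ fun x =>
      (prism_apply α β j 0 (x ∘ i.succAbove)).imp' i.succAbove fun _ => id
    have h2 : ∀ (j : Fin (n + 1)) (i : Fin (n + 2)),
        fiberSum (fun x => prism α β j x ∘ i.succAbove) (L.chainLin n c) y =
          ∑ x ∈ T, F x (prism α β j x ∘ i.succAbove) := fun j i => hF _ fun x =>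
      prism_apply α β j (i.succAbove 0) x
    simp only [h1, h2]
    rw [sum_smul_sum_smul_comm, sum_smul_sum_smul_comm, ← Finset.sum_add_distrib,
      ← Finset.sum_add_distrib]
    exact Finset.sum_congr rfl fun x _ =>
      eq_add_of_sub_eq (faceSum_prismSum R α β (F x) x).symm
  refine ⟨Homotopy.ofNatChain (fun n => ModuleCat.ofHom (prismChain hα hβ hαβ h n)) ?_
    fun n => ?_⟩
  · refine ModuleCat.hom_ext (LinearMap.ext fun c => N.chainLin_injective 0 ?_)
    refine (hD' 0 c).trans (Eq.trans ?_ (map_add (N.chainLin 0)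
      ((N.chains.d 1 0).hom (prismChain hα hβ hαβ h 0 c)) ((D.f 0).hom c)).symm)
    rw [chainLin_d_prismChain, hD, key]
    simp
  · refine ModuleCat.hom_ext (LinearMap.ext fun c => N.chainLin_injective (n + 1) ?_)
    refine (hD' (n + 1) c).trans (Eq.trans ?_ (map_add (N.chainLin (n + 1))
      (prismChain hα hβ hαβ h n ((L.chains.d (n + 1) n).hom c) +
        (N.chains.d (n + 2) (n + 1)).hom (prismChain hα hβ hαβ h (n + 1) c))
      ((D.f (n + 1)).hom c)).symm)
    rw [map_add, chainLin_d_prismChain, chainLin_prismChain_d, hD, key]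

end Prism
end ChainMap
end ResSubmodule

/-! ### The cochain maps `D^*(φ)` -/

namespace ResSubmodule

section Cochains

variable {R G H K W : Type*} [CommRing R] [Group G] [Group H] [Group K] [AddCommGroup W]
  [Module R W] (L : ResSubmodule R G W) {M : ResSubmodule R H W} {N : ResSubmodule R K W}

/-- A cochain as a function on homogeneous tuples. -/
def cochainLin (n : ℕ) : ((Fin n → G) → L.toSubmodule) →ₗ[R] (Fin (n + 1) → G) → W where
  toFun c x := (c ((homog n).symm x).2).1 ((homog n).symm x).1
  map_add' _ _ := rfl
  map_smul' _ _ := rfl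

theorem cochainLin_apply {n : ℕ} (c : (Fin n → G) → L.toSubmodule) (x : Fin (n + 1) → G) :
    L.cochainLin n c x = (c ((homog n).symm x).2).1 (x 0) := rfl

theorem cochainLin_homog {n : ℕ} (c : (Fin n → G) → L.toSubmodule) (x : G) (g : Fin n → G) :
    L.cochainLin n c (homog n (x, g)) = (c g).1 x := by
  change (c ((homog n).symm (homog n (x, g))).2).1 ((homog n).symm (homog n (x, g))).1 = _
  rw [Equiv.symm_apply_apply]

theorem cochainLin_injective (n : ℕ) : Function.Injective (L.cochainLin n) := by
  intro c c' h
  ext g x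
  rw [← cochainLin_homog, h, cochainLin_homog]

variable {L}

/-- Composition with `θ` maps cochains with coefficients in `M` to cochains with coefficients
in `L`. -/
def CochainPulls (M : ResSubmodule R H W) (L : ResSubmodule R G W) {n m : ℕ}
    (θ : (Fin (n + 1) → G) → (Fin (m + 1) → H)) : Prop :=
  ∀ (c : (Fin m → H) → M.toSubmodule) (g : Fin n → G),
    (fun x => M.cochainLin m c (θ (homog n (x, g)))) ∈ L.toSubmodule

/-- The pull-back of cochains along a map of tuples. -/
def CochainPulls.map {n m : ℕ} {θ : (Fin (n + 1) → G) → (Fin (m + 1) → H)}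
    (h : CochainPulls M L θ) :
    ((Fin m → H) → M.toSubmodule) →ₗ[R] ((Fin n → G) → L.toSubmodule) where
  toFun c g := ⟨_, h c g⟩
  map_add' _ _ := rfl
  map_smul' _ _ := rfl

theorem CochainPulls.cochainLin_map {n m : ℕ} {θ : (Fin (n + 1) → G) → (Fin (m + 1) → H)}
    (h : CochainPulls M L θ) (c : (Fin m → H) → M.toSubmodule) :
    L.cochainLin n (h.map c) = M.cochainLin m c ∘ θ := by
  funext x
  obtain ⟨⟨x, g⟩, rfl⟩ := (homog n).surjective x
  exact L.cochainLin_homog _ x g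

/-- On a set where the group components of `β` take finitely many values, the pull-back of a
cochain along `β` is a finite sum of restrictions of pull-backs of its values. -/
theorem indicator_cochainLin_comp {X : Type*} {m : ℕ} (c : (Fin m → H) → M.toSubmodule)
    (β : X → Fin (m + 1) → H) (A : Set X) (S : Finset (Fin m → H))
    (hS : ∀ x ∈ A, ((homog m).symm (β x)).2 ∈ S) :
    A.indicator (fun x => M.cochainLin m c (β x)) =
      ∑ h ∈ S, ((fun x => ((homog m).symm (β x)).2) ⁻¹' {h}).indicator
        (A.indicator fun x => (c h).1 (β x 0)) := by
  rw [eq_sum_indicator (fun x => ((homog m).symm (β x)).2) S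
    (A.indicator fun x => M.cochainLin m c (β x))
    fun x hx => hS x (Set.mem_of_indicator_ne_zero hx)]
  refine Finset.sum_congr rfl fun h _ => Set.indicator_congr fun x hx => ?_
  have hx : ((homog m).symm (β x)).2 = h := hx
  by_cases hA : x ∈ A
  · rw [Set.indicator_of_mem hA, Set.indicator_of_mem hA, cochainLin_apply, hx]
  · rw [Set.indicator_of_notMem hA, Set.indicator_of_notMem hA]

/-- Maps that are given in each entry by a function of one of the variables, with these functions
pairwise close on a family of sets that detects membership in `L`, pull cochains back to
cochains. -/
theorem CochainPulls.of_closeOn {𝒯 : Set (Set G)} (h𝒯 : L.DetectedOn 𝒯) {n m : ℕ}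
    (α : Fin (m + 1) → G → H) (s : Fin (m + 1) → Fin (n + 1))
    (hα : ∀ i j, CloseOn 𝒯 (α i) (α j)) (h0 : Pulls M L (α 0)) :
    CochainPulls M L (fun x : Fin (n + 1) → G => fun i => α i (x (s i))) := by
  intro c g
  refine h𝒯 _ fun A hA => ?_
  set β : G → Fin (m + 1) → H := fun x i => α i (homog n (x, g) (s i)) with hβ
  have hd : ((fun x => ((homog m).symm (β x)).2) '' A).Finite := by
    refine (Set.Finite.pi' fun i : Fin m => hα i.castSucc i.succ A hA
      (Fin.partialProd g (s i.castSucc))⁻¹ (Fin.partialProd g (s i.succ))⁻¹).subset ?_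
    rintro _ ⟨x, hx, rfl⟩ i
    exact ⟨x, hx, rfl⟩
  rw [indicator_cochainLin_comp c β A hd.toFinset fun x hx => hd.mem_toFinset.2 ⟨x, hx, rfl⟩]
  refine L.sum_mem fun h _ => L.res_mem' _ _ (L.res_mem' _ _ ?_)
  have := L.translate_mem' (Fin.partialProd g (s 0)) _ (h0 _ (c h).2)
  exact this

theorem CochainPulls.comp_left {𝒯 : Set (Set G)} (h𝒯 : L.DetectedOn 𝒯) {φ : G → H} (n : ℕ)
    (hc : CloseOn 𝒯 φ φ) (h : Pulls M L φ) :
    CochainPulls M L (fun x : Fin (n + 1) → G => φ ∘ x) :=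
  CochainPulls.of_closeOn h𝒯 (fun _ => φ) id (fun _ _ => hc) h

theorem CochainPulls.prism {𝒯 : Set (Set G)} (h𝒯 : L.DetectedOn 𝒯) {α β : G → H} {n : ℕ}
    (hα : CloseOn 𝒯 α α) (hβ : CloseOn 𝒯 β β) (hαβ : CloseOn 𝒯 α β) (h : Pulls M L α)
    (j : Fin (n + 1)) : CochainPulls M L (_root_.prism α β j) := by
  refine CochainPulls.of_closeOn h𝒯 (fun i => if i ≤ j.castSucc then α else β) j.predAbove
    (fun i k => ?_) ?_
  · split_ifs
    exacts [hα, hαβ, hαβ.symm, hβ]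
  · simpa using h

end Cochains

section CochainMap

variable {R G H K W : Type u} [CommRing R] [Group G] [Group H] [Group K] [AddCommGroup W]
  [Module R W] {L : ResSubmodule R G W} {M : ResSubmodule R H W} {N : ResSubmodule R K W}

theorem cochainFun_eq (L : ResSubmodule R G W) {n : ℕ} (c : (Fin n → G) → L.toSubmodule) :
    L.cochainFun c = L.cochainLin n c ∘ homog n := by
  funext p
  exact (L.cochainLin_homog c p.1 p.2).symm

/-- The differential of the cobar complex is the simplicial coboundary. -/
theorem cochainLin_d (L : ResSubmodule R G W) (n : ℕ) (c : (Fin n → G) → L.toSubmodule) :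
    L.cochainLin (n + 1) ((L.cochains.d n (n + 1)).hom c) = faceSum R (L.cochainLin n c) := by
  rw [groupCohomology.inhomogeneousCochains.d_def]
  funext x
  obtain ⟨⟨x, g⟩, rfl⟩ := (homog (n + 1)).surjective x
  refine (L.cochainLin_homog _ x g).trans ?_
  have hd : (inhomogeneousCochains.d L.rep n).hom c g = _ :=
    inhomogeneousCochains.d_hom_apply L.rep n c g
  have h0 : (L.rho (g 0) (c fun i => g i.succ)).1 x =
      (-1 : R) ^ ((0 : Fin (n + 2)) : ℕ) •
        L.cochainLin n c (homog (n + 1) (x, g) ∘ Fin.succAbove 0) := by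
    rw [← homog_tail, cochainLin_homog, Fin.val_zero, pow_zero, one_smul]
    rfl
  refine (congrArg (fun f : L.toSubmodule => f.1 x) hd).trans ?_
  refine Eq.trans ?_ (Fin.sum_univ_succ fun i : Fin (n + 2) => (-1 : R) ^ (i : ℕ) •
    L.cochainLin n c (homog (n + 1) (x, g) ∘ i.succAbove)).symm
  refine congrArg₂ (· + ·) h0 ?_
  rw [AddSubmonoidClass.coe_finsetSum, Finset.sum_apply]
  refine Finset.sum_congr rfl fun j _ => ?_
  rw [← homog_contractNth, cochainLin_homog, Fin.val_succ]
  rfl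

/-- The cochain map `D^*(φ)`. -/
def pullCochain {𝒯 : Set (Set G)} (h𝒯 : L.DetectedOn 𝒯) {φ : G → H} (hc : CloseOn 𝒯 φ φ)
    (h : Pulls M L φ) : M.cochains ⟶ L.cochains where
  f n := ModuleCat.ofHom (CochainPulls.comp_left h𝒯 n hc h).map
  comm' i j hij := by
    obtain rfl : i + 1 = j := hij
    refine ModuleCat.hom_ext (LinearMap.ext fun c => L.cochainLin_injective (i + 1) ?_)
    refine (cochainLin_d L i _).trans (Eq.trans ?_
      ((CochainPulls.comp_left h𝒯 (i + 1) hc h).cochainLin_map _).symm)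
    refine (congrArg (faceSum R)
      ((CochainPulls.comp_left h𝒯 i hc h).cochainLin_map c)).trans (funext fun x => ?_)
    exact (faceSum_comp R φ (M.cochainLin i c) x).trans (congrFun (cochainLin_d M i c).symm _)

theorem isCochainPull_iff {φ : G → H} (D : M.cochains ⟶ L.cochains) :
    IsCochainPull φ D ↔ ∀ (n : ℕ) (c : (Fin n → H) → M.toSubmodule),
      L.cochainLin n ((D.f n).hom c) = fun x => M.cochainLin n c (φ ∘ x) := by
  refine forall_congr' fun n => forall_congr' fun c => ?_
  have : M.cochainFun c ∘ tupleMap φ n = (fun x => M.cochainLin n c (φ ∘ x)) ∘ homog n := by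
    funext p
    rw [cochainFun_eq, Function.comp_apply, Function.comp_apply, homog_tupleMap]
    rfl
  rw [this, cochainFun_eq, (homog n).surjective.right_cancellable]

theorem isCochainPull_pullCochain {𝒯 : Set (Set G)} (h𝒯 : L.DetectedOn 𝒯) {φ : G → H}
    (hc : CloseOn 𝒯 φ φ) (h : Pulls M L φ) : IsCochainPull φ (pullCochain h𝒯 hc h) :=
  (isCochainPull_iff _).2 fun n c => (CochainPulls.comp_left h𝒯 n hc h).cochainLin_map c

theorem _root_.IsCochainPull.unique {φ : G → H} {D D' : M.cochains ⟶ L.cochains}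
    (hD : IsCochainPull φ D) (hD' : IsCochainPull φ D') : D = D' := by
  rw [isCochainPull_iff] at hD hD'
  ext n : 1
  exact ModuleCat.hom_ext (LinearMap.ext fun c => L.cochainLin_injective n
    ((hD n c).trans (hD' n c).symm))

theorem _root_.IsCochainPull.comp {φ : G → H} {ψ : H → K} {D : N.cochains ⟶ M.cochains}
    {D' : M.cochains ⟶ L.cochains} (hD : IsCochainPull ψ D) (hD' : IsCochainPull φ D') :
    IsCochainPull (ψ ∘ φ) (D ≫ D') := by
  rw [isCochainPull_iff] at hD hD' ⊢
  refine fun n c => (hD' n _).trans (funext fun x => ?_)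
  exact congrFun (hD n c) (φ ∘ x)

theorem isCochainPull_id (L : ResSubmodule R G W) : IsCochainPull id (𝟙 L.cochains) :=
  (isCochainPull_iff _).2 fun _ _ => rfl

section Prism

variable {𝒯 : Set (Set G)} (h𝒯 : L.DetectedOn 𝒯) {α β : G → H} (hα : CloseOn 𝒯 α α)
  (hβ : CloseOn 𝒯 β β) (hαβ : CloseOn 𝒯 α β) (h : Pulls M L α)

/-- The prism operator on cochains. -/
def prismCochain (n : ℕ) :
    ((Fin (n + 1) → H) → M.toSubmodule) →ₗ[R] ((Fin n → G) → L.toSubmodule) :=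
  ∑ j : Fin (n + 1), (-1 : R) ^ (j : ℕ) • (CochainPulls.prism h𝒯 hα hβ hαβ h j).map

theorem cochainLin_prismCochain (n : ℕ) (c : (Fin (n + 1) → H) → M.toSubmodule) :
    L.cochainLin n (prismCochain h𝒯 hα hβ hαβ h n c) =
      prismSum R α β (M.cochainLin (n + 1) c) := by
  rw [prismCochain, LinearMap.sum_apply, map_sum]
  funext x
  rw [Finset.sum_apply, prismSum]
  refine Finset.sum_congr rfl fun j _ => ?_
  rw [LinearMap.smul_apply, map_smul, CochainPulls.cochainLin_map]
  rfl

/-- The prism operators form a homotopy between `D^*(α)` and `D^*(β)`. -/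
theorem _root_.IsCochainPull.nonempty_homotopy (h𝒯 : L.DetectedOn 𝒯) (hα : CloseOn 𝒯 α α)
    (hβ : CloseOn 𝒯 β β) (hαβ : CloseOn 𝒯 α β) (h : Pulls M L α)
    {D D' : M.cochains ⟶ L.cochains} (hD : IsCochainPull α D) (hD' : IsCochainPull β D') :
    Nonempty (Homotopy D' D) := by
  rw [isCochainPull_iff] at hD hD'
  refine ⟨Homotopy.ofNatCochain (fun n => ModuleCat.ofHom (prismCochain h𝒯 hα hβ hαβ h n)) ?_
    fun n => ?_⟩
  · refine ModuleCat.hom_ext (LinearMap.ext fun c => L.cochainLin_injective 0 ?_)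
    refine (hD' 0 c).trans (Eq.trans ?_ (map_add (L.cochainLin 0)
      (prismCochain h𝒯 hα hβ hαβ h 0 ((M.cochains.d 0 1).hom c)) ((D.f 0).hom c)).symm)
    rw [cochainLin_prismCochain, cochainLin_d, hD]
    funext x
    have := faceSum_prismSum R α β (M.cochainLin 0 c) x
    rw [Pi.add_apply, ← sub_eq_iff_eq_add, ← this]
    simp [faceSum, prismSum]
  · refine ModuleCat.hom_ext (LinearMap.ext fun c => L.cochainLin_injective (n + 1) ?_)
    refine (hD' (n + 1) c).trans (Eq.trans ?_ (map_add (L.cochainLin (n + 1))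
      (prismCochain h𝒯 hα hβ hαβ h (n + 1) ((M.cochains.d (n + 1) (n + 2)).hom c) +
        (L.cochains.d n (n + 1)).hom (prismCochain h𝒯 hα hβ hαβ h n c))
      ((D.f (n + 1)).hom c)).symm)
    rw [map_add, cochainLin_d, cochainLin_prismCochain, cochainLin_prismCochain, cochainLin_d, hD]
    funext x
    have := faceSum_prismSum R α β (M.cochainLin (n + 1) c) x
    rw [Pi.add_apply, ← sub_eq_iff_eq_add, ← this, add_comm]
    rfl

end Prism
end CochainMap
end ResSubmodule

/-! ### Maps on homology and on reduced homology -/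

namespace ResSubmodule

variable {R G H K W : Type u} [CommRing R] [Group G] [Group H] [Group K] [AddCommGroup W]
  [Module R W]

theorem exists_isChainPush (L : ResSubmodule R G W) {φ : G → H} (hφ : IsCoarseMap φ) :
    ∃ D : L.chains ⟶ (L.push φ).chains, IsChainPush φ D :=
  ⟨_, isChainPush_pushChain (hφ.closeOn _) (L.pushes_push hφ)⟩

theorem exists_isCochainPull (M : ResSubmodule R H W) {φ : G → H} (hφ : IsCoarseMap φ) :
    ∃ D : M.cochains ⟶ (M.pull φ).cochains, IsCochainPull φ D :=
  ⟨_, isCochainPull_pullCochain (M.pull φ).detectedOn_univ (hφ.closeOn _) (M.pulls_pull φ)⟩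

/-- For a coarse embedding `φ`, the chain maps `D_*(φ)` and `D_*(ω)` are homotopy inverse to each
other: `ω ∘ φ` is close to the identity, and `φ ∘ ω` is close to the identity near `φ(G)`, where
the functions in `φ_* L` are supported. -/
theorem exists_isChainPush_inverse (L : ResSubmodule R G W) {φ : G → H} {ω : H → G}
    (hφ : IsCoarseEmbedding φ) (hω : IsCoarseInverse φ ω) :
    ∃ (D : L.chains ⟶ (L.push φ).chains) (D' : (L.push φ).chains ⟶ L.chains),
      IsChainPush φ D ∧ IsChainPush ω D' ∧ Nonempty (Homotopy (D ≫ D') (𝟙 _)) ∧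
        Nonempty (Homotopy (D' ≫ D) (𝟙 _)) := by
  have hpφ := L.pushes_push hφ.isCoarseMap
  have hpω := L.pushes_coarseInverse hφ hω
  have hcφ := hφ.isCoarseMap.closeOn L.supports
  have hcω := L.closeOn_supports_push (hω.closeOn hφ)
  have h1 := hω.closeOn_comp_id_right hφ L.supports
  have h2 := L.closeOn_supports_push hω.closeOn_comp_id
  have hD := isChainPush_pushChain hcφ hpφ
  have hD' := isChainPush_pushChain hcω hpω
  exact ⟨_, _, hD, hD',
    IsChainPush.nonempty_homotopy (closeOn_id _) (h1.trans h1.symm) h1.symm L.pushes_id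
      (isChainPush_id L) (hD.comp hpφ hpω (L.pushes_id.of_close h1) hD'),
    IsChainPush.nonempty_homotopy (closeOn_id _) (h2.trans h2.symm) h2.symm (pushes_id _)
      (isChainPush_id _) (hD'.comp hpω hpφ ((pushes_id _).of_close h2) hD)⟩

/-- For a coarse embedding `φ`, the cochain maps `D^*(φ)` and `D^*(ω)` are homotopy inverse to
each other: `ω ∘ φ` is close to the identity, and `φ ∘ ω` is close to the identity near `φ(G)`,
where membership in `φ^{*-1} L` is detected. -/
theorem exists_isCochainPull_inverse (L : ResSubmodule R G W) {φ : G → H} {ω : H → G}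
    (hφ : IsCoarseEmbedding φ) (hω : IsCoarseInverse φ ω) :
    ∃ (D : (L.invPull φ).cochains ⟶ L.cochains) (D' : L.cochains ⟶ (L.invPull φ).cochains),
      IsCochainPull φ D ∧ IsCochainPull ω D' ∧ Nonempty (Homotopy (D ≫ D') (𝟙 _)) ∧
        Nonempty (Homotopy (D' ≫ D) (𝟙 _)) := by
  have h1 := hω.closeOn_comp_id_right hφ {Set.univ}
  have h2 := hω.closeOn_comp_id
  have hD := isCochainPull_pullCochain L.detectedOn_univ (hφ.isCoarseMap.closeOn _)
    (L.pulls_invPull φ)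
  have hD' := isCochainPull_pullCochain (L.detectedOn_invPull φ) (hω.closeOn hφ)
    (L.pulls_coarseInverse hφ hω)
  exact ⟨_, _, hD, hD',
    IsCochainPull.nonempty_homotopy (L.detectedOn_invPull φ) (closeOn_id _)
      (h2.trans h2.symm) h2.symm (pulls_id _) (isCochainPull_id _) (hD.comp hD'),
    IsCochainPull.nonempty_homotopy L.detectedOn_univ (closeOn_id _)
      (h1.trans h1.symm) h1.symm (pulls_id _) (isCochainPull_id _) (hD'.comp hD)⟩

theorem exists_isChainPush_of_close (L : ResSubmodule R G W) {φ ϕ : G → H} (hφ : IsCoarseMap φ)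
    (hϕ : IsCoarseMap ϕ) (h : IsClose φ ϕ) :
    ∃ D D' : L.chains ⟶ (L.push φ).chains, IsChainPush φ D ∧ IsChainPush ϕ D' ∧
      Nonempty (Homotopy D' D) := by
  have hp := L.pushes_push hφ
  have hc := h.closeOn hφ L.supports
  have hD := isChainPush_pushChain (hφ.closeOn _) hp
  have hD' := isChainPush_pushChain (hϕ.closeOn _) (hp.of_close hc.symm)
  exact ⟨_, _, hD, hD', hD.nonempty_homotopy (hφ.closeOn _) (hϕ.closeOn _) hc hp hD'⟩

theorem exists_isCochainPull_of_close (M : ResSubmodule R H W) {φ ϕ : G → H}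
    (hφ : IsCoarseMap φ) (hϕ : IsCoarseMap ϕ) (h : IsClose φ ϕ) :
    ∃ D D' : M.cochains ⟶ (M.pull φ).cochains, IsCochainPull φ D ∧ IsCochainPull ϕ D' ∧
      Nonempty (Homotopy D' D) := by
  have hp := M.pulls_pull φ
  have hc := h.closeOn hφ {Set.univ}
  have hu := (M.pull φ).detectedOn_univ
  have hD := isCochainPull_pullCochain hu (hφ.closeOn _) hp
  have hD' := isCochainPull_pullCochain hu (hϕ.closeOn _) (hp.of_close hc.symm)
  exact ⟨_, _, hD, hD', hD.nonempty_homotopy hu (hφ.closeOn _) (hϕ.closeOn _) hc hp hD'⟩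

theorem _root_.IsChainPush.comp_push {L : ResSubmodule R G W} {φ : G → H} {ψ : H → K}
    (hφ : IsCoarseMap φ) (hψ : IsCoarseMap ψ) {D : L.chains ⟶ (L.push φ).chains}
    {D' : (L.push φ).chains ⟶ ((L.push φ).push ψ).chains} (hD : IsChainPush φ D)
    (hD' : IsChainPush ψ D') : IsChainPush (ψ ∘ φ) (D ≫ D') :=
  hD.comp (L.pushes_push hφ) (pushes_push _ hψ)
    ((pushes_push _ hψ).comp (L.pushes_push hφ) fun _ _ => (hψ.comp hφ).finiteFibers _) hD'

end ResSubmodule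

section HomotopyEquiv

variable {R : Type u} {ι : Type*} [CommRing R] {c : ComplexShape ι}
  {C C' C'' : HomologicalComplex (ModuleCat.{u} R) c}

/-- The isomorphism on homology induced by a pair of homotopy inverse maps of complexes. -/
noncomputable def homologyIsoOfHomotopy (D : C ⟶ C') (D' : C' ⟶ C)
    (h : Nonempty (Homotopy (D ≫ D') (𝟙 C))) (h' : Nonempty (Homotopy (D' ≫ D) (𝟙 C'))) (i : ι) :
    C.homology i ≅ C'.homology i where
  hom := HomologicalComplex.homologyMap D i
  inv := HomologicalComplex.homologyMap D' i
  hom_inv_id := by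
    rw [← HomologicalComplex.homologyMap_comp, h.some.homologyMap_eq,
      HomologicalComplex.homologyMap_id]
  inv_hom_id := by
    rw [← HomologicalComplex.homologyMap_comp, h'.some.homologyMap_eq,
      HomologicalComplex.homologyMap_id]

theorem map_mem_cycleSubmodule (D : C ⟶ C') (i : ι) {z : C.X i} (hz : z ∈ cycleSubmodule C i) :
    (D.f i).hom z ∈ cycleSubmodule C' i := by
  have h := congrArg (fun f => f.hom z) (D.comm i (c.next i))
  have hz : (C.d i (c.next i)).hom z = 0 := hz
  refine h.trans ?_
  exact (congrArg _ hz).trans (map_zero (D.f (c.next i)).hom)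

theorem map_mem_boundarySubmodule (D : C ⟶ C') (i : ι) {z : C.X i}
    (hz : z ∈ boundarySubmodule C i) : (D.f i).hom z ∈ boundarySubmodule C' i := by
  obtain ⟨y, rfl⟩ := hz
  exact ⟨(D.f (c.prev i)).hom y, congrArg (fun f => f.hom y) (D.comm (c.prev i) i)⟩

/-- Homotopic maps of complexes differ by boundaries on cycles. -/
theorem Homotopy.sub_mem_boundarySubmodule {D D' : C ⟶ C'} (s : Homotopy D D') (i : ι) {z : C.X i}
    (hz : z ∈ cycleSubmodule C i) :
    (D.f i).hom z - (D'.f i).hom z ∈ boundarySubmodule C' i := by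
  have h : (D.f i).hom z = _ := congrArg (fun f => f.hom z) (s.comm i)
  have hz : (C.d i (c.next i)).hom z = 0 := hz
  refine ⟨(s.hom i (c.prev i)).hom z, ?_⟩
  have h1 : (s.hom (c.next i) i).hom ((C.d i (c.next i)).hom z) = 0 := by rw [hz, map_zero]
  have h2 : (D.f i).hom z = (s.hom (c.next i) i).hom ((C.d i (c.next i)).hom z) +
    (C'.d (c.prev i) i).hom ((s.hom i (c.prev i)).hom z) + (D'.f i).hom z := h
  rw [h2, h1, zero_add, add_sub_cancel_right]

variable [∀ i, TopologicalSpace (C.X i)] [∀ i, IsTopologicalAddGroup (C.X i)]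
  [∀ i, ContinuousConstSMul R (C.X i)]
  [∀ i, TopologicalSpace (C'.X i)] [∀ i, IsTopologicalAddGroup (C'.X i)]
  [∀ i, ContinuousConstSMul R (C'.X i)]
  [∀ i, TopologicalSpace (C''.X i)] [∀ i, IsTopologicalAddGroup (C''.X i)]
  [∀ i, ContinuousConstSMul R (C''.X i)]

/-- A map of complexes that is continuous in degree `i` induces a continuous map on reduced
homology. -/
theorem exists_isReducedMap (D : C ⟶ C') (i : ι) (hD : Continuous (D.f i).hom) :
    ∃ T : ReducedHomology C i →L[R] ReducedHomology C' i, IsReducedMap D i T := by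
  let f : cycleSubmodule C i →ₗ[R] cycleSubmodule C' i :=
    (D.f i).hom.restrict fun z hz => map_mem_cycleSubmodule D i hz
  have hf : Continuous f := (hD.comp continuous_subtype_val).subtype_mk _
  have hle : (boundarySubmodule C i).topologicalClosure.submoduleOf (cycleSubmodule C i) ≤
      ((boundarySubmodule C' i).topologicalClosure.submoduleOf (cycleSubmodule C' i)).comap f := by
    intro z hz
    have hz : z.1 ∈ closure (boundarySubmodule C i : Set (C.X i)) := hz
    have : (D.f i).hom z.1 ∈ closure (boundarySubmodule C' i : Set (C'.X i)) :=
      map_mem_closure hD hz fun y hy => map_mem_boundarySubmodule D i hy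
    exact this
  refine ⟨⟨Submodule.mapQ _ _ f hle, ?_⟩, fun z => ⟨map_mem_cycleSubmodule D i z.2, rfl⟩⟩
  exact Continuous.quotient_lift (continuous_quotient_mk'.comp hf) _

theorem IsReducedMap.comp {D : C ⟶ C'} {D' : C' ⟶ C''} {i : ι}
    {T : ReducedHomology C i →L[R] ReducedHomology C' i}
    {S : ReducedHomology C' i →L[R] ReducedHomology C'' i} (hT : IsReducedMap D i T)
    (hS : IsReducedMap D' i S) : IsReducedMap (D ≫ D') i (S.comp T) := fun z => by
  obtain ⟨h, hz⟩ := hT z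
  obtain ⟨h', hz'⟩ := hS ⟨_, h⟩
  exact ⟨h', (congrArg S hz).trans hz'⟩

theorem IsReducedMap.of_homotopy {D D' : C ⟶ C'} {i : ι}
    {T : ReducedHomology C i →L[R] ReducedHomology C' i} (hT : IsReducedMap D i T)
    (s : Homotopy D' D) : IsReducedMap D' i T := fun z => by
  obtain ⟨h, hz⟩ := hT z
  refine ⟨map_mem_cycleSubmodule D' i z.2, hz.trans ?_⟩
  rw [eq_comm, Submodule.Quotient.eq]
  exact Submodule.le_topologicalClosure _ (s.sub_mem_boundarySubmodule i z.2)

theorem isReducedMap_id (C : HomologicalComplex (ModuleCat.{u} R) c)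
    [∀ i, TopologicalSpace (C.X i)] [∀ i, IsTopologicalAddGroup (C.X i)]
    [∀ i, ContinuousConstSMul R (C.X i)] (i : ι) :
    IsReducedMap (𝟙 C) i (ContinuousLinearMap.id R (ReducedHomology C i)) :=
  fun z => ⟨z.2, rfl⟩

theorem IsReducedMap.unique {D : C ⟶ C'} {i : ι}
    {T T' : ReducedHomology C i →L[R] ReducedHomology C' i} (hT : IsReducedMap D i T)
    (hT' : IsReducedMap D i T') : T = T' := by
  ext x
  obtain ⟨z, rfl⟩ := Submodule.Quotient.mk_surjective _ x
  obtain ⟨h, hz⟩ := hT z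
  obtain ⟨h', hz'⟩ := hT' z
  exact hz.trans hz'.symm

/-- Homotopy inverse maps of complexes, both continuous in degree `i`, induce topological
isomorphisms on reduced homology. -/
theorem exists_reducedEquiv (D : C ⟶ C') (D' : C' ⟶ C)
    (h : Nonempty (Homotopy (D ≫ D') (𝟙 C))) (h' : Nonempty (Homotopy (D' ≫ D) (𝟙 C'))) (i : ι)
    (hD : Continuous (D.f i).hom) (hD' : Continuous (D'.f i).hom) :
    ∃ e : ReducedHomology C i ≃L[R] ReducedHomology C' i,
      IsReducedMap D i (e : ReducedHomology C i →L[R] ReducedHomology C' i) := by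
  obtain ⟨T, hT⟩ := exists_isReducedMap D i hD
  obtain ⟨S, hS⟩ := exists_isReducedMap D' i hD'
  have h1 : S.comp T = ContinuousLinearMap.id R _ :=
    (hT.comp hS).unique ((isReducedMap_id C i).of_homotopy h.some)
  have h2 : T.comp S = ContinuousLinearMap.id R _ :=
    (hS.comp hT).unique ((isReducedMap_id C' i).of_homotopy h'.some)
  exact ⟨ContinuousLinearEquiv.equivOfInverse T S (fun x => congrArg (fun u => u x) h1)
    fun x => congrArg (fun u => u x) h2, hT⟩

end HomotopyEquiv

/-! ### Continuity of push-forward and pull-back -/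

section Maps

namespace ResSubmodule

variable {R G H K W : Type*} [CommRing R] [Group G] [Group H] [Group K] [AddCommGroup W]
  [Module R W] {L : ResSubmodule R G W} {M N : ResSubmodule R H W}

/-- The map `f ↦ α_* f` from `L` to `N`. -/
noncomputable def Pushes.map {α : G → H} (h : Pushes L N α) :
    L.toSubmodule →ₗ[R] N.toSubmodule where
  toFun f := ⟨fiberSum α f.1, h.mem f.1 f.2⟩
  map_add' f f' := Subtype.ext
    (fiberSum_add (h.finiteFibers f.1 f.2) (h.finiteFibers f'.1 f'.2))
  map_smul' r f := Subtype.ext (fiberSum_smul r (h.finiteFibers f.1 f.2))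

/-- The map `f ↦ f ∘ α` from `M` to `L`. -/
def Pulls.map {α : G → H} (h : Pulls M L α) : M.toSubmodule →ₗ[R] L.toSubmodule where
  toFun f := ⟨f.1 ∘ α, h f.1 f.2⟩
  map_add' _ _ := rfl
  map_smul' _ _ := rfl

/-- Restriction to `A` on `L` as a linear map. -/
noncomputable def resLin (L : ResSubmodule R G W) (A : Set G) :
    L.toSubmodule →ₗ[R] L.toSubmodule where
  toFun := L.resMap A
  map_add' f f' := Subtype.ext (Set.indicator_add' A f.1 f'.1)
  map_smul' r f := Subtype.ext (Set.indicator_const_smul A r f.1)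

end ResSubmodule
end Maps

namespace TopResSubmodule

open ResSubmodule

variable {R G H K W : Type*} [CommRing R] [Group G] [Group H] [Group K] [AddCommGroup W]
  [Module R W] [TopologicalSpace R]

/-- Topological res-invariant modules agree if their inclusions into each other are defined and
continuous. -/
theorem ext_of_continuous {L L' : TopResSubmodule R G W}
    (p : L.toRes.toSubmodule → L'.toRes.toSubmodule) (hp : ∀ f, (p f).1 = f.1)
    (hpc : Continuous p) (q : L'.toRes.toSubmodule → L.toRes.toSubmodule)
    (hq : ∀ f, (q f).1 = f.1) (hqc : Continuous q) : L = L' := by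
  have h : L.toRes = L'.toRes := ResSubmodule.ext_mem fun f =>
    ⟨fun hf => Eq.mp (congrArg (· ∈ L'.toRes.toSubmodule) (hp ⟨f, hf⟩)) (p ⟨f, hf⟩).2,
      fun hf => Eq.mp (congrArg (· ∈ L.toRes.toSubmodule) (hq ⟨f, hf⟩)) (q ⟨f, hf⟩).2⟩
  obtain ⟨L, t, ht⟩ := L
  obtain ⟨L', t', ht'⟩ := L'
  obtain rfl : L = L' := h
  have hp' : p = id := funext fun f => Subtype.ext (hp f)
  have hq' : q = id := funext fun f => Subtype.ext (hq f)
  subst hp' hq'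
  obtain rfl : t = t' := le_antisymm (continuous_id_iff_le.1 hpc) (continuous_id_iff_le.1 hqc)
  rfl

/-- The initial topology for a family of linear maps to a topological res-invariant module is
res-invariant if the family is stable, up to continuous maps, under precomposition with
restrictions and translations. -/
theorem isTopRes_iInf_induced {ι : Type*} (P : ResSubmodule R H W) (N : TopResSubmodule R K W)
    (Λ : ι → P.toSubmodule →ₗ[R] N.toRes.toSubmodule)
    (hres : ∀ A i, ∃ j, ∃ u : N.toRes.toSubmodule → N.toRes.toSubmodule, Continuous u ∧
      ∀ f, Λ i (P.resMap A f) = u (Λ j f))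
    (htr : ∀ g i, ∃ j, ∀ f, Λ i (P.translateMap g f) = Λ j f) :
    @IsTopRes R H W _ _ _ _ _ P (⨅ i, TopologicalSpace.induced (Λ i) N.top) :=
  letI := ⨅ i, TopologicalSpace.induced (Λ i) N.top
  { topologicalAddGroup := topologicalAddGroup_iInf fun i => topologicalAddGroup_induced (Λ i)
    continuousSMul := continuousSMul_iInf fun i => continuousSMul_induced (Λ i)
    continuous_res := fun A => by
      refine continuous_iInf_rng.2 fun i => continuous_induced_rng.2 ?_
      obtain ⟨j, u, hu, h⟩ := hres A i
      have : Λ i ∘ P.resMap A = u ∘ Λ j := funext h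
      rw [this]
      exact hu.comp (continuous_iInf_dom continuous_induced_dom)
    continuous_translate := fun g => by
      refine continuous_iInf_rng.2 fun i => continuous_induced_rng.2 ?_
      obtain ⟨j, h⟩ := htr g i
      have : Λ i ∘ P.translateMap g = Λ j := funext h
      rw [this]
      exact continuous_iInf_dom continuous_induced_dom }

section Push

variable {L : TopResSubmodule R G W} {N : TopResSubmodule R H W} {P : TopResSubmodule R K W}

theorem continuous_push_map (L : TopResSubmodule R G W) {φ : G → H} (hφ : IsCoarseMap φ) :
    Continuous (X := L.toRes.toSubmodule) (Y := (L.push φ).toRes.toSubmodule)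
      (L.toRes.pushes_push hφ).map :=
  continuous_sInf_rng.2 fun _ ht => ht.2

theorem continuous_pushes_id : Continuous L.toRes.pushes_id.map := by
  have : (L.toRes.pushes_id.map : L.toRes.toSubmodule → L.toRes.toSubmodule) = id :=
    funext fun f => Subtype.ext (fiberSum_id f.1)
  rw [this]
  exact continuous_id

/-- If `u` and `v` differ by finitely many left translations, then `u_*` is continuous if `v_*`
is. -/
theorem continuous_pushes_of_close {u v : G → H} (hu : Pushes L.toRes N.toRes u)
    (hv : Pushes L.toRes N.toRes v) (h : (Set.range fun x => u x * (v x)⁻¹).Finite)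
    (hc : Continuous hv.map) : Continuous hu.map := by
  have key : (hu.map : L.toRes.toSubmodule → N.toRes.toSubmodule) = fun f =>
      ∑ k ∈ h.toFinset, N.toRes.translateMap k
        (hv.map (L.toRes.resMap ((fun x => u x * (v x)⁻¹) ⁻¹' {k}) f)) := by
    funext f
    apply Subtype.ext
    rw [AddSubmonoidClass.coe_finsetSum]
    exact fiberSum_eq_sum_leftTranslate h.toFinset (fun x _ => h.mem_toFinset.2 ⟨x, rfl⟩)
      (hu.finiteFibers f.1 f.2)
  rw [key]
  exact continuous_finsetSum _ fun k _ => (N.isTopRes.continuous_translate k).comp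
    (hc.comp (L.isTopRes.continuous_res _))

/-- Continuity of `ψ_*` on `φ_* L` follows from continuity of `(ψ ∘ φ)_*` on `L`: the initial
topology on `φ_* L` for the maps `f ↦ ψ_*(1_B · (h.f))` is a competitor for the topology of
`φ_* L`. -/
theorem continuous_pushes_push {φ : G → H} {ψ : H → K}
    (hψ : CloseOn (imageTranslates φ) ψ ψ) (hψφ : Pushes L.toRes P.toRes (ψ ∘ φ))
    (hc : Continuous hψφ.map) (h : Pushes (L.push φ).toRes P.toRes ψ) : Continuous h.map := by
  classical
  let Λ : H × Set H → (L.push φ).toRes.toSubmodule →ₗ[R] P.toRes.toSubmodule := fun i =>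
    h.map ∘ₗ (L.push φ).toRes.resLin i.2 ∘ₗ (L.push φ).toRes.translateMap i.1
  have hΛ : ∀ i f, (Λ i f).1 = fiberSum ψ (i.2.indicator (leftTranslate i.1 f.1)) :=
    fun _ _ => rfl
  have htop := isTopRes_iInf_induced (L.push φ).toRes P Λ
    (fun A i => ⟨(i.1, i.2 ∩ {x | i.1⁻¹ * x ∈ A}), id, continuous_id, fun f => by
      apply Subtype.ext
      rw [id, hΛ, hΛ, ← Set.indicator_indicator]
      congr 2⟩)
    (fun g i => ⟨(i.1 * g, i.2), fun f => by
      apply Subtype.ext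
      rw [hΛ, hΛ]
      have : leftTranslate i.1 ((L.push φ).toRes.translateMap g f).1 =
          leftTranslate (i.1 * g) f.1 := by
        funext x
        simp [leftTranslate, translateMap_apply, mul_assoc]
      rw [this]⟩)
  have hle : (L.push φ).top ≤ ⨅ i, TopologicalSpace.induced (Λ i) P.top := by
    refine sInf_le ⟨htop, continuous_iInf_rng.2 fun i => continuous_induced_rng.2 ?_⟩
    have hcl : (Set.range fun x => (ψ ∘ fun x => i.1 * φ x) x * ((ψ ∘ φ) x)⁻¹).Finite := by
      simpa using closeOn_imageTranslates_iff.1 hψ i.1 1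
    have hi : Pushes L.toRes P.toRes (ψ ∘ fun x => i.1 * φ x) :=
      hψφ.of_finite_range hcl
    have : Λ i ∘ L.toRes.pushMap φ =
        hi.map ∘ L.toRes.resMap ((fun x => i.1 * φ x) ⁻¹' i.2) := by
      funext f
      apply Subtype.ext
      refine (hΛ i (L.toRes.pushMap φ f)).trans ?_
      change fiberSum ψ (i.2.indicator (leftTranslate i.1 (fiberSum φ f.1))) =
        fiberSum _ (Set.indicator _ f.1)
      rw [leftTranslate_fiberSum, indicator_fiberSum, fiberSum_comp
        ((hi.finiteFibers f.1 f.2).mono (support_indicator_subset_support _ _))]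
    exact (congrArg Continuous this).mpr
      ((continuous_pushes_of_close hi hψφ hcl hc).comp (L.isTopRes.continuous_res _))
  have h1 : (h.map : (L.push φ).toRes.toSubmodule → P.toRes.toSubmodule) =
      Λ (1, Set.univ) := by
    funext f
    apply Subtype.ext
    rw [hΛ, Set.indicator_univ, leftTranslate_one]
    rfl
  rw [h1, continuous_iff_le_induced]
  exact hle.trans (iInf_le _ _)

theorem push_eq_of_close (L : TopResSubmodule R G W) {φ ϕ : G → H} (hφ : IsCoarseMap φ)
    (hϕ : IsCoarseMap ϕ) (h : IsClose φ ϕ) : L.push φ = L.push ϕ := by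
  have key : ∀ {φ ϕ : G → H}, IsCoarseMap φ → IsCoarseMap ϕ → CloseOn {Set.univ} φ ϕ →
      ∃ p : (L.push φ).toRes.toSubmodule → (L.push ϕ).toRes.toSubmodule,
        (∀ f, (p f).1 = f.1) ∧ Continuous p := by
    intro φ ϕ hφ hϕ h
    have hc := h.of_univ L.toRes.supports
    have h1 : Pushes L.toRes (L.push ϕ).toRes (id ∘ φ) := (L.toRes.pushes_push hϕ).of_close hc
    have h2 : Continuous h1.map := continuous_pushes_of_close _ (L.toRes.pushes_push hϕ)
      (by simpa using closeOn_univ_iff.1 h 1 1) (L.continuous_push_map hϕ)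
    have h3 := pushes_of_comp (closeOn_id _) h1
    exact ⟨_, fun f => fiberSum_id f.1, continuous_pushes_push (closeOn_id _) h1 h2 h3⟩
  have hc := h.closeOn hφ {Set.univ}
  obtain ⟨p, hp, hpc⟩ := key hφ hϕ hc
  obtain ⟨q, hq, hqc⟩ := key hϕ hφ hc.symm
  exact ext_of_continuous p hp hpc q hq hqc

theorem push_push (L : TopResSubmodule R G W) {φ : G → H} {ψ : H → K} (hφ : IsCoarseMap φ)
    (hψ : IsCoarseMap ψ) : (L.push φ).push ψ = L.push (ψ ∘ φ) := by
  have hψφ := hψ.comp hφ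
  have hψ' := hψ.closeOn (imageTranslates φ)
  have a1 : Pushes (L.push φ).toRes (L.push (ψ ∘ φ)).toRes (id ∘ ψ) :=
    pushes_of_comp hψ' (L.toRes.pushes_push hψφ)
  have a2 := continuous_pushes_push hψ' _ (L.continuous_push_map hψφ) a1
  have a3 := pushes_of_comp (closeOn_id _) a1
  have b1 : Pushes L.toRes ((L.push φ).push ψ).toRes (id ∘ (ψ ∘ φ)) :=
    ((L.push φ).toRes.pushes_push hψ).comp (L.toRes.pushes_push hφ)
      fun f _ => hψφ.finiteFibers _
  have b2 : Continuous b1.map := by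
    have : (b1.map : L.toRes.toSubmodule → ((L.push φ).push ψ).toRes.toSubmodule) =
        ((L.push φ).toRes.pushes_push hψ).map ∘ (L.toRes.pushes_push hφ).map := by
      funext f
      exact Subtype.ext (fiberSum_comp (hψφ.finiteFibers _)).symm
    rw [this]
    exact ((L.push φ).continuous_push_map hψ).comp (L.continuous_push_map hφ)
  have b3 := pushes_of_comp (closeOn_id _) b1
  exact ext_of_continuous _ (fun f => fiberSum_id f.1)
    (continuous_pushes_push (closeOn_id _) a1 a2 a3) _ (fun f => fiberSum_id f.1)
    (continuous_pushes_push (closeOn_id _) b1 b2 b3)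

theorem continuous_pushes_coarseInverse (L : TopResSubmodule R G W) {φ : G → H} {ω : H → G}
    (hφ : IsCoarseEmbedding φ) (hω : IsCoarseInverse φ ω)
    (h : Pushes (L.push φ).toRes L.toRes ω) : Continuous h.map := by
  have hc := hω.closeOn_comp_id_right hφ {Set.univ}
  exact continuous_pushes_push (hω.closeOn hφ)
    (L.toRes.pushes_id.of_close (hc.of_univ _))
    (continuous_pushes_of_close _ L.toRes.pushes_id (by simpa using closeOn_univ_iff.1 hc 1 1)
      continuous_pushes_id) h

end Push

section Pull

variable {L : TopResSubmodule R G W} {M : TopResSubmodule R H W} {N : TopResSubmodule R K W}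

theorem continuous_pull_map (M : TopResSubmodule R H W) (φ : G → H) :
    Continuous (X := M.toRes.toSubmodule) (Y := (M.pull φ).toRes.toSubmodule)
      (M.toRes.pulls_pull φ).map :=
  continuous_sInf_rng.2 fun _ ht => ht.2

/-- If `u` and `v` differ by finitely many left translations, then `u^*` is continuous if `v^*`
is. -/
theorem continuous_pulls_of_close {u v : G → H} (hu : Pulls M.toRes L.toRes u)
    (hv : Pulls M.toRes L.toRes v) (h : (Set.range fun x => u x * (v x)⁻¹).Finite)
    (hc : Continuous hv.map) : Continuous hu.map := by
  have key : (hu.map : M.toRes.toSubmodule → L.toRes.toSubmodule) = fun f =>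
      ∑ k ∈ h.toFinset, L.toRes.resMap ((fun x => u x * (v x)⁻¹) ⁻¹' {k})
        (hv.map (M.toRes.translateMap k⁻¹ f)) := by
    funext f
    apply Subtype.ext
    rw [AddSubmonoidClass.coe_finsetSum]
    exact comp_eq_sum_leftTranslate f.1 h.toFinset fun x => h.mem_toFinset.2 ⟨x, rfl⟩
  rw [key]
  exact continuous_finsetSum _ fun k _ => (L.isTopRes.continuous_res _).comp
    (hc.comp (M.isTopRes.continuous_translate _))

/-- Continuity of `φ^*` on `ψ^* N` follows from continuity of `(ψ ∘ φ)^*` on `N`: the initial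
topology on `ψ^* N` for the maps `f ↦ φ^*(h.f)` is a competitor for the topology of `ψ^* N`. -/
theorem continuous_pulls_pull {φ : G → H} {ψ : H → K} (hψ : CloseOn (imageTranslates φ) ψ ψ)
    (hψφ : Pulls N.toRes L.toRes (ψ ∘ φ)) (hc : Continuous hψφ.map)
    (h : Pulls (N.pull ψ).toRes L.toRes φ) : Continuous h.map := by
  classical
  let Λ : H → (N.pull ψ).toRes.toSubmodule →ₗ[R] L.toRes.toSubmodule := fun i =>
    h.map ∘ₗ (N.pull ψ).toRes.translateMap i
  have hΛ : ∀ i f x, (Λ i f).1 x = f.1 (i⁻¹ * φ x) := fun _ _ _ => rfl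
  have htop := isTopRes_iInf_induced (N.pull ψ).toRes L Λ
    (fun A i => ⟨i, L.toRes.resMap {x | i⁻¹ * φ x ∈ A}, L.isTopRes.continuous_res _, fun f => by
      ext x
      rw [hΛ]
      simp [resMap, Set.indicator_apply, hΛ]⟩)
    (fun g i => ⟨i * g, fun f => by
      ext x
      rw [hΛ, hΛ, translateMap_apply]
      simp [mul_assoc]⟩)
  have hle : (N.pull ψ).top ≤ ⨅ i, TopologicalSpace.induced (Λ i) L.top := by
    refine sInf_le ⟨htop, continuous_iInf_rng.2 fun i => continuous_induced_rng.2 ?_⟩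
    have hcl : (Set.range fun x => ψ (i⁻¹ * φ x) * ((ψ ∘ φ) x)⁻¹).Finite := by
      simpa using closeOn_imageTranslates_iff.1 hψ i⁻¹ 1
    exact continuous_pulls_of_close (hψφ.of_finite_range (u := fun x => ψ (i⁻¹ * φ x)) hcl)
      hψφ hcl hc
  have h1 : (h.map : (N.pull ψ).toRes.toSubmodule → L.toRes.toSubmodule) = Λ 1 := by
    funext f
    ext x
    rw [hΛ]
    simp [Pulls.map]
  rw [h1, continuous_iff_le_induced]
  exact hle.trans (iInf_le _ _)

theorem continuous_invPull_rng {X : Type*} [TopologicalSpace X] {φ : G → H}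
    {q : X → (L.invPull φ).toRes.toSubmodule} :
    Continuous q ↔ ∀ h, Continuous (L.toRes.invPullMap φ h ∘ q) :=
  continuous_iInf_rng.trans (forall_congr' fun _ => continuous_induced_rng)

theorem continuous_pulls_invPull (L : TopResSubmodule R G W) (φ : G → H) :
    Continuous (X := (L.invPull φ).toRes.toSubmodule) (Y := L.toRes.toSubmodule)
      (L.toRes.pulls_invPull φ).map := by
  have : ((L.toRes.pulls_invPull φ).map : (L.invPull φ).toRes.toSubmodule → L.toRes.toSubmodule) =
      L.toRes.invPullMap φ 1 ∘ id := by
    funext f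
    ext x
    rw [Function.comp_apply, invPullMap_apply]
    simp [Pulls.map]
  rw [this]
  exact continuous_invPull_rng.1 continuous_id 1

theorem continuous_pulls_id : Continuous L.toRes.pulls_id.map := continuous_id

/-- `x ↦ ω (a φ(x))` is close to the identity of `G`, so it induces a continuous map on `L`. -/
theorem continuous_pulls_coarseInverse_translate (L : TopResSubmodule R G W) {φ : G → H}
    {ω : H → G} (hφ : IsCoarseEmbedding φ) (hω : IsCoarseInverse φ ω) (a : H) :
    ∃ h : Pulls L.toRes L.toRes (fun x => ω (a * φ x)), Continuous h.map := by
  have hc := (hω.closeOn_comp_id_right hφ {Set.univ})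
  have h1 : Pulls L.toRes L.toRes (ω ∘ φ) := L.toRes.pulls_id.of_close hc
  have h2 : Continuous h1.map := continuous_pulls_of_close h1 L.toRes.pulls_id
    (by simpa using closeOn_univ_iff.1 hc 1 1) continuous_pulls_id
  have hcl : (Set.range fun x => ω (a * φ x) * ((ω ∘ φ) x)⁻¹).Finite := by
    simpa using closeOn_imageTranslates_iff.1 (hω.closeOn hφ) a 1
  exact ⟨h1.of_finite_range hcl, continuous_pulls_of_close _ h1 hcl h2⟩

theorem continuous_pulls_coarseInverse (L : TopResSubmodule R G W) {φ : G → H} {ω : H → G}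
    (hφ : IsCoarseEmbedding φ) (hω : IsCoarseInverse φ ω)
    (h : Pulls L.toRes (L.invPull φ).toRes ω) : Continuous h.map :=
  continuous_invPull_rng.2 fun a =>
    (L.continuous_pulls_coarseInverse_translate hφ hω a⁻¹).choose_spec

/-- The inclusion of `ψ^* N` into a topological res-invariant module is continuous as soon as
`ψ^*` is continuous as a map to this module. -/
theorem exists_continuous_inclusion_pull {N : TopResSubmodule R H W} {ψ : G → H}
    (hψ : IsCoarseMap ψ) (h : Pulls N.toRes L.toRes ψ) (hc : Continuous h.map) :
    ∃ p : (N.pull ψ).toRes.toSubmodule → L.toRes.toSubmodule,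
      (∀ f, (p f).1 = f.1) ∧ Continuous p :=
  have h1 : Pulls N.toRes L.toRes (ψ ∘ id) := h
  ⟨(h1.pull_of_comp (hψ.closeOn _)).map, fun _ => rfl,
    continuous_pulls_pull (hψ.closeOn _) h1 hc _⟩

theorem pull_eq_of_close (M : TopResSubmodule R H W) {φ ϕ : G → H} (hφ : IsCoarseMap φ)
    (hϕ : IsCoarseMap ϕ) (h : IsClose φ ϕ) : M.pull φ = M.pull ϕ := by
  have key : ∀ {φ ϕ : G → H}, IsCoarseMap φ → CloseOn {Set.univ} φ ϕ →
      ∃ p : (M.pull φ).toRes.toSubmodule → (M.pull ϕ).toRes.toSubmodule,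
        (∀ f, (p f).1 = f.1) ∧ Continuous p := by
    intro φ ϕ hφ h
    exact exists_continuous_inclusion_pull hφ ((M.toRes.pulls_pull ϕ).of_close h)
      (continuous_pulls_of_close _ (M.toRes.pulls_pull ϕ)
        (by simpa using closeOn_univ_iff.1 h 1 1) (M.continuous_pull_map ϕ))
  have hc := h.closeOn hφ {Set.univ}
  obtain ⟨p, hp, hpc⟩ := key hφ hc
  obtain ⟨q, hq, hqc⟩ := key hϕ hc.symm
  exact ext_of_continuous p hp hpc q hq hqc

theorem pull_pull (N : TopResSubmodule R K W) {φ : G → H} {ψ : H → K} (hφ : IsCoarseMap φ)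
    (hψ : IsCoarseMap ψ) : (N.pull ψ).pull φ = N.pull (ψ ∘ φ) := by
  have h1 : Pulls (N.pull ψ).toRes (N.pull (ψ ∘ φ)).toRes φ :=
    (N.toRes.pulls_pull (ψ ∘ φ)).pull_of_comp (hψ.closeOn _)
  have h2 : Continuous h1.map := continuous_pulls_pull (hψ.closeOn _) _
    (N.continuous_pull_map (ψ ∘ φ)) h1
  have h3 : Pulls N.toRes ((N.pull ψ).pull φ).toRes (ψ ∘ φ) :=
    (N.toRes.pulls_pull ψ).comp ((N.pull ψ).toRes.pulls_pull φ)
  have h4 : Continuous h3.map :=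
    ((N.pull ψ).continuous_pull_map φ).comp (N.continuous_pull_map ψ)
  obtain ⟨p, hp, hpc⟩ := exists_continuous_inclusion_pull hφ h1 h2
  obtain ⟨q, hq, hqc⟩ := exists_continuous_inclusion_pull (hψ.comp hφ) h3 h4
  exact ext_of_continuous p hp hpc q hq hqc

theorem pull_invPull (L : TopResSubmodule R G W) {φ : G → H} {ω : H → G}
    (hφ : IsCoarseEmbedding φ) (hω : IsCoarseInverse φ ω) : (L.invPull φ).pull φ = L := by
  obtain ⟨p, hp, hpc⟩ := exists_continuous_inclusion_pull (N := L.invPull φ) hφ.isCoarseMap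
    (L.toRes.pulls_invPull φ) (L.continuous_pulls_invPull φ)
  have h1 : Pulls L.toRes (L.invPull φ).toRes ω := L.toRes.pulls_coarseInverse hφ hω
  have h2 := L.continuous_pulls_coarseInverse hφ hω h1
  have h3 : Pulls L.toRes ((L.invPull φ).pull φ).toRes (ω ∘ φ) :=
    h1.comp ((L.invPull φ).toRes.pulls_pull φ)
  have h4 : Continuous h3.map := ((L.invPull φ).continuous_pull_map φ).comp h2
  have hc := (hω.closeOn_comp_id_right hφ {Set.univ}).symm
  have h5 : Pulls L.toRes ((L.invPull φ).pull φ).toRes id := h3.of_close hc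
  exact ext_of_continuous p hp hpc h5.map (fun _ => rfl) (continuous_pulls_of_close h5 h3
    (by simpa using closeOn_univ_iff.1 hc 1 1) h4)

end Pull
end TopResSubmodule

/-! ### Continuity of the cochain maps -/

namespace TopResSubmodule

open ResSubmodule

section Cochains

variable {R G H K W : Type u} [CommRing R] [Group G] [Group H] [Group K] [AddCommGroup W]
  [Module R W] [TopologicalSpace R]

/-- The pull-back of cochains along a map `β` whose group components take finitely many values is a
finite sum of restrictions of pull-backs of values of the cochain, hence continuous. -/
theorem continuous_of_eq_cochainLin_comp {L : TopResSubmodule R G W} {M : TopResSubmodule R H W}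
    {m : ℕ} (β : G → Fin (m + 1) → H)
    (hβ : (Set.range fun x => ((homog m).symm (β x)).2).Finite)
    (h : Pulls M.toRes L.toRes fun x => β x 0) (hc : Continuous h.map)
    (q : ((Fin m → H) → M.toRes.toSubmodule) → L.toRes.toSubmodule)
    (hq : ∀ c, (q c).1 = fun x => M.toRes.cochainLin m c (β x)) : Continuous q := by
  have key : q = fun c => ∑ k ∈ hβ.toFinset,
      L.toRes.resMap ((fun x => ((homog m).symm (β x)).2) ⁻¹' {k}) (h.map (c k)) := by
    funext c
    apply Subtype.ext
    rw [AddSubmonoidClass.coe_finsetSum, hq]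
    have := indicator_cochainLin_comp c β Set.univ hβ.toFinset
      fun x _ => hβ.mem_toFinset.2 ⟨x, rfl⟩
    simp only [Set.indicator_univ] at this
    exact this
  rw [key]
  exact continuous_finsetSum _ fun k _ => (L.isTopRes.continuous_res _).comp
    (hc.comp (continuous_apply k))

/-- Composition of a value of `D^*(α)` with a map `u` is continuous if `(α ∘ u)^*` is and `α` is
controlled on the image of `u`. -/
theorem continuous_comp_isCochainPull {L : TopResSubmodule R G W} {M : TopResSubmodule R H W}
    {N : TopResSubmodule R K W} {α : H → K} {D : N.toRes.cochains ⟶ M.toRes.cochains}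
    (hD : IsCochainPull α D) (u : G → H) (hα : CloseOn {Set.range u} α α)
    (h : Pulls N.toRes L.toRes (α ∘ u)) (hc : Continuous h.map)
    (p : M.toRes.toSubmodule → L.toRes.toSubmodule) (hp : ∀ f, (p f).1 = f.1 ∘ u) (n : ℕ)
    (g : Fin n → H) :
    Continuous fun c : (Fin n → K) → N.toRes.toSubmodule =>
      p (((D.f n).hom c : (Fin n → H) → M.toRes.toSubmodule) g) := by
  have h0 : ∀ v, v = α ∘ u → ∃ h : Pulls N.toRes L.toRes v, Continuous h.map := by
    rintro _ rfl
    exact ⟨h, hc⟩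
  obtain ⟨h', hc'⟩ := h0 (fun x => (α ∘ homog n (u x, g)) 0)
    (funext fun x => by simp [homog_apply])
  refine continuous_of_eq_cochainLin_comp (fun x => α ∘ homog n (u x, g)) ?_ h' hc' _ fun c => ?_
  · refine (Set.Finite.pi' fun i : Fin n => hα _ rfl (Fin.partialProd g i.castSucc)⁻¹
      (Fin.partialProd g i.succ)⁻¹).subset ?_
    rintro _ ⟨x, rfl⟩ i
    exact ⟨u x, ⟨x, rfl⟩, rfl⟩
  · rw [hp]
    funext x
    refine (M.toRes.cochainLin_homog _ (u x) g).symm.trans ?_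
    exact congrFun ((isCochainPull_iff D).1 hD n c) _

theorem continuous_isCochainPull {L : TopResSubmodule R G W} {M : TopResSubmodule R H W}
    {φ : G → H} (hφ : IsCoarseMap φ) (h : Pulls M.toRes L.toRes φ) (hc : Continuous h.map)
    {D : M.toRes.cochains ⟶ L.toRes.cochains} (hD : IsCochainPull φ D) (n : ℕ) :
    Continuous (D.f n).hom :=
  continuous_pi fun g => continuous_comp_isCochainPull hD id (hφ.closeOn _) h hc id
    (fun _ => rfl) n g

theorem continuous_isCochainPull_pull (M : TopResSubmodule R H W) {φ : G → H}
    (hφ : IsCoarseMap φ) {D : M.toRes.cochains ⟶ (M.pull φ).toRes.cochains}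
    (hD : IsCochainPull φ D) (n : ℕ) : Continuous (D.f n).hom :=
  continuous_isCochainPull hφ _ (M.continuous_pull_map φ) hD n

theorem continuous_isCochainPull_coarseInverse (L : TopResSubmodule R G W) {φ : G → H}
    {ω : H → G} (hφ : IsCoarseEmbedding φ) (hω : IsCoarseInverse φ ω)
    {D : L.toRes.cochains ⟶ (L.invPull φ).toRes.cochains} (hD : IsCochainPull ω D) (n : ℕ) :
    Continuous (D.f n).hom := by
  refine continuous_pi fun g => continuous_invPull_rng.2 fun a => ?_
  obtain ⟨h, hc⟩ := L.continuous_pulls_coarseInverse_translate hφ hω a⁻¹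
  exact continuous_comp_isCochainPull hD (fun x => a⁻¹ * φ x)
    (fun A hA => hω.closeOn hφ A ⟨a⁻¹, hA⟩) h hc (L.toRes.invPullMap φ a)
    (fun f => funext fun x => L.toRes.invPullMap_apply φ a f x) n g

end Cochains

/-! ### Continuity of the chain maps -/

section Chains

variable {R G H K W : Type u} [CommRing R] [Group G] [Group H] [Group K] [AddCommGroup W]
  [Module R W] [TopologicalSpace R]

theorem continuous_chains_apply (L : TopResSubmodule R G W) {n : ℕ} (g : Fin n → G) :
    Continuous (X := L.toRes.chains.X n) (Y := L.toRes.toSubmodule)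
      fun c : (Fin n → G) →₀ L.toRes.toSubmodule => c g :=
  (continuous_apply g).comp continuous_induced_dom

/-- `D_n(α)` is continuous if `α_*` is and if only finitely many `g` occur in the tuples `(x, g)`
that `αⁿ` maps to tuples with a given group component. -/
theorem continuous_isChainPush {L : TopResSubmodule R G W} {N : TopResSubmodule R H W} {α : G → H}
    (h : Pushes L.toRes N.toRes α) (hc : Continuous h.map)
    {D : L.toRes.chains ⟶ N.toRes.chains} (hD : IsChainPush α D) {n : ℕ}
    (hfin : ∀ k : Fin n → H, {g | ∃ x, ((homog n).symm (α ∘ homog n (x, g))).2 = k}.Finite) :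
    Continuous (D.f n).hom := by
  refine continuous_induced_rng.2 (continuous_pi fun k => ?_)
  let A : (Fin n → G) → Set G := fun g => {x | ((homog n).symm (α ∘ homog n (x, g))).2 = k}
  let E : ((Fin n → G) →₀ L.toRes.toSubmodule) →ₗ[R] N.toRes.toSubmodule :=
    ∑ g ∈ (hfin k).toFinset, h.map ∘ₗ L.toRes.resLin (A g) ∘ₗ Finsupp.lapply g
  have hE : ∀ c, E c = ∑ g ∈ (hfin k).toFinset, h.map (L.toRes.resMap (A g) (c g)) :=
    fun c => LinearMap.sum_apply _ _ _
  have key : ∀ c : (Fin n → G) →₀ L.toRes.toSubmodule,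
      ((D.f n).hom c : (Fin n → H) →₀ N.toRes.toSubmodule) k = E c := by
    refine LinearMap.congr_fun (f := Finsupp.lapply k ∘ₗ (D.f n).hom) ?_
    refine Finsupp.lhom_ext fun g f => Subtype.ext (funext fun y => ?_)
    have h1 : (((D.f n).hom (Finsupp.single g f) : (Fin n → H) →₀ N.toRes.toSubmodule) k).1 y =
        fiberSum (fun x => α ∘ homog n (x, g)) f.1 (homog n (y, k)) := by
      refine (N.toRes.chainLin_homog _ y k).symm.trans ?_
      refine (congrFun ((isChainPush_iff h D).1 hD n (Finsupp.single g f)) _).trans ?_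
      rw [chainLin_single, fiberSum_comp]
      · rfl
      · exact h.chainFinite_apply (θ := fun x => α ∘ x) 0 (fun _ => rfl) g f.1 f.2
    have h2 : (E (Finsupp.single g f)).1 y = fiberSum α ((A g).indicator f.1) y := by
      classical
      rw [hE, Finset.sum_eq_single g]
      · rw [Finsupp.single_eq_same]
        rfl
      · intro g' _ hg
        have : L.toRes.resMap (A g') 0 = 0 := (L.toRes.resLin (A g')).map_zero
        rw [Finsupp.single_eq_of_ne hg, this, map_zero]
      · intro hg
        have : A g = ∅ := Set.eq_empty_of_forall_notMem fun x hx =>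
          hg ((hfin k).mem_toFinset.2 ⟨x, hx⟩)
        have : L.toRes.resMap (A g) (Finsupp.single g f g) = 0 := by
          apply Subtype.ext
          refine (congrArg (fun B : Set G => B.indicator _) this).trans ?_
          exact Set.indicator_empty _
        rw [this, map_zero]
    refine h1.trans (Eq.trans ?_ h2.symm)
    have h3 : (fun x => α ∘ homog n (x, g)) ⁻¹' {homog n (y, k)} = α ⁻¹' {y} ∩ A g := by
      ext x
      rw [Set.mem_preimage, Set.mem_singleton_iff, ← Equiv.symm_apply_eq, Prod.ext_iff]
      refine and_congr ?_ Iff.rfl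
      simp [homog_symm_apply, homog_apply]
    rw [fiberSum, fiberSum, h3, finsum_mem_def, finsum_mem_def, Set.indicator_indicator]
  have key' : (fun c : L.toRes.chains.X n =>
      ((D.f n).hom c : (Fin n → H) →₀ N.toRes.toSubmodule) k) =
      fun c : (Fin n → G) →₀ L.toRes.toSubmodule =>
        ∑ g ∈ (hfin k).toFinset, h.map (L.toRes.resMap (A g) (c g)) :=
    funext fun c => (key c).trans (hE c)
  refine (congrArg Continuous key').mpr ?_
  exact continuous_finsetSum _ fun g _ =>
    hc.comp ((L.isTopRes.continuous_res _).comp (L.continuous_chains_apply g))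

/-- For a coarse embedding `φ` the values `φ xᵢ (φ xᵢ₊₁)⁻¹` restrict `xᵢ xᵢ₊₁⁻¹` to a finite set, so
`D_n(φ)` is continuous. -/
theorem continuous_isChainPush_of_isCoarseEmbedding (L : TopResSubmodule R G W) {φ : G → H}
    (hφ : IsCoarseEmbedding φ) {D : L.toRes.chains ⟶ (L.push φ).toRes.chains}
    (hD : IsChainPush φ D) (n : ℕ) : Continuous (D.f n).hom := by
  refine continuous_isChainPush _ (L.continuous_push_map hφ.isCoarseMap) hD fun k => ?_
  have hF := (hφ {p | φ p.1 * (φ p.2)⁻¹ ∈ Set.range k}).2 ((Set.finite_range k).subset (by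
    rintro _ ⟨p, hp, rfl⟩
    exact hp))
  refine (Set.Finite.pi' fun _ : Fin n => hF).subset ?_
  rintro g ⟨x, hx⟩ i
  refine ⟨(homog n (x, g) i.castSucc, homog n (x, g) i.succ), ⟨i, ?_⟩, ?_⟩
  · exact (congrFun hx i).symm
  · exact congrFun (congrArg Prod.snd ((homog n).symm_apply_apply (x, g))) i

theorem continuous_isChainPush_coarseInverse_zero (L : TopResSubmodule R G W) {φ : G → H}
    {ω : H → G} (hφ : IsCoarseEmbedding φ) (hω : IsCoarseInverse φ ω)
    {D : (L.push φ).toRes.chains ⟶ L.toRes.chains} (hD : IsChainPush ω D) :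
    Continuous (D.f 0).hom :=
  continuous_isChainPush (L.toRes.pushes_coarseInverse hφ hω)
    (L.continuous_pushes_coarseInverse hφ hω _) hD fun _ => Set.toFinite _

end Chains
end TopResSubmodule

/-! ### Vanishing of reduced homology in positive degrees -/

section Vanishing

variable {R G H W : Type u} [CommRing R] [Group G] [Group H] [AddCommGroup W] [Module R W]

namespace ResSubmodule

theorem range_d_le_boundarySubmodule (L : ResSubmodule R G W) (n : ℕ) :
    LinearMap.range (L.chains.d (n + 2) (n + 1)).hom ≤ boundarySubmodule L.chains (n + 1) := by
  have : ∀ j, j = n + 2 → LinearMap.range (L.chains.d (n + 2) (n + 1)).hom ≤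
      LinearMap.range (L.chains.d j (n + 1)).hom := by
    rintro j rfl
    exact le_rfl
  exact this _ (ChainComplex.prev ℕ (n + 1))

/-- If `G` is infinite, then every chain of positive degree agrees with a boundary on any given
finite set `I` of coordinates: with `b` the cone over the chain with apex `a`, the other terms of
the differential of `b` leave `I` when `a` is far away. -/
theorem exists_boundary_eqOn [Infinite G] (L : ResSubmodule R G W) (n : ℕ)
    (z : (Fin (n + 1) → G) →₀ L.toSubmodule) (I : Finset (Fin (n + 1) → G)) :
    ∃ b : (Fin (n + 2) → G) →₀ L.toSubmodule, ∀ i ∈ I,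
      ((L.chains.d (n + 2) (n + 1)).hom b : (Fin (n + 1) → G) →₀ L.toSubmodule) i = z i := by
  classical
  -- `a` is the first entry of the inner faces that do not contract at `0`, and `a * g 0` that of
  -- the face that does
  obtain ⟨a, ha⟩ := Infinite.exists_notMem_finset
    (I.image (fun i => i 0) ∪ (I ×ˢ z.support).image fun p => p.1 0 * (p.2 0)⁻¹)
  rw [Finset.mem_union, not_or, Finset.mem_image, Finset.mem_image] at ha
  refine ⟨∑ g ∈ z.support, Finsupp.single (Fin.cons a g : Fin (n + 2) → G) (L.rho a (z g)),
    fun i hi => ?_⟩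
  have key : ∀ g ∈ z.support, ((L.chains.d (n + 2) (n + 1)).hom
      (Finsupp.single (Fin.cons a g : Fin (n + 2) → G) (L.rho a (z g))) :
        (Fin (n + 1) → G) →₀ L.toSubmodule) i =
          (Finsupp.single g (z g) : _ →₀ L.toSubmodule) i := by
    intro g hg
    rw [groupHomology.inhomogeneousChains.d_def]
    have hd := groupHomology.inhomogeneousChains.d_single (A := L.rep) (n + 1)
      (Fin.cons a g : Fin (n + 2) → G) (L.rho a (z g))
    refine (congrArg (fun c : (Fin (n + 1) → G) →₀ L.toSubmodule => c i) hd).trans ?_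
    have h1 : L.rho a⁻¹ (L.rho a (z g)) = z g := by
      rw [← Module.End.mul_apply, ← map_mul, inv_mul_cancel, map_one, Module.End.one_apply]
    have h2 : ∀ j : Fin (n + 2),
        Fin.contractNth j (· * ·) (Fin.cons a g : Fin (n + 2) → G) ≠ i := by
      rintro j rfl
      by_cases hj : j = 0
      · subst hj
        have h0 : Fin.contractNth 0 (· * ·) (Fin.cons a g : Fin (n + 2) → G) 0 = a * g 0 :=
          Fin.contractNth_apply_of_eq _ _ _ _ rfl
        refine ha.2 ⟨(_, g), Finset.mk_mem_product hi hg, ?_⟩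
        exact mul_inv_eq_iff_eq_mul.2 h0
      · refine ha.1 ⟨_, hi, ?_⟩
        rw [Fin.contractNth_apply_of_lt]
        · rfl
        · exact Fin.pos_iff_ne_zero.2 hj
    refine (congrArg₂ (· + ·) ?_ ?_).trans (add_zero _)
    · exact congrArg (fun f => (Finsupp.single g f : _ →₀ L.toSubmodule) i) h1
    · refine (Finsupp.finsetSum_apply _ _ _).trans (Finset.sum_eq_zero fun j _ => ?_)
      refine (Finsupp.smul_apply _ _ _).trans ?_
      rw [Finsupp.single_eq_of_ne (h2 j).symm]
      exact smul_zero _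
  rw [map_sum]
  refine (Finsupp.finsetSum_apply _ _ _).trans ((Finset.sum_congr rfl key).trans ?_)
  rw [← Finsupp.finsetSum_apply]
  exact congrArg (fun c : (Fin (n + 1) → G) →₀ L.toSubmodule => c i) z.sum_single

/-- If `G` is finite, then the map from `G` to the trivial group is a coarse embedding, so the
homology of `G` in positive degrees is that of the trivial group. -/
theorem cycleSubmodule_le_boundarySubmodule_of_finite [Finite G] (L : ResSubmodule R G W) (n : ℕ) :
    cycleSubmodule L.chains (n + 1) ≤ boundarySubmodule L.chains (n + 1) := by
  let φ : G → PUnit.{u + 1} := fun _ => PUnit.unit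
  have hφ : IsCoarseEmbedding φ := fun S => iff_of_true (Set.toFinite _) (Set.toFinite _)
  obtain ⟨ω, hω⟩ := exists_isCoarseInverse φ
  obtain ⟨D, D', -, -, h, h'⟩ := L.exists_isChainPush_inverse hφ hω
  have hz : Limits.IsZero (L.chains.homology (n + 1)) :=
    (isZero_groupHomology_succ_of_subsingleton (L.push φ).rep n).of_iso
      (homologyIsoOfHomotopy D D' h h' (n + 1))
  rw [← HomologicalComplex.exactAt_iff_isZero_homology, HomologicalComplex.exactAt_iff,
    ShortComplex.moduleCat_exact_iff] at hz
  intro z hz'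
  exact hz z hz'

end ResSubmodule

namespace TopResSubmodule

open ResSubmodule

variable [TopologicalSpace R]

/-- A basic open set for pointwise convergence constrains finitely many coordinates only. -/
theorem dense_boundarySubmodule_of_infinite [Infinite G] (L : TopResSubmodule R G W) (n : ℕ) :
    Dense (boundarySubmodule L.toRes.chains (n + 1) : Set (L.toRes.chains.X (n + 1))) := by
  intro z
  rw [mem_closure_iff]
  rintro _ ⟨U, hU, rfl⟩ hz
  obtain ⟨I, u, hu, hUI⟩ := isOpen_pi_iff.1 hU _ hz
  obtain ⟨b, hb⟩ := exists_boundary_eqOn L.toRes n z I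
  refine ⟨_, hUI fun i hi => ?_, range_d_le_boundarySubmodule L.toRes n ⟨b, rfl⟩⟩
  exact (congrArg (· ∈ u i) (hb i hi)).mpr (hu i hi).2

theorem subsingleton_redHomology_succ (L : TopResSubmodule R G W) (n : ℕ) :
    Subsingleton (L.RedHomology (n + 1)) := by
  rw [Submodule.Quotient.subsingleton_iff, eq_top_iff]
  rintro ⟨z, hz⟩ -
  change z ∈ closure (boundarySubmodule L.toRes.chains (n + 1) : Set (L.toRes.chains.X (n + 1)))
  cases finite_or_infinite G with
  | inl h => exact subset_closure (cycleSubmodule_le_boundarySubmodule_of_finite L.toRes n hz)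
  | inr h => exact L.dense_boundarySubmodule_of_infinite n z

/-- In degree `0`, the inverse is induced by `D_0(ω)`, which is continuous. The maps `D_n(ω)`,
`n ≥ 1`, need not be continuous, but reduced homology vanishes in these degrees. -/
theorem exists_isRedHomologyMap_equiv (L : TopResSubmodule R G W) {φ : G → H}
    {ω : H → G} (hφ : IsCoarseEmbedding φ) (hω : IsCoarseInverse φ ω) (n : ℕ) :
    ∃ e : L.RedHomology n ≃L[R] (L.push φ).RedHomology n, IsRedHomologyMap φ L (L.push φ) n e := by
  obtain ⟨D, D', hD, hD', h, h'⟩ : ∃ (D : L.toRes.chains ⟶ (L.push φ).toRes.chains)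
      (D' : (L.push φ).toRes.chains ⟶ L.toRes.chains), IsChainPush φ D ∧ IsChainPush ω D' ∧
        Nonempty (Homotopy (D ≫ D') (𝟙 _)) ∧ Nonempty (Homotopy (D' ≫ D) (𝟙 _)) :=
    L.toRes.exists_isChainPush_inverse hφ hω
  have hc := L.continuous_isChainPush_of_isCoarseEmbedding hφ hD
  cases n with
  | zero =>
    obtain ⟨e, he⟩ := exists_reducedEquiv D D' h h' 0 (hc 0)
      (L.continuous_isChainPush_coarseInverse_zero hφ hω hD')
    exact ⟨e, D, hD, he⟩
  | succ n =>
    obtain ⟨T, hT⟩ := exists_isReducedMap D (n + 1) (hc (n + 1))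
    have h1 := L.subsingleton_redHomology_succ n
    have h2 := (L.push φ).subsingleton_redHomology_succ n
    exact ⟨ContinuousLinearEquiv.equivOfInverse T 0 (fun x => Subsingleton.elim _ _)
      fun x => Subsingleton.elim _ _, D, hD, hT⟩

end TopResSubmodule

end Vanishing

theorem mainTheorem2 {R W G H : Type u} [CommRing R] [AddCommGroup W] [Module R W]
    [Group G] [Group H] [Countable G] [Countable H]
    (φ : G → H) (hφ : IsCoarseMap φ) :
    -- homology
    (∀ L : ResSubmodule R G W,
      (∀ n, ∃! T : groupHomology L.rep n ⟶ groupHomology (L.push φ).rep n,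
        IsHomologyMap φ L (L.push φ) n T) ∧
      (IsCoarseEmbedding φ → ∀ ω : H → G, IsCoarseInverse φ ω → ∀ n,
        ∃ e : groupHomology L.rep n ≅ groupHomology (L.push φ).rep n,
          IsHomologyMap φ L (L.push φ) n e.hom ∧ IsHomologyMap ω (L.push φ) L n e.inv) ∧
      (∀ ϕ : G → H, IsCoarseMap ϕ → IsClose φ ϕ → L.push φ = L.push ϕ ∧
        ∀ n, ∃ T : groupHomology L.rep n ⟶ groupHomology (L.push φ).rep n,
          IsHomologyMap φ L (L.push φ) n T ∧ IsHomologyMap ϕ L (L.push φ) n T) ∧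
      (∀ {K : Type u} [Group K] [Countable K] (ψ : H → K), IsCoarseMap ψ →
        (L.push φ).push ψ = L.push (ψ ∘ φ) ∧
        ∀ n, ∃ (T : groupHomology L.rep n ⟶ groupHomology (L.push φ).rep n)
          (S : groupHomology (L.push φ).rep n ⟶ groupHomology ((L.push φ).push ψ).rep n),
          IsHomologyMap φ L (L.push φ) n T ∧
          IsHomologyMap ψ (L.push φ) ((L.push φ).push ψ) n S ∧
          IsHomologyMap (ψ ∘ φ) L ((L.push φ).push ψ) n (T ≫ S))) ∧
    -- reduced homology
    (∀ [TopologicalSpace R] [IsTopologicalRing R] (L : TopResSubmodule R G W),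
      IsCoarseEmbedding φ →
      (∀ n, ∃ e : L.RedHomology n ≃L[R] (L.push φ).RedHomology n,
        IsRedHomologyMap φ L (L.push φ) n e) ∧
      (∀ ϕ : G → H, IsCoarseMap ϕ → IsClose φ ϕ → L.push φ = L.push ϕ ∧
        ∀ n, ∃ T : L.RedHomology n →L[R] (L.push φ).RedHomology n,
          IsRedHomologyMap φ L (L.push φ) n T ∧ IsRedHomologyMap ϕ L (L.push φ) n T) ∧
      (∀ {K : Type u} [Group K] [Countable K] (ψ : H → K), IsCoarseEmbedding ψ →
        (L.push φ).push ψ = L.push (ψ ∘ φ) ∧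
        ∀ n, ∃ (T : L.RedHomology n →L[R] (L.push φ).RedHomology n)
          (S : (L.push φ).RedHomology n →L[R] ((L.push φ).push ψ).RedHomology n),
          IsRedHomologyMap φ L (L.push φ) n T ∧
          IsRedHomologyMap ψ (L.push φ) ((L.push φ).push ψ) n S ∧
          IsRedHomologyMap (ψ ∘ φ) L ((L.push φ).push ψ) n (S.comp T))) ∧
    -- cohomology
    (∀ M : ResSubmodule R H W,
      (∀ n, ∃! T : groupCohomology M.rep n ⟶ groupCohomology (M.pull φ).rep n,
        IsCohomologyMap φ M (M.pull φ) n T) ∧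
      (∀ ϕ : G → H, IsCoarseMap ϕ → IsClose φ ϕ → M.pull φ = M.pull ϕ ∧
        ∀ n, ∃ T : groupCohomology M.rep n ⟶ groupCohomology (M.pull φ).rep n,
          IsCohomologyMap φ M (M.pull φ) n T ∧ IsCohomologyMap ϕ M (M.pull φ) n T)) ∧
    (IsCoarseEmbedding φ → ∀ L : ResSubmodule R G W, (L.invPull φ).pull φ = L ∧
      ∀ ω : H → G, IsCoarseInverse φ ω → ∀ n,
        ∃ e : groupCohomology (L.invPull φ).rep n ≅ groupCohomology L.rep n,
          IsCohomologyMap φ (L.invPull φ) L n e.hom ∧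
          IsCohomologyMap ω L (L.invPull φ) n e.inv) ∧
    (∀ {K : Type u} [Group K] [Countable K] (ψ : H → K), IsCoarseMap ψ →
      ∀ N : ResSubmodule R K W, (N.pull ψ).pull φ = N.pull (ψ ∘ φ) ∧
        ∀ n, ∃ (T : groupCohomology N.rep n ⟶ groupCohomology (N.pull ψ).rep n)
          (S : groupCohomology (N.pull ψ).rep n ⟶ groupCohomology ((N.pull ψ).pull φ).rep n),
          IsCohomologyMap ψ N (N.pull ψ) n T ∧
          IsCohomologyMap φ (N.pull ψ) ((N.pull ψ).pull φ) n S ∧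
          IsCohomologyMap (ψ ∘ φ) N ((N.pull ψ).pull φ) n (T ≫ S)) ∧
    -- reduced cohomology
    (∀ [TopologicalSpace R] [IsTopologicalRing R], IsCoarseEmbedding φ →
      (∀ M : TopResSubmodule R H W,
        (∀ n, ∃ T : M.RedCohomology n →L[R] (M.pull φ).RedCohomology n,
          IsRedCohomologyMap φ M (M.pull φ) n T) ∧
        (∀ ϕ : G → H, IsCoarseMap ϕ → IsClose φ ϕ → M.pull φ = M.pull ϕ ∧
          ∀ n, ∃ T : M.RedCohomology n →L[R] (M.pull φ).RedCohomology n,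
            IsRedCohomologyMap φ M (M.pull φ) n T ∧ IsRedCohomologyMap ϕ M (M.pull φ) n T)) ∧
      (∀ L : TopResSubmodule R G W, (L.invPull φ).pull φ = L ∧
        ∀ n, ∃ e : (L.invPull φ).RedCohomology n ≃L[R] L.RedCohomology n,
          IsRedCohomologyMap φ (L.invPull φ) L n e) ∧
      (∀ {K : Type u} [Group K] [Countable K] (ψ : H → K), IsCoarseEmbedding ψ →
        ∀ N : TopResSubmodule R K W, (N.pull ψ).pull φ = N.pull (ψ ∘ φ) ∧
          ∀ n, ∃ (T : N.RedCohomology n →L[R] (N.pull ψ).RedCohomology n)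
            (S : (N.pull ψ).RedCohomology n →L[R] ((N.pull ψ).pull φ).RedCohomology n),
            IsRedCohomologyMap ψ N (N.pull ψ) n T ∧
            IsRedCohomologyMap φ (N.pull ψ) ((N.pull ψ).pull φ) n S ∧
            IsRedCohomologyMap (ψ ∘ φ) N ((N.pull ψ).pull φ) n (S.comp T))) := by
  refine ⟨fun L => ⟨?_, ?_, ?_, ?_⟩, fun {_ _} L hφe => ⟨?_, ?_, ?_⟩, fun M => ⟨?_, ?_⟩,
    fun hφe L => ⟨?_, ?_⟩, ?_, fun {_ _} hφe => ⟨fun M => ⟨?_, ?_⟩, fun L => ⟨?_, ?_⟩, ?_⟩⟩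
  · intro n
    obtain ⟨D, hD⟩ := L.exists_isChainPush hφ
    refine ⟨HomologicalComplex.homologyMap D n, ⟨D, hD, rfl⟩, ?_⟩
    rintro _ ⟨D', hD', rfl⟩
    rw [hD'.unique hD]
  · intro hφe ω hω n
    obtain ⟨D, D', hD, hD', h, h'⟩ := L.exists_isChainPush_inverse hφe hω
    exact ⟨homologyIsoOfHomotopy D D' h h' n, ⟨D, hD, rfl⟩, D', hD', rfl⟩
  · intro ϕ hϕ h
    obtain ⟨D, D', hD, hD', hs⟩ := L.exists_isChainPush_of_close hφ hϕ h
    exact ⟨L.push_eq_of_close hφ hϕ h, fun n => ⟨HomologicalComplex.homologyMap D n,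
      ⟨D, hD, rfl⟩, D', hD', (hs.some.homologyMap_eq n).symm⟩⟩
  · intro K _ _ ψ hψ
    obtain ⟨D, hD⟩ := L.exists_isChainPush hφ
    obtain ⟨D', hD'⟩ := (L.push φ).exists_isChainPush hψ
    exact ⟨L.push_push hφ hψ, fun n => ⟨HomologicalComplex.homologyMap D n,
      HomologicalComplex.homologyMap D' n, ⟨D, hD, rfl⟩, ⟨D', hD', rfl⟩, D ≫ D',
      hD.comp_push hφ hψ hD', (HomologicalComplex.homologyMap_comp D D' n).symm⟩⟩
  · obtain ⟨ω, hω⟩ := exists_isCoarseInverse φ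
    exact L.exists_isRedHomologyMap_equiv hφe hω
  · intro ϕ hϕ h
    obtain ⟨D, D', hD, hD', hs⟩ : ∃ D D' : L.toRes.chains ⟶ (L.push φ).toRes.chains,
      IsChainPush φ D ∧ IsChainPush ϕ D' ∧ Nonempty (Homotopy D' D) :=
        L.toRes.exists_isChainPush_of_close hφ hϕ h
    refine ⟨L.push_eq_of_close hφ hϕ h, fun n => ?_⟩
    obtain ⟨T, hT⟩ := exists_isReducedMap D n
      (L.continuous_isChainPush_of_isCoarseEmbedding hφe hD n)
    exact ⟨T, ⟨D, hD, hT⟩, D', hD', hT.of_homotopy hs.some⟩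
  · intro K _ _ ψ hψ
    obtain ⟨D, hD⟩ : ∃ D : L.toRes.chains ⟶ (L.push φ).toRes.chains, IsChainPush φ D :=
      L.toRes.exists_isChainPush hφ
    obtain ⟨D', hD'⟩ : ∃ D : (L.push φ).toRes.chains ⟶ ((L.push φ).push ψ).toRes.chains,
      IsChainPush ψ D := (L.push φ).toRes.exists_isChainPush hψ.isCoarseMap
    refine ⟨L.push_push hφ hψ.isCoarseMap, fun n => ?_⟩
    obtain ⟨T, hT⟩ := exists_isReducedMap D n
      (L.continuous_isChainPush_of_isCoarseEmbedding hφe hD n)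
    obtain ⟨S, hS⟩ := exists_isReducedMap D' n
      ((L.push φ).continuous_isChainPush_of_isCoarseEmbedding hψ hD' n)
    exact ⟨T, S, ⟨D, hD, hT⟩, ⟨D', hD', hS⟩, D ≫ D',
      IsChainPush.comp_push hφ hψ.isCoarseMap hD hD', hT.comp hS⟩
  · intro n
    obtain ⟨D, hD⟩ := M.exists_isCochainPull hφ
    refine ⟨HomologicalComplex.homologyMap D n, ⟨D, hD, rfl⟩, ?_⟩
    rintro _ ⟨D', hD', rfl⟩
    rw [hD'.unique hD]
  · intro ϕ hϕ h
    obtain ⟨D, D', hD, hD', hs⟩ := M.exists_isCochainPull_of_close hφ hϕ h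
    exact ⟨M.pull_eq_of_close hφ h, fun n => ⟨HomologicalComplex.homologyMap D n,
      ⟨D, hD, rfl⟩, D', hD', (hs.some.homologyMap_eq n).symm⟩⟩
  · obtain ⟨ω, hω⟩ := exists_isCoarseInverse φ
    exact L.pull_invPull hφe hω
  · intro ω hω n
    obtain ⟨D, D', hD, hD', h, h'⟩ := L.exists_isCochainPull_inverse hφe hω
    exact ⟨homologyIsoOfHomotopy D D' h h' n, ⟨D, hD, rfl⟩, D', hD', rfl⟩
  · intro K _ _ ψ hψ N
    obtain ⟨D, hD⟩ := N.exists_isCochainPull hψ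
    obtain ⟨D', hD'⟩ := (N.pull ψ).exists_isCochainPull hφ
    exact ⟨N.pull_pull hψ, fun n => ⟨HomologicalComplex.homologyMap D n,
      HomologicalComplex.homologyMap D' n, ⟨D, hD, rfl⟩, ⟨D', hD', rfl⟩, D ≫ D',
      hD.comp hD', (HomologicalComplex.homologyMap_comp D D' n).symm⟩⟩
  · intro n
    obtain ⟨D, hD⟩ : ∃ D : M.toRes.cochains ⟶ (M.pull φ).toRes.cochains, IsCochainPull φ D :=
      M.toRes.exists_isCochainPull hφ
    obtain ⟨T, hT⟩ := exists_isReducedMap D n (M.continuous_isCochainPull_pull hφ hD n)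
    exact ⟨T, D, hD, hT⟩
  · intro ϕ hϕ h
    obtain ⟨D, D', hD, hD', hs⟩ : ∃ D D' : M.toRes.cochains ⟶ (M.pull φ).toRes.cochains,
      IsCochainPull φ D ∧ IsCochainPull ϕ D' ∧ Nonempty (Homotopy D' D) :=
        M.toRes.exists_isCochainPull_of_close hφ hϕ h
    refine ⟨M.pull_eq_of_close hφ hϕ h, fun n => ?_⟩
    obtain ⟨T, hT⟩ := exists_isReducedMap D n (M.continuous_isCochainPull_pull hφ hD n)
    exact ⟨T, ⟨D, hD, hT⟩, D', hD', hT.of_homotopy hs.some⟩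
  · obtain ⟨ω, hω⟩ := exists_isCoarseInverse φ
    exact L.pull_invPull hφe hω
  · intro n
    obtain ⟨ω, hω⟩ := exists_isCoarseInverse φ
    obtain ⟨D, D', hD, hD', h, h'⟩ : ∃ (D : (L.invPull φ).toRes.cochains ⟶ L.toRes.cochains)
        (D' : L.toRes.cochains ⟶ (L.invPull φ).toRes.cochains), IsCochainPull φ D ∧
        IsCochainPull ω D' ∧ Nonempty (Homotopy (D ≫ D') (𝟙 _)) ∧
        Nonempty (Homotopy (D' ≫ D) (𝟙 _)) := L.toRes.exists_isCochainPull_inverse hφe hω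
    obtain ⟨e, he⟩ := exists_reducedEquiv D D' h h' n
      (TopResSubmodule.continuous_isCochainPull hφ _ (L.continuous_pulls_invPull φ) hD n)
      (L.continuous_isCochainPull_coarseInverse hφe hω hD' n)
    exact ⟨e, D, hD, he⟩
  · intro K _ _ ψ hψ N
    obtain ⟨D, hD⟩ : ∃ D : N.toRes.cochains ⟶ (N.pull ψ).toRes.cochains, IsCochainPull ψ D :=
      N.toRes.exists_isCochainPull hψ.isCoarseMap
    obtain ⟨D', hD'⟩ : ∃ D : (N.pull ψ).toRes.cochains ⟶ ((N.pull ψ).pull φ).toRes.cochains,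
      IsCochainPull φ D := (N.pull ψ).toRes.exists_isCochainPull hφ
    refine ⟨N.pull_pull hφ hψ.isCoarseMap, fun n => ?_⟩
    obtain ⟨T, hT⟩ := exists_isReducedMap D n
      (N.continuous_isCochainPull_pull hψ.isCoarseMap hD n)
    obtain ⟨S, hS⟩ := exists_isReducedMap D' n
      ((N.pull ψ).continuous_isCochainPull_pull hφ hD' n)
    exact ⟨T, S, ⟨D, hD, hT⟩, ⟨D', hD', hS⟩, D ≫ D', hD.comp hD', hT.comp hS⟩
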